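/- Let $k$ be a real quadratic field with ring of integers $\mathcal O$, let $\bar{\mathbb Q}\subset\mathbb C$ be the field of algebraic numbers, let $I$ be a (non-zero) fractional ideal of $k$ and let $\xi$ be a character of the additive group $I$ with values in the complex roots of unity. Let $\mathfrak f=\{a\in\mathcal O:\xi(ax)=1\ \forall x\in I\}$ be its annihilator, assume $\mathfrak f\neq\mathcal O$, and write $\mathfrak f\cap\mathbb Z=f\mathbb Z$ with $f>0$. Let $\tau_1,\tau_2\in I$ be totally positive and linearly independent over $\mathbb Q$, with $\xi(\tau_1)\ne1$ and $\xi(\tau_2)\neq 1$. Put $$P(\tau_1,\tau_2)=\{\lambda\tau_1+\mu\tau_2:\lambda,\mu\in\mathbb Q,\ 0<\lambda\le1,\ 0\le\mu<1\},\qquad C(\tau_1,\tau_2)=\{\lambda\tau_1+\mu\tau_2:\lambda,\mu\in\mathbb Q,\ 0<\lambda,\ 0\le\mu\}.$$ Let $p$ be a prime number such that $(p,\mathfrak f)=1$, such that $p\mathcal O=\mathfrak p_1\mathfrak p_2$ with prime ideals $\mathfrak p_1\ne\mathfrak p_2$, and such that $I$ is prime to $p$, i.e. $\mathrm{ord}_{\mathfrak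 p_i}(I)=0$ for $i=1,2$. Denote by $z_{T_p}(s;\xi,I,\tau_1,\tau_2)$ the function given for $\Re(s)>1$ by the absolutely convergent series $$z_{T_p}(s;\xi,I,\tau_1,\tau_2)=\sum_{\substack{a\in I\cap C(\tau_1,\tau_2)\\ p\nmid |I:(a)|}}\frac{\xi(a)}{(\iota_1(a)\iota_2(a))^s},$$ where $\iota_1,\iota_2$ are the two embeddings of $k$ in $\bar{\mathbb Q}$. This function has a meromorphic continuation to $\mathbb C$, denoted in the same way, which is analytic at every integer $m\le0$. Let $w_p$ be the number of roots of unity in $\mathbb Q_p$, $\mathcal M(p)=\{m\in\mathbb Z: m\le0,\ m\equiv1\pmod{w_p}\}$ and $D(p)=1+2\mathbb Z_p$. The values $z_{T_p}(m;\xi,I,\tau_1,\tau_2)$ for $m\in\mathcal M(p)$ are algebraic numbers. Let $\mathbb C_p$ be the completion of an algebraic closure of $\mathbb Q_p$. Then for every embedding $j:\bar{\mathbb Q}\to\mathbb C_p$ the following hold. (i) There is a unique $p$-adically continuous function $z^{(j)}_{T_p,p}(\,\cdot\,;\xi,I,\tau_1,\tau_2):D(p)\to\mathbb C_p$ with $$z^{(j)}_{T_p,p}(m;\xi,I,\tau_1,\tau_2)=j\bigl(z_{T_p}(m;\xi,I,\tau_1,\tau_2)\bigr)\quad\text{for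 all }m\in\mathcal M(p).$$ (ii) For either ordering $\underline\iota=(\iota_1,\iota_2)$ of the two embeddings, let $(1+\underline X)^{\underline\iota(a)}=(1+X_1)^{\iota_1(a)}(1+X_2)^{\iota_2(a)}$ be the product of formal binomial series, let $$F_{\underline\iota}(\underline X;\xi,I,\tau_1,\tau_2)=\frac{\sum_{a\in I\cap P(\tau_1,\tau_2)}\xi(a)(1+\underline X)^{\underline\iota(a)}}{\bigl(1-\xi(\tau_1)(1+\underline X)^{\underline\iota(\tau_1)}\bigr)\bigl(1-\xi(\tau_2)(1+\underline X)^{\underline\iota(\tau_2)}\bigr)}\in\bar{\mathbb Q}[[X_1,X_2]],$$ let $F^j_{\underline\iota}$ be the series obtained from it by applying $j$ to the coefficients, and write $$(1+X_1)^{-1}(1+X_2)^{-1}F_{\underline\iota}(\underline X;\xi,I,\tau_1,\tau_2)^j=\sum_{i,l\ge0}a_{i,l}X_1^iX_2^l.$$ Then $a_{i,l}\in\mathbb Z_p[\mu_f]$ for all $i,l\ge0$, where $\mathbb Z_p[\mu_f]$ is the subring of $\mathbb C_p$ generated by $\mathbb Z_p$ and the $f$-th roots of unity, and, with $c_n=\sum_{\zeta^p=1}(\zeta-1)^n$,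 $$z^{(j)}_{T_p,p}(1;\xi,I,\tau_1,\tau_2)=\frac1{p^2}\sum_{i,l\ge0}\frac{c_{i+1}c_{l+1}a_{i,l}}{(i+1)(l+1)}\in\mathbb Z_p[\mu_f],$$ the series being convergent in $\mathbb C_p$. -/

import Mathlib

open scoped NumberField nonZeroDivisors

namespace ConeZeta

noncomputable section

/-! ### Algebraic numbers, characters and cones -/

/-- The field of algebraic numbers, as a subfield of `ℂ`. -/
abbrev QBar : IntermediateField ℚ ℂ := algebraicClosure ℚ ℂ

/-- The annihilator of an additive character `ξ` of `I`: the ideal of all `a` in the ring of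
integers with `ξ (a x) = 1` for every `x` in `I`. -/
def annihilator {k : Type*} [Field k] {I : Submodule (𝓞 k) k} (ξ : AddChar I QBar) :
    Ideal (𝓞 k) where
  carrier := {a | ∀ x : I, ξ (a • x) = 1}
  add_mem' := by
    intro a b ha hb x
    rw [add_smul, AddChar.map_add_eq_mul, ha x, hb x, one_mul]
  zero_mem' := by
    intro x
    rw [zero_smul, AddChar.map_zero_eq_one]
  smul_mem' := by
    intro c a ha x
    rw [smul_eq_mul, mul_comm, mul_smul]
    exact ha (c • x)

/-- An element of `k` is totally positive if it is positive at every real place. -/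
def TotallyPositive {k : Type*} [Field k] (x : k) : Prop :=
  ∀ φ : k →+* ℝ, 0 < φ x

/-- The half-open parallelogram `{λ τ₁ + μ τ₂ : λ, μ ∈ ℚ, 0 < λ ≤ 1, 0 ≤ μ < 1}`. -/
def parallelogram {k : Type*} [Field k] [CharZero k] (τ₁ τ₂ : k) : Set k :=
  {x | ∃ r t : ℚ, 0 < r ∧ r ≤ 1 ∧ 0 ≤ t ∧ t < 1 ∧ x = r * τ₁ + t * τ₂}

/-- The half-open cone `{λ τ₁ + μ τ₂ : λ, μ ∈ ℚ, 0 < λ, 0 ≤ μ}`. -/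
def cone {k : Type*} [Field k] [CharZero k] (τ₁ τ₂ : k) : Set k :=
  {x | ∃ r t : ℚ, 0 < r ∧ 0 ≤ t ∧ x = r * τ₁ + t * τ₂}

/-! ### The complex partial zeta function -/

/-- The index `|I : (a)|` of the principal fractional ideal generated by `a ∈ I` in `I`. -/
def principalIndex {k : Type*} [Field k] {I : Submodule (𝓞 k) k} (a : I) : ℕ :=
  (Submodule.span (𝓞 k) {a}).toAddSubgroup.index

/-- The index set of the series: the `a ∈ I ∩ C(τ₁, τ₂)` such that `p` does not divide
`|I : (a)|`. -/
def summationSet {k : Type*} [Field k] [CharZero k] (p : ℕ) {I : Submodule (𝓞 k) k}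
    (τ₁ τ₂ : I) : Set I :=
  {a | (a : k) ∈ cone (τ₁ : k) (τ₂ : k) ∧ ¬ p ∣ principalIndex a}

/-- The term `ξ(a) / (ι₁(a) ι₂(a)) ^ s` of the series; the product is taken over all the
embeddings of `k` in `ℂ`. -/
def zetaTerm {k : Type*} [Field k] [NumberField k] {I : Submodule (𝓞 k) k}
    (ξ : AddChar I QBar) (s : ℂ) (a : I) : ℂ :=
  ((ξ a : QBar) : ℂ) / (∏ φ : k →+* ℂ, φ (a : k)) ^ s

/-- `Z` is the meromorphic continuation to `ℂ` of the function given for `Re s > 1` by the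
(absolutely convergent) series of all `ξ(a) / (ι₁(a) ι₂(a)) ^ s` with `a ∈ I ∩ C(τ₁, τ₂)` and
`p ∤ |I : (a)|`, and it is analytic at the integers `m ≤ 0`. -/
structure IsPartialZeta {k : Type*} [Field k] [NumberField k] (p : ℕ) {I : Submodule (𝓞 k) k}
    (ξ : AddChar I QBar) (τ₁ τ₂ : I) (Z : ℂ → ℂ) : Prop where
  hasSum : ∀ s : ℂ, 1 < s.re →
    HasSum (fun a : summationSet p τ₁ τ₂ => zetaTerm ξ s (a : I)) (Z s)
  meromorphic : MeromorphicOn Z Set.univ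
  analyticAt : ∀ m : ℤ, m ≤ 0 → AnalyticAt ℂ Z m

/-! ### The power series -/

/-- The product `(1 + X₁) ^ u₁ (1 + X₂) ^ u₂` of two formal binomial series. -/
def binomialProd {K : Type*} [Field K] [CharZero K] (u : Fin 2 → K) : MvPowerSeries (Fin 2) K :=
  fun n => Ring.choose (u 0) (n 0) * Ring.choose (u 1) (n 1)

/-- The power series attached to `ξ`, `I`, `τ₁`, `τ₂` and the pair `ι` of embeddings of `k`:
the quotient of `∑ ξ(a) (1 + X) ^ ι(a)`, over the finitely many `a ∈ I ∩ P(τ₁, τ₂)`, by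
`(1 - ξ(τ₁) (1 + X) ^ ι(τ₁)) (1 - ξ(τ₂) (1 + X) ^ ι(τ₂))`. -/
def coneSeries {k : Type*} [Field k] [CharZero k] {I : Submodule (𝓞 k) k}
    (ξ : AddChar I QBar) (τ₁ τ₂ : I) (ι : Fin 2 → (k →+* QBar)) : MvPowerSeries (Fin 2) QBar :=
  (∑ᶠ a : {a : I // (a : k) ∈ parallelogram (τ₁ : k) (τ₂ : k)},
      MvPowerSeries.C (ξ a.1) * binomialProd (fun i => ι i (a.1 : k))) *
    ((1 - MvPowerSeries.C (ξ τ₁) * binomialProd (fun i => ι i (τ₁ : k))) *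
      (1 - MvPowerSeries.C (ξ τ₂) * binomialProd (fun i => ι i (τ₂ : k))))⁻¹

/-- The coefficient `a_{i,l}` of `X₁ ^ i X₂ ^ l` in the series `(1 + X₁)⁻¹ (1 + X₂)⁻¹ F ^ j`, where
`F ^ j` is obtained from the power series `F` of `ξ`, `I`, `τ₁`, `τ₂`, `ι` by applying `j` to its
coefficients. -/
def coneCoeff {k : Type*} [Field k] [CharZero k] {I : Submodule (𝓞 k) k}
    (ξ : AddChar I QBar) (τ₁ τ₂ : I) (ι : Fin 2 → (k →+* QBar)) {L : Type*} [Field L]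
    (j : QBar →+* L) (i l : ℕ) : L :=
  MvPowerSeries.coeff (Finsupp.single 0 i + Finsupp.single 1 l)
    (((1 + MvPowerSeries.X 0) * (1 + MvPowerSeries.X 1))⁻¹ *
      MvPowerSeries.map j (coneSeries ξ τ₁ τ₂ ι))

/-! ### The `p`-adic side -/

/-- The number `w_p` of roots of unity in `ℚ_p`. -/
def numRootsOfUnity (p : ℕ) [Fact p.Prime] : ℕ :=
  Nat.card (CommGroup.torsion ℚ_[p]ˣ)

/-- The set `M(p)` of the integers `m ≤ 0` with `m ≡ 1` modulo `w_p`. -/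
def interpolationSet (p : ℕ) [Fact p.Prime] : Set ℤ :=
  {m | m ≤ 0 ∧ m ≡ 1 [ZMOD numRootsOfUnity p]}

/-- The set `D(p) = 1 + 2 ℤ_p`. -/
def interpolationDomain (p : ℕ) [Fact p.Prime] : Set ℤ_[p] :=
  {s | ∃ t : ℤ_[p], s = 1 + 2 * t}

theorem two_dvd_numRootsOfUnity (p : ℕ) [Fact p.Prime] : 2 ∣ numRootsOfUnity p := by
  have hfin : IsOfFinOrder (-1 : ℚ_[p]ˣ) :=
    isOfFinOrder_iff_pow_eq_one.mpr ⟨2, by norm_num, by norm_num⟩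
  set u : CommGroup.torsion ℚ_[p]ˣ := ⟨-1, hfin⟩ with hu
  have hcoe : (u : ℚ_[p]ˣ) = -1 := rfl
  have h2 : orderOf u = 2 := by
    refine orderOf_eq_prime (Subtype.ext ?_) ?_
    · rw [Subgroup.coe_pow, hcoe]
      simp
    · intro h
      have h1 : (-1 : ℚ_[p]ˣ) = 1 := by rw [← hcoe, h, Subgroup.coe_one]
      have h' : (-1 : ℚ_[p]) = 1 := by
        simpa using congrArg (fun v : ℚ_[p]ˣ => (v : ℚ_[p])) h1
      norm_num at h'
  rw [← h2]
  exact orderOf_dvd_natCard _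

theorem intCast_mem_interpolationDomain {p : ℕ} [Fact p.Prime] {m : ℤ}
    (hm : m ∈ interpolationSet p) : (m : ℤ_[p]) ∈ interpolationDomain p := by
  have h1 : (2 : ℤ) ∣ m - 1 :=
    (Int.natCast_dvd_natCast.mpr (two_dvd_numRootsOfUnity p)).trans hm.2.symm.dvd
  obtain ⟨t, ht⟩ := h1
  refine ⟨(t : ℤ_[p]), ?_⟩
  have h2 : m = 1 + 2 * t := by omega
  rw [h2]
  push_cast
  ring

theorem one_mem_interpolationDomain (p : ℕ) [Fact p.Prime] :
    (1 : ℤ_[p]) ∈ interpolationDomain p :=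
  ⟨0, by simp⟩

/-- `c_n`, the sum of `(ζ - 1) ^ n` over all `p`-th roots of unity `ζ`, as an element of `ℂ_p`. -/
def rootSum (p : ℕ) [Fact p.Prime] (n : ℕ) : ℂ_[p] :=
  ∑ ζ ∈ Polynomial.nthRootsFinset p (1 : ℂ_[p]), (ζ - 1) ^ n

/-- The subring `ℤ_p[μ_f]` of `ℂ_p`, generated by `ℤ_p` and the `f`-th roots of unity. -/
def cyclotomicInts (p : ℕ) [Fact p.Prime] (f : ℕ) : Subring ℂ_[p] :=
  Subring.closure
    (Set.range (fun x : ℤ_[p] => algebraMap ℚ_[p] ℂ_[p] (x : ℚ_[p])) ∪ {ζ : ℂ_[p] | ζ ^ f = 1})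

/-- `z` is a continuous function on `D(p)` with `z(m) = j(Z(m))` for all `m ∈ M(p)`. -/
structure IsInterpolation {p : ℕ} [Fact p.Prime] (j : QBar →+* ℂ_[p]) (Z : ℂ → ℂ)
    (hZ : ∀ m ∈ interpolationSet p, Z m ∈ QBar) (z : interpolationDomain p → ℂ_[p]) : Prop where
  continuous : Continuous z
  interpolates : ∀ (m : ℤ) (hm : m ∈ interpolationSet p),
    z ⟨m, intCast_mem_interpolationDomain hm⟩ = j ⟨Z m, hZ m hm⟩

end

end ConeZeta

/-! Cut the cone into translates, by natural multiples of `p τ₁` and `p τ₂`, of the finitely many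
base points `x + i τ₁ + l τ₂` with `x` in the parallelogram and `0 ≤ i, l < p`. Since `p` splits and
`I` is prime to `p`, every embedding of `k` in `ℂ_p` maps `I` into `ℤ_p`, and `p ∤ |I : (a)|` says
that both images of `a` are units (`not_dvd_principalIndex_iff`). This depends on the base point
only. So the partial zeta function is a finite sum of double series `∑ α ^ n β ^ m / (L₀ L₁) ^ s` in
two positive linear forms, with `α = ξ(τ₁) ^ p` and `β = ξ(τ₂) ^ p`. Both differ from `1`, because
`p ∤ f`.

Over `ℂ`, such a series times `Γ(s) ^ 2` is the Mellin transform of an exponential times two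
geometric series, with no pole at the origin. Integration by parts continues it to an entire
function, whose value at `-N` is the derivative of order `(N, N)` at the origin
(`IsDecayingFamily.exists_entire`). That derivative is a `regularizedSum`: expand `(L₀ L₁) ^ N` in
binomial coefficients of `n` and `m`, and replace `∑ α ^ n * choose n i` by `α ^ i / (1 - α) ^ (i +
1)`. The expression is finite and algebraic, so `j` can be applied to it.

On the `p`-adic side, a power series over `ℤ_p[μ_f]` is a measure on `ℤ_p × ℤ_p`. Integrating `h ⊗
h` by means of Mahler coefficients sends `(1 + X) ^ (y - 1)` to `h(y₀) h(y₁)`; the shift by one is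
the factor `(1 + X₁)⁻¹ (1 + X₂)⁻¹`. For `h` equal to `x ^ N` on units and `0` elsewhere, expanding
the denominators yields the same regularised sum (`evalFunctional_geom`), while base points with a
non-unit image contribute `0`. Hence the integral is `j` of the value at `-N`
(`pairing_baseSeries`).

For `-N` in `M(p)` these functions `h` vary uniformly with `N` in the `p`-adic sense, which gives
the interpolation; density of `M(p)` in `D(p)` gives uniqueness. As `-N` tends to `1`, `h` tends to
`x⁻¹` on units, whose Mahler coefficients are `-c_{i+1} / (p (i + 1))`
(`intToComplex_mahlerCoeff_unitInv`). This is the series at `1`, and its sum stays in `ℤ_p[μ_f]`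
because that ring is closed. -/

namespace ConeZeta
open MeasureTheory Set Filter Topology Complex

/-! ### Mellin transforms on the positive quadrant -/

/-- A family of functions on `ℝ × ℝ`, closed under both partial derivatives, all of whose members
decay exponentially on the closed first quadrant. -/
structure IsDecayingFamily (F : ℕ → ℕ → ℝ → ℝ → ℂ) : Prop where
  continuous : ∀ a b, Continuous fun t : ℝ × ℝ => F a b t.1 t.2
  hasDerivAt_fst : ∀ a b t₁ t₂, HasDerivAt (fun t => F a b t t₂) (F (a + 1) b t₁ t₂) t₁
  hasDerivAt_snd : ∀ a b t₁ t₂, HasDerivAt (fun t => F a b t₁ t) (F a (b + 1) t₁ t₂) t₂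
  bound : ∀ a b, ∃ C c : ℝ, 0 < c ∧ ∀ t₁ t₂, 0 ≤ t₁ → 0 ≤ t₂ →
    ‖F a b t₁ t₂‖ ≤ C * (Real.exp (-c * t₁) * Real.exp (-c * t₂))

theorem integrableOn_rpow_mul_exp {σ c : ℝ} (hσ : 0 < σ) (hc : 0 < c) :
    IntegrableOn (fun t : ℝ => t ^ (σ - 1) * Real.exp (-c * t)) (Ioi 0) := by
  have := integrableOn_rpow_mul_exp_neg_mul_rpow (p := 1) (s := σ - 1) (b := c)
    (by linarith) one_pos hc
  simpa using this

theorem norm_ofReal_cpow {t : ℝ} (ht : 0 < t) (s : ℂ) : ‖(t : ℂ) ^ s‖ = t ^ s.re :=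
  Complex.norm_cpow_eq_rpow_re_of_pos ht s

theorem aestronglyMeasurable_cpow (s : ℂ) (ν : Measure ℝ) :
    AEStronglyMeasurable (fun t : ℝ => (t : ℂ) ^ s) ν :=
  (Measurable.pow_const Complex.measurable_ofReal s).aestronglyMeasurable

theorem integrableOn_cpow_mul {f : ℝ → ℂ} (hf : Continuous f) {C c : ℝ} (hc : 0 < c)
    (hb : ∀ t, 0 ≤ t → ‖f t‖ ≤ C * Real.exp (-c * t)) {s : ℂ} (hs : 0 < s.re) :
    IntegrableOn (fun t : ℝ => (t : ℂ) ^ (s - 1) * f t) (Ioi 0) := by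
  refine Integrable.mono' (((integrableOn_rpow_mul_exp hs hc).const_mul C)) 
    ((aestronglyMeasurable_cpow _ _).mul hf.aestronglyMeasurable) ?_
  refine (ae_restrict_iff' measurableSet_Ioi).2 (Eventually.of_forall fun t ht => ?_)
  have ht : 0 < t := ht
  rw [norm_mul, norm_ofReal_cpow ht]
  have := hb t ht.le
  have h2 : 0 ≤ t ^ (s.re - 1) := by positivity
  simp only [sub_re, one_re]
  nlinarith [mul_le_mul_of_nonneg_left this h2]

theorem tendsto_exp_bound {f : ℝ → ℂ} {C c : ℝ} (hc : 0 < c)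
    (hb : ∀ t, 0 ≤ t → ‖f t‖ ≤ C * Real.exp (-c * t)) (s : ℂ) :
    Tendsto (fun t : ℝ => (t : ℂ) ^ s * f t) atTop (𝓝 0) := by
  have h1 : Tendsto (fun t : ℝ => C * (t ^ s.re * Real.exp (-c * t))) atTop (𝓝 0) := by
    simpa using (tendsto_rpow_mul_exp_neg_mul_atTop_nhds_zero s.re c hc).const_mul C
  refine squeeze_zero_norm' ?_ h1
  filter_upwards [eventually_gt_atTop 0] with t ht
  rw [norm_mul, norm_ofReal_cpow ht]
  have h2 : 0 ≤ t ^ s.re := by positivity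
  nlinarith [mul_le_mul_of_nonneg_left (hb t ht.le) h2]

/-- Integration by parts against `t ^ s`: the boundary term vanishes at `0` because `Re s > 0`, and
at infinity by exponential decay. The exponent is left as `s + 1 - 1` to display a Mellin transform
at `s + 1`. -/
theorem integral_cpow_mul_deriv {f f' : ℝ → ℂ} (hf' : Continuous f')
    (hd : ∀ t, HasDerivAt f (f' t) t) {C c C' c' : ℝ} (hc : 0 < c) (hc' : 0 < c')
    (hb : ∀ t, 0 ≤ t → ‖f t‖ ≤ C * Real.exp (-c * t))
    (hb' : ∀ t, 0 ≤ t → ‖f' t‖ ≤ C' * Real.exp (-c' * t)) {s : ℂ} (hs : 0 < s.re) :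
    ∫ t in Ioi (0 : ℝ), (t : ℂ) ^ (s + 1 - 1) * f' t =
      -(s * ∫ t in Ioi (0 : ℝ), (t : ℂ) ^ (s - 1) * f t) := by
  have hs0 : s ≠ 0 := by
    rintro rfl
    simp at hs
  have hf : Continuous f := continuous_iff_continuousAt.2 fun t => (hd t).continuousAt
  have hs1 : 0 < (s + 1).re := by simp; linarith
  have key := integral_Ioi_mul_deriv_eq_deriv_mul (a := 0) (a' := 0) (b' := 0)
    (u := fun t : ℝ => (t : ℂ) ^ s) (v := f) (u' := fun t : ℝ => s * (t : ℂ) ^ (s - 1)) (v' := f')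
    (fun t ht => hasDerivAt_ofReal_cpow_const (ne_of_gt ht) hs0)
    (fun t _ => hd t)
    (by
      have := integrableOn_cpow_mul hf' hc' hb' hs1
      rw [add_sub_cancel_right] at this
      exact this)
    (by
      have := (integrableOn_cpow_mul hf hc hb hs).const_mul s
      refine this.congr (Eventually.of_forall fun t => ?_)
      simp [mul_assoc])
    (by
      have h0 : Tendsto (fun t : ℝ => (t : ℂ) ^ s * f t) (𝓝 0) (𝓝 (((0 : ℝ) : ℂ) ^ s * f 0)) := by
        refine Tendsto.mul ?_ hf.continuousAt
        exact (Complex.continuousAt_ofReal_cpow_const 0 s (Or.inl hs))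
      simp only [ofReal_zero, zero_cpow hs0, zero_mul] at h0
      exact h0.mono_left nhdsWithin_le_nhds)
    (tendsto_exp_bound hc hb s)
  rw [add_sub_cancel_right, key, ← integral_const_mul]
  simp [mul_assoc]

/-- Lebesgue measure on the positive quadrant. -/
noncomputable def quadrant : Measure (ℝ × ℝ) :=
  (volume.restrict (Ioi (0 : ℝ))).prod (volume.restrict (Ioi (0 : ℝ)))

theorem ae_quadrant : ∀ᵐ t ∂quadrant, 0 < t.1 ∧ 0 < t.2 := by
  rw [quadrant, Measure.prod_restrict]
  exact (ae_restrict_iff' (measurableSet_Ioi.prod measurableSet_Ioi)).2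
    (Eventually.of_forall fun t ht => ht)

/-- The kernel `(t₁ t₂) ^ (s - 1)` of the two-dimensional Mellin transform. -/
noncomputable def mellinKernel (s : ℂ) (t : ℝ × ℝ) : ℂ := (t.1 : ℂ) ^ (s - 1) * (t.2 : ℂ) ^ (s - 1)

/-- The diagonal two-dimensional Mellin transform. -/
noncomputable def doubleMellin (f : ℝ → ℝ → ℂ) (s : ℂ) : ℂ :=
  ∫ t, mellinKernel s t * f t.1 t.2 ∂quadrant

theorem norm_mellinKernel (s : ℂ) {t : ℝ × ℝ} (h : 0 < t.1 ∧ 0 < t.2) :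
    ‖mellinKernel s t‖ = (t.1 * t.2) ^ (s.re - 1) := by
  rw [mellinKernel, norm_mul, norm_ofReal_cpow h.1, norm_ofReal_cpow h.2,
    Real.mul_rpow h.1.le h.2.le]
  simp

theorem aestronglyMeasurable_mellinKernel (s : ℂ) :
    AEStronglyMeasurable (mellinKernel s) quadrant := by
  unfold mellinKernel
  refine Measurable.aestronglyMeasurable ?_
  fun_prop

theorem integrable_quadrant {σ c : ℝ} (hσ : 0 < σ) (hc : 0 < c) :
    Integrable (fun t : ℝ × ℝ => (t.1 * t.2) ^ (σ - 1) *
      (Real.exp (-c * t.1) * Real.exp (-c * t.2))) quadrant := by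
  refine ((integrableOn_rpow_mul_exp hσ hc).mul_prod (integrableOn_rpow_mul_exp hσ hc)).congr ?_
  filter_upwards [ae_quadrant] with t ht
  rw [Real.mul_rpow ht.1.le ht.2.le]
  ring

theorem integrable_mellinKernel_mul {f : ℝ → ℝ → ℂ} (hf : Continuous fun t : ℝ × ℝ => f t.1 t.2)
    {C c : ℝ} (hc : 0 < c) (hb : ∀ t₁ t₂, 0 ≤ t₁ → 0 ≤ t₂ →
      ‖f t₁ t₂‖ ≤ C * (Real.exp (-c * t₁) * Real.exp (-c * t₂))) {s : ℂ} (hs : 0 < s.re) :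
    Integrable (fun t => mellinKernel s t * f t.1 t.2) quadrant := by
  refine Integrable.mono' ((integrable_quadrant hs hc).const_mul C)
    ((aestronglyMeasurable_mellinKernel s).mul hf.aestronglyMeasurable) ?_
  filter_upwards [ae_quadrant] with t ht
  rw [norm_mul, norm_mellinKernel s ht]
  have h1 := hb t.1 t.2 ht.1.le ht.2.le
  have h2 : 0 ≤ (t.1 * t.2) ^ (s.re - 1) := Real.rpow_nonneg (mul_nonneg ht.1.le ht.2.le) _
  nlinarith [mul_le_mul_of_nonneg_left h1 h2]

/-- The logarithm costs a factor `y ^ ε` for `y ≥ 1` and `y ^ (-ε)` for `y ≤ 1`. The bound is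
uniform for `σ` near `σ₀`, as needed to differentiate the Mellin integral in `s` under domination.
-/
theorem abs_log_mul_rpow_le {y ε σ σ₀ : ℝ} (hy : 0 < y) (hε : 0 < ε) (hσ : |σ - σ₀| ≤ ε) :
    |Real.log y| * y ^ (σ - 1) ≤
      ε⁻¹ * (y ^ (σ₀ + 2 * ε - 1) + y ^ (σ₀ - 2 * ε - 1)) := by
  obtain ⟨h1, h2⟩ := abs_le.1 hσ
  have hi : 0 < ε⁻¹ := inv_pos.2 hε
  have hp1 : 0 ≤ y ^ (σ₀ + 2 * ε - 1) := by positivity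
  have hp2 : 0 ≤ y ^ (σ₀ - 2 * ε - 1) := by positivity
  have hp : 0 ≤ y ^ (σ - 1) := by positivity
  rcases le_total 1 y with h | h
  · rw [abs_of_nonneg (Real.log_nonneg h)]
    have h3 : Real.log y ≤ y ^ ε / ε := Real.log_le_rpow_div hy.le hε
    calc Real.log y * y ^ (σ - 1) ≤ y ^ ε / ε * y ^ (σ - 1) := by gcongr
      _ = ε⁻¹ * y ^ (ε + (σ - 1)) := by rw [Real.rpow_add hy]; ring
      _ ≤ ε⁻¹ * y ^ (σ₀ + 2 * ε - 1) := by
        gcongr 1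
        exact Real.rpow_le_rpow_of_exponent_le h (by linarith)
      _ ≤ _ := by gcongr; linarith
  · rw [abs_of_nonpos (Real.log_nonpos hy.le h), ← Real.log_inv]
    have h3 : Real.log y⁻¹ ≤ y⁻¹ ^ ε / ε := Real.log_le_rpow_div (inv_nonneg.2 hy.le) hε
    rw [Real.inv_rpow hy.le, ← Real.rpow_neg hy.le] at h3
    calc Real.log y⁻¹ * y ^ (σ - 1) ≤ y ^ (-ε) / ε * y ^ (σ - 1) := by gcongr
      _ = ε⁻¹ * y ^ (-ε + (σ - 1)) := by rw [Real.rpow_add hy]; ring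
      _ ≤ ε⁻¹ * y ^ (σ₀ - 2 * ε - 1) := by
        gcongr 1
        exact Real.rpow_le_rpow_of_exponent_ge hy h (by linarith)
      _ ≤ _ := by gcongr; linarith

theorem hasDerivAt_mellinKernel (s : ℂ) {t : ℝ × ℝ} (h : 0 < t.1 ∧ 0 < t.2) :
    HasDerivAt (fun s => mellinKernel s t) (Real.log (t.1 * t.2) * mellinKernel s t) s := by
  unfold mellinKernel
  have h1 : (t.1 : ℂ) ≠ 0 := by exact_mod_cast h.1.ne'
  have h2 : (t.2 : ℂ) ≠ 0 := by exact_mod_cast h.2.ne'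
  have d : HasDerivAt (fun s : ℂ => s - 1) 1 s := (hasDerivAt_id s).sub_const 1
  refine ((d.const_cpow (Or.inl h1)).mul (d.const_cpow (Or.inl h2))).congr_deriv ?_
  rw [Real.log_mul h.1.ne' h.2.ne']
  push_cast [Complex.ofReal_log h.1.le, Complex.ofReal_log h.2.le]
  ring

theorem differentiableAt_doubleMellin {f : ℝ → ℝ → ℂ}
    (hf : Continuous fun t : ℝ × ℝ => f t.1 t.2)
    {C c : ℝ} (hc : 0 < c) (hb : ∀ t₁ t₂, 0 ≤ t₁ → 0 ≤ t₂ →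
      ‖f t₁ t₂‖ ≤ C * (Real.exp (-c * t₁) * Real.exp (-c * t₂))) {s : ℂ} (hs : 0 < s.re) :
    DifferentiableAt ℂ (doubleMellin f) s := by
  -- With this choice `s.re - 2 * ε` is still positive, so both dominating functions are integrable
  -- at `0`.
  set ε := s.re / 4 with hεd
  have hε : 0 < ε := by positivity
  have hC : 0 ≤ C := by
    have := (norm_nonneg _).trans (hb 0 0 le_rfl le_rfl)
    simpa using this
  have := hasDerivAt_integral_of_dominated_loc_of_deriv_le (μ := quadrant)
    (F := fun s t => mellinKernel s t * f t.1 t.2)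
    (F' := fun s t => Real.log (t.1 * t.2) * mellinKernel s t * f t.1 t.2)
    (bound := fun t => C * ε⁻¹ * ((t.1 * t.2) ^ (s.re + 2 * ε - 1) *
        (Real.exp (-c * t.1) * Real.exp (-c * t.2)) + (t.1 * t.2) ^ (s.re - 2 * ε - 1) *
        (Real.exp (-c * t.1) * Real.exp (-c * t.2)))) (x₀ := s)
    (Metric.ball_mem_nhds s hε)
    (Eventually.of_forall fun z =>
      (aestronglyMeasurable_mellinKernel z).mul hf.aestronglyMeasurable)
    (integrable_mellinKernel_mul hf hc hb hs)
    (by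
      refine AEStronglyMeasurable.mul (AEStronglyMeasurable.mul ?_
        (aestronglyMeasurable_mellinKernel s)) hf.aestronglyMeasurable
      refine Measurable.aestronglyMeasurable ?_
      fun_prop)
    (by
      filter_upwards [ae_quadrant] with t ht z hz
      rw [norm_mul, norm_mul, norm_mellinKernel z ht, Complex.norm_real, Real.norm_eq_abs]
      have hz' : |z.re - s.re| ≤ ε := by
        rw [← sub_re]
        exact (abs_re_le_norm _).trans (mem_ball_iff_norm.1 hz).le
      have h1 := abs_log_mul_rpow_le (mul_pos ht.1 ht.2) hε hz'
      have h2 := hb t.1 t.2 ht.1.le ht.2.le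
      refine (mul_le_mul h1 h2 (norm_nonneg _) ?_).trans (le_of_eq ?_)
      · have : 0 ≤ t.1 * t.2 := mul_nonneg ht.1.le ht.2.le
        positivity
      · ring)
    (((integrable_quadrant (by linarith) hc).add
      (integrable_quadrant (by linarith) hc)).const_mul _)
    (by
      filter_upwards [ae_quadrant] with t ht z _
      exact (hasDerivAt_mellinKernel z ht).mul_const _)
  exact this.2.differentiableAt

theorem doubleMellin_comm {f : ℝ → ℝ → ℂ} {s s' : ℂ}
    (h : Integrable (fun t : ℝ × ℝ => (t.1 : ℂ) ^ s * (t.2 : ℂ) ^ s' * f t.1 t.2) quadrant) :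
    ∫ t₁ in Ioi (0 : ℝ), (t₁ : ℂ) ^ s * ∫ t₂ in Ioi (0 : ℝ), (t₂ : ℂ) ^ s' * f t₁ t₂ =
      ∫ t₂ in Ioi (0 : ℝ), (t₂ : ℂ) ^ s' * ∫ t₁ in Ioi (0 : ℝ), (t₁ : ℂ) ^ s * f t₁ t₂ := by
  simp_rw [← integral_const_mul]
  rw [integral_integral_swap]
  · simp_rw [mul_left_comm]
  · refine h.congr (Eventually.of_forall fun t => ?_)
    simp [Function.uncurry, mul_assoc]

theorem integrable_cpow_mul_cpow_mul {f : ℝ → ℝ → ℂ}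
    (hf : Continuous fun t : ℝ × ℝ => f t.1 t.2)
    {C c : ℝ} (hc : 0 < c) (hb : ∀ t₁ t₂, 0 ≤ t₁ → 0 ≤ t₂ →
      ‖f t₁ t₂‖ ≤ C * (Real.exp (-c * t₁) * Real.exp (-c * t₂))) {s s' : ℂ}
    (hs : 0 < s.re) (hs' : 0 < s'.re) :
    Integrable (fun t : ℝ × ℝ => (t.1 : ℂ) ^ (s - 1) * (t.2 : ℂ) ^ (s' - 1) * f t.1 t.2)
      quadrant := by
  refine Integrable.mono' (((integrableOn_rpow_mul_exp hs hc).mul_prod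
    (integrableOn_rpow_mul_exp hs' hc)).const_mul C)
    (AEStronglyMeasurable.mul (Measurable.aestronglyMeasurable (by fun_prop))
      hf.aestronglyMeasurable) ?_
  filter_upwards [ae_quadrant] with t ht
  rw [norm_mul, norm_mul, norm_ofReal_cpow ht.1, norm_ofReal_cpow ht.2]
  have h1 := hb t.1 t.2 ht.1.le ht.2.le
  have h2 : 0 ≤ t.1 ^ (s.re - 1) * t.2 ^ (s'.re - 1) :=
    mul_nonneg (Real.rpow_nonneg ht.1.le _) (Real.rpow_nonneg ht.2.le _)
  simp only [sub_re, one_re]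
  nlinarith [mul_le_mul_of_nonneg_left h1 h2]

theorem doubleMellin_eq_iterated {f : ℝ → ℝ → ℂ}
    (hf : Continuous fun t : ℝ × ℝ => f t.1 t.2)
    {C c : ℝ} (hc : 0 < c) (hb : ∀ t₁ t₂, 0 ≤ t₁ → 0 ≤ t₂ →
      ‖f t₁ t₂‖ ≤ C * (Real.exp (-c * t₁) * Real.exp (-c * t₂))) {s : ℂ} (hs : 0 < s.re) :
    doubleMellin f s = ∫ t₁ in Ioi (0 : ℝ), (t₁ : ℂ) ^ (s - 1) *
      ∫ t₂ in Ioi (0 : ℝ), (t₂ : ℂ) ^ (s - 1) * f t₁ t₂ := by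
  rw [doubleMellin, quadrant, integral_prod _ (integrable_mellinKernel_mul hf hc hb hs)]
  simp_rw [mellinKernel, ← integral_const_mul, mul_assoc]

/-! ### Entire continuation of the Mellin transform -/

namespace IsDecayingFamily

variable {F : ℕ → ℕ → ℝ → ℝ → ℂ}

theorem bound_fst (hF : IsDecayingFamily F) (a b : ℕ) : ∃ c, 0 < c ∧ ∀ t₂, 0 ≤ t₂ →
    ∃ C : ℝ, ∀ t₁, 0 ≤ t₁ → ‖F a b t₁ t₂‖ ≤ C * Real.exp (-c * t₁) := by
  obtain ⟨C, c, hc, h⟩ := hF.bound a b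
  refine ⟨c, hc, fun t₂ h₂ => ⟨C * Real.exp (-c * t₂), fun t₁ h₁ => ?_⟩⟩
  refine (h t₁ t₂ h₁ h₂).trans (le_of_eq (by ring))

theorem bound_snd (hF : IsDecayingFamily F) (a b : ℕ) : ∃ c, 0 < c ∧ ∀ t₁, 0 ≤ t₁ →
    ∃ C : ℝ, ∀ t₂, 0 ≤ t₂ → ‖F a b t₁ t₂‖ ≤ C * Real.exp (-c * t₂) := by
  obtain ⟨C, c, hc, h⟩ := hF.bound a b
  refine ⟨c, hc, fun t₁ h₁ => ⟨C * Real.exp (-c * t₁), fun t₂ h₂ => ?_⟩⟩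
  refine (h t₁ t₂ h₁ h₂).trans (le_of_eq (by ring))

theorem continuous_fst (hF : IsDecayingFamily F) (a b : ℕ) (t₂ : ℝ) :
    Continuous fun t₁ => F a b t₁ t₂ :=
  (hF.continuous a b).comp (Continuous.prodMk_left t₂)

theorem continuous_snd (hF : IsDecayingFamily F) (a b : ℕ) (t₁ : ℝ) :
    Continuous fun t₂ => F a b t₁ t₂ :=
  (hF.continuous a b).comp (Continuous.prodMk_right t₁)

theorem integral_snd (hF : IsDecayingFamily F) (a b : ℕ) {s : ℂ} (hs : 0 < s.re) {t₁ : ℝ}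
    (ht₁ : 0 ≤ t₁) :
    ∫ t in Ioi (0 : ℝ), (t : ℂ) ^ (s + 1 - 1) * F a (b + 1) t₁ t =
      -(s * ∫ t in Ioi (0 : ℝ), (t : ℂ) ^ (s - 1) * F a b t₁ t) := by
  obtain ⟨c, hc, h⟩ := hF.bound_snd a b
  obtain ⟨c', hc', h'⟩ := hF.bound_snd a (b + 1)
  obtain ⟨C, h⟩ := h t₁ ht₁
  obtain ⟨C', h'⟩ := h' t₁ ht₁
  exact integral_cpow_mul_deriv (hF.continuous_snd a (b + 1) t₁)
    (fun t => hF.hasDerivAt_snd a b t₁ t) hc hc' h h' hs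

theorem integral_fst (hF : IsDecayingFamily F) (a b : ℕ) {s : ℂ} (hs : 0 < s.re) {t₂ : ℝ}
    (ht₂ : 0 ≤ t₂) :
    ∫ t in Ioi (0 : ℝ), (t : ℂ) ^ (s + 1 - 1) * F (a + 1) b t t₂ =
      -(s * ∫ t in Ioi (0 : ℝ), (t : ℂ) ^ (s - 1) * F a b t t₂) := by
  obtain ⟨c, hc, h⟩ := hF.bound_fst a b
  obtain ⟨c', hc', h'⟩ := hF.bound_fst (a + 1) b
  obtain ⟨C, h⟩ := h t₂ ht₂
  obtain ⟨C', h'⟩ := h' t₂ ht₂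
  exact integral_cpow_mul_deriv (hF.continuous_fst (a + 1) b t₂)
    (fun t => hF.hasDerivAt_fst a b t t₂) hc hc' h h' hs

/-- One integration by parts in each variable, each giving a factor `-s`; Fubini brings the other
variable inside in between. -/
theorem doubleMellin_succ (hF : IsDecayingFamily F) (a b : ℕ) {s : ℂ} (hs : 0 < s.re) :
    doubleMellin (F (a + 1) (b + 1)) (s + 1) = s ^ 2 * doubleMellin (F a b) s := by
  obtain ⟨C, c, hc, h⟩ := hF.bound (a + 1) (b + 1)
  obtain ⟨C₁, c₁, hc₁, h₁⟩ := hF.bound (a + 1) b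
  obtain ⟨C₀, c₀, hc₀, h₀⟩ := hF.bound a b
  have hs1 : 0 < (s + 1).re := by simp; linarith
  rw [doubleMellin_eq_iterated (hF.continuous _ _) hc h hs1,
    doubleMellin_eq_iterated (hF.continuous _ _) hc₀ h₀ hs]
  calc ∫ t₁ in Ioi (0 : ℝ), (t₁ : ℂ) ^ (s + 1 - 1) *
      ∫ t₂ in Ioi (0 : ℝ), (t₂ : ℂ) ^ (s + 1 - 1) * F (a + 1) (b + 1) t₁ t₂
      = ∫ t₁ in Ioi (0 : ℝ), -s * ((t₁ : ℂ) ^ (s + 1 - 1) *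
          ∫ t₂ in Ioi (0 : ℝ), (t₂ : ℂ) ^ (s - 1) * F (a + 1) b t₁ t₂) := by
        refine setIntegral_congr_fun measurableSet_Ioi fun t₁ ht₁ => ?_
        rw [hF.integral_snd _ _ hs (le_of_lt ht₁)]
        ring
    _ = -s * ∫ t₂ in Ioi (0 : ℝ), (t₂ : ℂ) ^ (s - 1) *
          ∫ t₁ in Ioi (0 : ℝ), (t₁ : ℂ) ^ (s + 1 - 1) * F (a + 1) b t₁ t₂ := by
        rw [integral_const_mul, doubleMellin_comm
          (integrable_cpow_mul_cpow_mul (hF.continuous _ _) hc₁ h₁ hs1 hs)]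
    _ = -s * ∫ t₂ in Ioi (0 : ℝ), -s * ((t₂ : ℂ) ^ (s - 1) *
          ∫ t₁ in Ioi (0 : ℝ), (t₁ : ℂ) ^ (s - 1) * F a b t₁ t₂) := by
        congr 1
        refine setIntegral_congr_fun measurableSet_Ioi fun t₂ ht₂ => ?_
        rw [hF.integral_fst _ _ hs (le_of_lt ht₂)]
        ring
    _ = _ := by
        rw [integral_const_mul, ← doubleMellin_comm
          (integrable_cpow_mul_cpow_mul (hF.continuous _ _) hc₀ h₀ hs hs)]
        ring

/-- At `s = 1` the kernel is trivial, so the fundamental theorem of calculus applies in each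
variable, and the two signs cancel. -/
theorem doubleMellin_one (hF : IsDecayingFamily F) (a b : ℕ) :
    doubleMellin (F (a + 1) (b + 1)) 1 = F a b 0 0 := by
  obtain ⟨C, c, hc, h⟩ := hF.bound (a + 1) (b + 1)
  rw [doubleMellin_eq_iterated (hF.continuous _ _) hc h (by simp)]
  simp only [sub_self, cpow_zero, one_mul]
  have key : ∀ {f f' : ℝ → ℂ}, Continuous f' → (∀ t, HasDerivAt f (f' t) t) →
      (∃ c, 0 < c ∧ ∃ C, ∀ t, 0 ≤ t → ‖f t‖ ≤ C * Real.exp (-c * t)) →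
      (∃ c, 0 < c ∧ ∃ C, ∀ t, 0 ≤ t → ‖f' t‖ ≤ C * Real.exp (-c * t)) →
      ∫ t in Ioi (0 : ℝ), f' t = -f 0 := by
    rintro f f' hf' hd ⟨c, hc, C, h⟩ ⟨c', hc', C', h'⟩
    rw [integral_Ioi_of_hasDerivAt_of_tendsto (f := f) (m := 0) (hd 0).continuousAt.continuousWithinAt
      (fun t _ => hd t), zero_sub]
    · simpa using integrableOn_cpow_mul hf' hc' h' (s := 1) (by simp)
    · simpa using tendsto_exp_bound hc h 0
  have h1 : ∀ t₁ ∈ Ioi (0 : ℝ), ∫ t₂ in Ioi (0 : ℝ), F (a + 1) (b + 1) t₁ t₂ =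
      -F (a + 1) b t₁ 0 := by
    intro t₁ ht₁
    refine key (hF.continuous_snd _ _ _) (fun t => hF.hasDerivAt_snd _ _ _ _) ?_ ?_
    · obtain ⟨c, hc, h⟩ := hF.bound_snd (a + 1) b
      exact ⟨c, hc, h t₁ (le_of_lt ht₁)⟩
    · obtain ⟨c, hc, h⟩ := hF.bound_snd (a + 1) (b + 1)
      exact ⟨c, hc, h t₁ (le_of_lt ht₁)⟩
  rw [setIntegral_congr_fun measurableSet_Ioi h1, integral_neg,
    key (hF.continuous_fst _ _ _) (fun t => hF.hasDerivAt_fst a b _ _), neg_neg]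
  · obtain ⟨c, hc, h⟩ := hF.bound_fst a b
    exact ⟨c, hc, h 0 le_rfl⟩
  · obtain ⟨c, hc, h⟩ := hF.bound_fst (a + 1) b
    exact ⟨c, hc, h 0 le_rfl⟩

/-- The Mellin transform divided by `Γ(s) ^ 2`, after `K` integrations by parts. -/
theorem doubleMellin_div_Gamma_add (hF : IsDecayingFamily F) {s : ℂ} (K n : ℕ)
    (hs : 0 < (s + K).re) :
    doubleMellin (F (K + n) (K + n)) (s + (K + n : ℕ)) / Gamma (s + (K + n : ℕ)) ^ 2 =
      doubleMellin (F K K) (s + K) / Gamma (s + K) ^ 2 := by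
  induction n with
  | zero => simp
  | succ n ih =>
    have h0 : 0 < (s + (K + n : ℕ)).re := by
      simp only [add_re, natCast_re, Nat.cast_add] at hs ⊢
      have : (0 : ℝ) ≤ n := n.cast_nonneg
      linarith
    have hne : s + (K + n : ℕ) ≠ 0 := by
      intro h
      rw [h] at h0
      simp at h0
    rw [← ih, ← add_assoc K n 1, show s + ((K + n + 1 : ℕ) : ℂ) = s + (K + n : ℕ) + 1 by
      push_cast; ring, hF.doubleMellin_succ _ _ h0, Gamma_add_one _ hne, mul_pow,
      mul_div_mul_left _ _ (pow_ne_zero 2 hne)]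

/-- The Mellin transform of a decaying family, divided by `Γ(s) ^ 2`, extends to an entire function
whose values at the non-positive integers are the diagonal derivatives at the origin. -/
theorem exists_entire (hF : IsDecayingFamily F) : ∃ Z : ℂ → ℂ, Differentiable ℂ Z ∧
    (∀ s : ℂ, 0 < s.re → Z s = doubleMellin (F 0 0) s / Gamma s ^ 2) ∧
    ∀ N : ℕ, Z (-N) = F N N 0 0 := by
  -- The number of integrations by parts is chosen pointwise so that the shifted argument has
  -- positive real part; the `+ 1` makes the inequality strict. By `hZK` every other admissible
  -- number gives the same value, so near a given point it may be held fixed.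
  set Z : ℂ → ℂ := fun s => doubleMellin (F (⌈-s.re⌉₊ + 1) (⌈-s.re⌉₊ + 1))
    (s + (⌈-s.re⌉₊ + 1 : ℕ)) / Gamma (s + (⌈-s.re⌉₊ + 1 : ℕ)) ^ 2 with hZ
  have hZK : ∀ (s : ℂ) (K : ℕ), 0 < (s + K).re →
      Z s = doubleMellin (F K K) (s + K) / Gamma (s + K) ^ 2 := by
    intro s K hK
    have h1 : 0 < (s + (⌈-s.re⌉₊ + 1 : ℕ)).re := by
      have := Nat.le_ceil (-s.re)
      simp only [add_re, natCast_re]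
      push_cast
      linarith
    simp only [hZ]
    rcases le_total K (⌈-s.re⌉₊ + 1) with h | h
    · obtain ⟨n, hn⟩ := Nat.exists_eq_add_of_le h
      rw [hn]
      exact hF.doubleMellin_div_Gamma_add K n hK
    · obtain ⟨n, hn⟩ := Nat.exists_eq_add_of_le h
      rw [hn]
      exact (hF.doubleMellin_div_Gamma_add _ n h1).symm
  refine ⟨Z, fun s => ?_, fun s hs => ?_, fun N => ?_⟩
  · obtain ⟨K, hK⟩ := exists_nat_gt (-s.re)
    have hK' : 0 < (s + K).re := by
      simp only [add_re, natCast_re]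
      linarith
    have hev : Z =ᶠ[𝓝 s] fun z => doubleMellin (F K K) (z + K) * ((Gamma (z + K))⁻¹) ^ 2 := by
      have hopen : IsOpen {z : ℂ | 0 < (z + K).re} :=
        isOpen_lt continuous_const (by fun_prop)
      filter_upwards [hopen.mem_nhds hK'] with z hz
      rw [hZK z K hz, inv_pow, div_eq_mul_inv]
    refine DifferentiableAt.congr_of_eventuallyEq ?_ hev
    obtain ⟨C, c, hc, h⟩ := hF.bound K K
    have hadd : DifferentiableAt ℂ (fun z : ℂ => z + K) s := by fun_prop
    refine DifferentiableAt.mul ?_ (DifferentiableAt.pow ?_ 2)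
    · exact DifferentiableAt.comp (g := doubleMellin (F K K)) s
        (differentiableAt_doubleMellin (hF.continuous K K) hc h hK') hadd
    · exact DifferentiableAt.comp (g := fun z => (Gamma z)⁻¹) s
        (differentiable_one_div_Gamma (s + K)) hadd
  · simpa using hZK s 0 (by simpa using hs)
  -- After `N + 1` shifts the argument is exactly `1`, where `Γ = 1` and the transform is a value at
  -- the origin.
  · rw [hZK (-N) (N + 1) (by simp)]
    rw [show (-(N : ℂ) + ((N + 1 : ℕ) : ℂ)) = 1 by push_cast; ring, Gamma_one, one_pow, div_one,
      hF.doubleMellin_one]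

end IsDecayingFamily

end ConeZeta

namespace ConeZeta
open MeasureTheory Set Filter Topology Complex

/-! ### Iterated differences and regularised sums -/

/-- The mixed difference of order `(i, l)` of `Q` at the origin. -/
def diffCoeff {K : Type*} [AddCommGroup K] (Q : ℕ → ℕ → K) (i l : ℕ) : K :=
  (fwdDiff 1)^[i] (fun n => (fwdDiff 1)^[l] (Q n) 0) 0

/-- The regularised value of `∑ α ^ n β ^ m Q n m`, truncated to the differences of order
less than `M`. -/
def regularizedSum {K : Type*} [Field K] (α β : K) (M : ℕ) (Q : ℕ → ℕ → K) : K :=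
  ∑ i ∈ Finset.range M, ∑ l ∈ Finset.range M,
    diffCoeff Q i l * (α ^ i / (1 - α) ^ (i + 1)) * (β ^ l / (1 - β) ^ (l + 1))

theorem diffCoeff_eq_sum {K : Type*} [CommRing K] (Q : ℕ → ℕ → K) (i l : ℕ) :
    diffCoeff Q i l = ∑ a ∈ Finset.range (i + 1), ∑ b ∈ Finset.range (l + 1),
      ((-1) ^ (i - a) * (i.choose a) : ℤ) * ((-1) ^ (l - b) * (l.choose b) : ℤ) * Q a b := by
  unfold diffCoeff
  rw [fwdDiff_iter_eq_sum_shift]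
  refine Finset.sum_congr rfl fun a _ => ?_
  rw [fwdDiff_iter_eq_sum_shift, zsmul_eq_mul, Finset.mul_sum]
  refine Finset.sum_congr rfl fun b _ => ?_
  simp [mul_assoc]

theorem map_diffCoeff {K L : Type*} [CommRing K] [CommRing L] (φ : K →+* L) (Q : ℕ → ℕ → K)
    (i l : ℕ) : φ (diffCoeff Q i l) = diffCoeff (fun n m => φ (Q n m)) i l := by
  simp [diffCoeff_eq_sum]

/-- The regularised sum is a rational expression in its data, hence commutes with field
homomorphisms. This is the bridge from `ℂ` through `QBar` to `ℂ_p`. -/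
theorem map_regularizedSum {K L : Type*} [Field K] [Field L] (φ : K →+* L) (α β : K) (M : ℕ)
    (Q : ℕ → ℕ → K) :
    φ (regularizedSum α β M Q) = regularizedSum (φ α) (φ β) M (fun n m => φ (Q n m)) := by
  simp [regularizedSum, map_diffCoeff]

/-- The discrete Leibniz rule for the linear factor `n`. At `i = 0` the truncated `i - 1` is
harmless, since its coefficient is `0`. -/
theorem fwdDiff_iter_natCast_mul {K : Type*} [CommRing K] (g : ℕ → K) (i y : ℕ) :
    (fwdDiff 1)^[i] (fun n : ℕ => (n : K) * g n) y =
      (y + i) * (fwdDiff 1)^[i] g y + i * (fwdDiff 1)^[i - 1] g y := by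
  induction i generalizing y with
  | zero => simp
  | succ i ih =>
    rw [Function.iterate_succ_apply', fwdDiff, ih, ih, Nat.add_sub_cancel]
    have h1 : (fwdDiff 1)^[i + 1] g y = (fwdDiff 1)^[i] g (y + 1) - (fwdDiff 1)^[i] g y := by
      rw [Function.iterate_succ_apply', fwdDiff]
    rcases i with _ | i
    · rw [h1]
      simp
      ring
    · have h2 : (fwdDiff 1)^[i + 1] g y = (fwdDiff 1)^[i] g (y + 1) - (fwdDiff 1)^[i] g y := by
        rw [Function.iterate_succ_apply', fwdDiff]
      rw [h1]
      simp only [Nat.add_sub_cancel]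
      push_cast
      linear_combination (-(i + 1 : K)) * h2

/-- The linear form `x + n u + m v`. -/
def linForm {K : Type*} [CommRing K] (x u v : K) (n m : ℕ) : K := x + n * u + m * v

theorem diffCoeff_linForm_mul {K : Type*} [CommRing K] (x u v : K) (Q : ℕ → ℕ → K) (i l : ℕ) :
    diffCoeff (fun n m => linForm x u v n m * Q n m) i l =
      (x + i * u + l * v) * diffCoeff Q i l + i * u * diffCoeff Q (i - 1) l +
        l * v * diffCoeff Q i (l - 1) := by
  have h1 : ∀ n : ℕ, (fwdDiff 1)^[l] (fun m : ℕ => (x + n * u + m * v) * Q n m) 0 =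
      (x • (fun n => (fwdDiff 1)^[l] (Q n) 0) +
        u • (fun n : ℕ => (n : K) * (fwdDiff 1)^[l] (Q n) 0) +
        (v * l) • (fun n => (fwdDiff 1)^[l] (Q n) 0) +
        (v * l) • (fun n => (fwdDiff 1)^[l - 1] (Q n) 0)) n := by
    intro n
    have : (fun m : ℕ => (x + n * u + m * v) * Q n m) =
        (x + n * u) • Q n + v • (fun m : ℕ => (m : K) * Q n m) := by
      ext m
      simp
      ring
    rw [this, fwdDiff_iter_add, fwdDiff_iter_const_smul, fwdDiff_iter_const_smul]
    simp only [Pi.add_apply, Pi.smul_apply, smul_eq_mul, fwdDiff_iter_natCast_mul]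
    push_cast
    ring
  unfold diffCoeff linForm
  rw [funext h1]
  simp only [fwdDiff_iter_add, fwdDiff_iter_const_smul, Pi.add_apply, Pi.smul_apply, smul_eq_mul,
    fwdDiff_iter_natCast_mul]
  push_cast
  ring

theorem diffCoeff_one {K : Type*} [CommRing K] (i l : ℕ) (h : i ≠ 0 ∨ l ≠ 0) :
    diffCoeff (fun _ _ => (1 : K)) i l = 0 := by
  have h0 : ∀ k : ℕ, k ≠ 0 → ∀ c : K, (fwdDiff 1)^[k] (fun _ : ℕ => c) = fun _ => 0 := by
    intro k hk c
    induction k with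
    | zero => exact absurd rfl hk
    | succ k ih =>
      rw [Function.iterate_succ_apply']
      rcases eq_or_ne k 0 with rfl | h
      · simp
      · rw [ih h]
        simp
  unfold diffCoeff
  rcases eq_or_ne l 0 with rfl | hl
  · simp only [Function.iterate_zero, id]
    rw [h0 i (by simpa using h)]
  · simp only [h0 l hl]
    rcases eq_or_ne i 0 with rfl | hi
    · simp
    · rw [h0 i hi]

/-- By the Leibniz rule, each linear factor raises by at most one the order, in either variable, up
to which differences can survive. -/
theorem diffCoeff_linForm_pow_eq_zero {K : Type*} [CommRing K] (x u v : Fin 2 → K)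
    (N₁ N₂ i l : ℕ) (h : N₁ + N₂ < i ∨ N₁ + N₂ < l) :
    diffCoeff (fun n m => linForm (x 0) (u 0) (v 0) n m ^ N₁ *
      linForm (x 1) (u 1) (v 1) n m ^ N₂) i l = 0 := by
  induction N₁ generalizing i l with
  | zero =>
    induction N₂ generalizing i l with
    | zero =>
      simp only [pow_zero, mul_one]
      exact diffCoeff_one i l (by omega)
    | succ N ih =>
      simp only [pow_zero, one_mul] at ih ⊢
      simp only [pow_succ']
      have := diffCoeff_linForm_mul (x 1) (u 1) (v 1)
        (fun n m => linForm (x 1) (u 1) (v 1) n m ^ N) i l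
      rw [this, ih i l (by omega), ih (i - 1) l (by omega), ih i (l - 1) (by omega)]
      simp
  | succ N ih =>
    simp only [pow_succ', mul_assoc]
    have := diffCoeff_linForm_mul (x 0) (u 0) (v 0)
      (fun n m => linForm (x 0) (u 0) (v 0) n m ^ N * linForm (x 1) (u 1) (v 1) n m ^ N₂) i l
    rw [this, ih i l (by omega), ih (i - 1) l (by omega), ih i (l - 1) (by omega)]
    simp

/-! ### The derivative family of a product of geometric series -/

/-- The differential equation assumed for `E` is the transpose of the Leibniz rule for mixed
differences. So differentiating the sum in `t` amounts to multiplying `Q` by the linear form, up to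
sign. The vanishing of the differences of order at least `M` makes the index shifts balance at the
upper end. -/
theorem hasDerivAt_sum_diffCoeff (x u v : ℂ) (Q : ℕ → ℕ → ℂ) (M : ℕ)
    (hQ : ∀ i l, M ≤ i ∨ M ≤ l → diffCoeff Q i l = 0) (E : ℕ → ℕ → ℝ → ℂ) (t : ℝ)
    (hE : ∀ i l, HasDerivAt (E i l) (-((x + i * u + l * v) * E i l t +
      (i + 1) * u * E (i + 1) l t + (l + 1) * v * E i (l + 1) t)) t) :
    HasDerivAt (fun t => ∑ i ∈ Finset.range M, ∑ l ∈ Finset.range M, diffCoeff Q i l * E i l t)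
      (-∑ i ∈ Finset.range (M + 1), ∑ l ∈ Finset.range (M + 1),
        diffCoeff (fun n m => linForm x u v n m * Q n m) i l * E i l t) t := by
  refine (HasDerivAt.fun_sum fun i _ => HasDerivAt.fun_sum fun l _ =>
    (hE i l).const_mul (diffCoeff Q i l)).congr_deriv ?_
  have hs : ∀ f : ℕ → ℕ → ℂ, (∀ i l, M ≤ i ∨ M ≤ l → f i l = 0) →
      ∑ i ∈ Finset.range (M + 1), ∑ l ∈ Finset.range (M + 1), f i l =
      ∑ i ∈ Finset.range M, ∑ l ∈ Finset.range M, f i l := by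
    intro f hf
    rw [Finset.sum_range_succ, Finset.sum_eq_zero (s := Finset.range (M + 1)) (f := f M)
      (fun l _ => hf M l (Or.inl le_rfl)), add_zero]
    refine Finset.sum_congr rfl fun i _ => ?_
    rw [Finset.sum_range_succ, hf i M (Or.inr le_rfl), add_zero]
  have hs1 : ∑ i ∈ Finset.range (M + 1), ∑ l ∈ Finset.range (M + 1),
      (i : ℂ) * u * diffCoeff Q (i - 1) l * E i l t =
      ∑ i ∈ Finset.range M, ∑ l ∈ Finset.range M,
        diffCoeff Q i l * ((i + 1) * u * E (i + 1) l t) := by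
    rw [Finset.sum_range_succ']
    simp only [CharP.cast_eq_zero, zero_mul, Finset.sum_const_zero, add_zero, Nat.add_sub_cancel]
    refine Finset.sum_congr rfl fun i _ => ?_
    rw [Finset.sum_range_succ, hQ i M (Or.inr le_rfl)]
    simp only [mul_zero, zero_mul, add_zero]
    refine Finset.sum_congr rfl fun l _ => ?_
    push_cast
    ring
  have hs2 : ∑ i ∈ Finset.range (M + 1), ∑ l ∈ Finset.range (M + 1),
      (l : ℂ) * v * diffCoeff Q i (l - 1) * E i l t =
      ∑ i ∈ Finset.range M, ∑ l ∈ Finset.range M,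
        diffCoeff Q i l * ((l + 1) * v * E i (l + 1) t) := by
    rw [Finset.sum_comm, Finset.sum_range_succ', Finset.sum_comm (s := Finset.range M)]
    simp only [CharP.cast_eq_zero, zero_mul, Finset.sum_const_zero, add_zero, Nat.add_sub_cancel]
    rw [Finset.sum_comm]
    rw [Finset.sum_comm (s := Finset.range M)]
    rw [Finset.sum_range_succ]
    simp only [hQ M _ (Or.inl le_rfl), mul_zero, zero_mul, Finset.sum_const_zero, add_zero]
    refine Finset.sum_congr rfl fun i _ => Finset.sum_congr rfl fun l _ => ?_
    push_cast
    ring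
  have hR : ∑ i ∈ Finset.range (M + 1), ∑ l ∈ Finset.range (M + 1),
        diffCoeff (fun n m => linForm x u v n m * Q n m) i l * E i l t =
      ∑ i ∈ Finset.range (M + 1), ∑ l ∈ Finset.range (M + 1),
        (x + i * u + l * v) * diffCoeff Q i l * E i l t +
      ∑ i ∈ Finset.range (M + 1), ∑ l ∈ Finset.range (M + 1),
        (i : ℂ) * u * diffCoeff Q (i - 1) l * E i l t +
      ∑ i ∈ Finset.range (M + 1), ∑ l ∈ Finset.range (M + 1),
        (l : ℂ) * v * diffCoeff Q i (l - 1) * E i l t := by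
    simp only [← Finset.sum_add_distrib]
    refine Finset.sum_congr rfl fun i _ => Finset.sum_congr rfl fun l _ => ?_
    rw [diffCoeff_linForm_mul]
    ring
  rw [hR, hs1, hs2, hs _ (fun i l h => by rw [hQ i l h]; ring)]
  simp only [← Finset.sum_add_distrib, ← Finset.sum_neg_distrib]
  refine Finset.sum_congr rfl fun i _ => Finset.sum_congr rfl fun l _ => ?_
  ring

/-- The term `e ^ (-X) W_i(α e ^ (-U)) W_l(β e ^ (-V))` with `W_i(y) = y ^ i / (1 - y) ^ (i + 1)`. -/
noncomputable def geomTerm (α β : ℂ) (i l : ℕ) (X U V : ℝ) : ℂ :=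
  Real.exp (-X) * ((α * Real.exp (-U)) ^ i / (1 - α * Real.exp (-U)) ^ (i + 1)) *
    ((β * Real.exp (-V)) ^ l / (1 - β * Real.exp (-V)) ^ (l + 1))

/-- Taking norms in `α * exp r = 1` forces `exp r = 1`. It holds for all real `r`, as needed since
the derivatives of the family are taken on the whole plane. -/
theorem one_sub_mul_exp_ne_zero {α : ℂ} (hα : ‖α‖ = 1) (hα1 : α ≠ 1) (r : ℝ) :
    1 - α * Real.exp r ≠ 0 := by
  intro h
  have h1 : α * Real.exp r = 1 := (sub_eq_zero.1 h).symm
  have h2 : Real.exp r = 1 := by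
    have := congrArg norm h1
    rwa [norm_mul, hα, one_mul, norm_one, Complex.norm_real, Real.norm_eq_abs,
      abs_of_pos (Real.exp_pos r)] at this
  rw [h2] at h1
  exact hα1 (by simpa using h1)

/-- This is the identity `y W_i'(y) = i W_i(y) + (i + 1) W_{i+1}(y)` for `W_i(y) = y ^ i / (1 - y) ^
(i + 1)`, composed with `y = α e ^ (-U)`. -/
theorem hasDerivAt_geomFactor {α : ℂ} (hα : ‖α‖ = 1) (hα1 : α ≠ 1) (i : ℕ) {U : ℝ → ℝ} {u t : ℝ}
    (hU : HasDerivAt U u t) :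
    HasDerivAt (fun t => (α * Real.exp (-U t)) ^ i / (1 - α * Real.exp (-U t)) ^ (i + 1))
      (-(i * u * ((α * Real.exp (-U t)) ^ i / (1 - α * Real.exp (-U t)) ^ (i + 1)) + (i + 1) * u *
        ((α * Real.exp (-U t)) ^ (i + 1) / (1 - α * Real.exp (-U t)) ^ (i + 1 + 1)))) t := by
  have hne := one_sub_mul_exp_ne_zero hα hα1 (-U t)
  have h1 : HasDerivAt (fun t => α * (Real.exp (-U t) : ℂ)) (-(u * (α * Real.exp (-U t)))) t := by
    refine (hU.neg.exp.ofReal_comp.const_mul α).congr_deriv ?_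
    simp only [Pi.neg_apply]
    push_cast
    ring
  have h2 := h1.const_sub 1
  refine ((h1.fun_pow i).div (h2.fun_pow (i + 1)) (pow_ne_zero _ hne)).congr_deriv ?_
  set y := α * (Real.exp (-U t) : ℂ) with hy
  rcases i with _ | i
  · simp
    field_simp
  · simp only [Nat.add_sub_cancel]
    push_cast
    field_simp
    ring

theorem hasDerivAt_geomTerm {α β : ℂ} (hα : ‖α‖ = 1) (hα1 : α ≠ 1) (hβ : ‖β‖ = 1) (hβ1 : β ≠ 1)
    (i l : ℕ) {X U V : ℝ → ℝ} {x u v t : ℝ} (hX : HasDerivAt X x t) (hU : HasDerivAt U u t)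
    (hV : HasDerivAt V v t) :
    HasDerivAt (fun t => geomTerm α β i l (X t) (U t) (V t))
      (-((x + i * u + l * v) * geomTerm α β i l (X t) (U t) (V t) +
      (i + 1) * u * geomTerm α β (i + 1) l (X t) (U t) (V t) +
      (l + 1) * v * geomTerm α β i (l + 1) (X t) (U t) (V t))) t := by
  unfold geomTerm
  refine ((hX.neg.exp.ofReal_comp.mul (hasDerivAt_geomFactor hα hα1 i hU)).mul
    (hasDerivAt_geomFactor hβ hβ1 l hV)).congr_deriv ?_
  simp only [Pi.neg_apply, Pi.mul_apply]
  push_cast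
  ring

/-- For `U ≥ 0` the number `e ^ (-U)` stays in the compact interval `[0, 1]`, on which the
denominator never vanishes. -/
theorem exists_geomFactor_bound {α : ℂ} (hα : ‖α‖ = 1) (hα1 : α ≠ 1) (i : ℕ) :
    ∃ C : ℝ, ∀ U : ℝ, 0 ≤ U →
      ‖(α * Real.exp (-U)) ^ i / (1 - α * Real.exp (-U)) ^ (i + 1)‖ ≤ C := by
  have hne : ∀ r ∈ Icc (0 : ℝ) 1, 1 - α * r ≠ 0 := by
    intro r hr h
    have h1 : α * r = 1 := (sub_eq_zero.1 h).symm
    have h2 : r = 1 := by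
      have := congrArg norm h1
      rwa [norm_mul, hα, one_mul, norm_one, Complex.norm_real, Real.norm_eq_abs,
        abs_of_nonneg hr.1] at this
    rw [h2] at h1
    exact hα1 (by simpa using h1)
  obtain ⟨C, hC⟩ := (isCompact_Icc (a := (0 : ℝ)) (b := 1)).exists_bound_of_continuousOn
    (f := fun r : ℝ => (α * r) ^ i / (1 - α * r) ^ (i + 1))
    (ContinuousOn.div (by fun_prop) (by fun_prop) fun r hr => pow_ne_zero _ (hne r hr))
  exact ⟨C, fun U hU => hC _ ⟨(Real.exp_pos _).le, Real.exp_le_one_iff.2 (by linarith)⟩⟩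

/-- The mixed derivative of order `(a, b)` of
`e ^ (-x t) / ((1 - α e ^ (-u t)) (1 - β e ^ (-v t)))`. -/
noncomputable def geomFamily (α β : ℂ) (x u v : Fin 2 → ℝ) (a b : ℕ) (t₁ t₂ : ℝ) : ℂ :=
  (-1) ^ (a + b) * ∑ i ∈ Finset.range (a + b + 1), ∑ l ∈ Finset.range (a + b + 1),
    diffCoeff (fun n m => linForm (x 0 : ℂ) (u 0) (v 0) n m ^ a *
      linForm (x 1 : ℂ) (u 1) (v 1) n m ^ b) i l *
    geomTerm α β i l (x 0 * t₁ + x 1 * t₂) (u 0 * t₁ + u 1 * t₂) (v 0 * t₁ + v 1 * t₂)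

theorem isDecayingFamily_geomFamily {α β : ℂ} (hα : ‖α‖ = 1) (hα1 : α ≠ 1) (hβ : ‖β‖ = 1)
    (hβ1 : β ≠ 1) {x u v : Fin 2 → ℝ} (hx : ∀ i, 0 < x i) (hu : ∀ i, 0 < u i)
    (hv : ∀ i, 0 < v i) : IsDecayingFamily (geomFamily α β x u v) where
  continuous a b := by
    unfold geomFamily geomTerm
    refine continuous_const.mul (continuous_finsetSum _ fun i _ => continuous_finsetSum _
      fun l _ => continuous_const.mul ((Continuous.mul (by fun_prop) ?_).mul ?_))
    · exact Continuous.div (by fun_prop) (by fun_prop)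
        fun t => pow_ne_zero _ (one_sub_mul_exp_ne_zero hα hα1 _)
    · exact Continuous.div (by fun_prop) (by fun_prop)
        fun t => pow_ne_zero _ (one_sub_mul_exp_ne_zero hβ hβ1 _)
  hasDerivAt_fst a b t₁ t₂ := by
    have h := hasDerivAt_sum_diffCoeff (x 0) (u 0) (v 0) (fun n m =>
      linForm (x 0 : ℂ) (u 0) (v 0) n m ^ a * linForm (x 1 : ℂ) (u 1) (v 1) n m ^ b) (a + b + 1)
      (fun i l h => diffCoeff_linForm_pow_eq_zero (fun i => (x i : ℂ)) (fun i => (u i : ℂ))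
        (fun i => (v i : ℂ)) a b i l (by omega))
      (fun i l t => geomTerm α β i l (x 0 * t + x 1 * t₂) (u 0 * t + u 1 * t₂)
        (v 0 * t + v 1 * t₂)) t₁
      (fun i l => hasDerivAt_geomTerm hα hα1 hβ hβ1 i l
        (((hasDerivAt_id t₁).const_mul (x 0)).add_const _ |>.congr_deriv (mul_one _))
        (((hasDerivAt_id t₁).const_mul (u 0)).add_const _ |>.congr_deriv (mul_one _))
        (((hasDerivAt_id t₁).const_mul (v 0)).add_const _ |>.congr_deriv (mul_one _)))
    refine (h.const_mul ((-1) ^ (a + b))).congr_deriv ?_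
    simp only [geomFamily, ← mul_assoc, ← pow_succ']
    rw [show a + 1 + b = a + b + 1 by ring, pow_succ (-1 : ℂ) (a + b)]
    ring
  hasDerivAt_snd a b t₁ t₂ := by
    have h := hasDerivAt_sum_diffCoeff (x 1) (u 1) (v 1) (fun n m =>
      linForm (x 0 : ℂ) (u 0) (v 0) n m ^ a * linForm (x 1 : ℂ) (u 1) (v 1) n m ^ b) (a + b + 1)
      (fun i l h => diffCoeff_linForm_pow_eq_zero (fun i => (x i : ℂ)) (fun i => (u i : ℂ))
        (fun i => (v i : ℂ)) a b i l (by omega))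
      (fun i l t => geomTerm α β i l (x 0 * t₁ + x 1 * t) (u 0 * t₁ + u 1 * t)
        (v 0 * t₁ + v 1 * t)) t₂
      (fun i l => hasDerivAt_geomTerm hα hα1 hβ hβ1 i l
        (((hasDerivAt_id t₂).const_mul (x 1)).const_add _ |>.congr_deriv (mul_one _))
        (((hasDerivAt_id t₂).const_mul (u 1)).const_add _ |>.congr_deriv (mul_one _))
        (((hasDerivAt_id t₂).const_mul (v 1)).const_add _ |>.congr_deriv (mul_one _)))
    refine (h.const_mul ((-1) ^ (a + b))).congr_deriv ?_
    simp only [geomFamily, mul_left_comm _ (linForm (x 0 : ℂ) (u 0) (v 0) _ _ ^ a), ← pow_succ']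
    rw [← add_assoc a b 1, pow_succ (-1 : ℂ) (a + b)]
    ring
  bound a b := by
    choose C hC using exists_geomFactor_bound hα hα1
    choose C' hC' using exists_geomFactor_bound hβ hβ1
    refine ⟨∑ i ∈ Finset.range (a + b + 1), ∑ l ∈ Finset.range (a + b + 1),
      ‖diffCoeff (fun n m => linForm (x 0 : ℂ) (u 0) (v 0) n m ^ a *
        linForm (x 1 : ℂ) (u 1) (v 1) n m ^ b) i l‖ * (C i * C' l), min (x 0) (x 1),
      lt_min (hx 0) (hx 1), fun t₁ t₂ h₁ h₂ => ?_⟩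
    rw [geomFamily, norm_mul, norm_pow, norm_neg, norm_one, one_pow, one_mul, Finset.sum_mul]
    refine norm_sum_le_of_le _ fun i _ => ?_
    rw [Finset.sum_mul]
    refine norm_sum_le_of_le _ fun l _ => ?_
    rw [norm_mul, mul_assoc]
    refine mul_le_mul_of_nonneg_left ?_ (norm_nonneg _)
    have hU : 0 ≤ u 0 * t₁ + u 1 * t₂ :=
      add_nonneg (mul_nonneg (hu 0).le h₁) (mul_nonneg (hu 1).le h₂)
    have hV : 0 ≤ v 0 * t₁ + v 1 * t₂ :=
      add_nonneg (mul_nonneg (hv 0).le h₁) (mul_nonneg (hv 1).le h₂)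
    have hX : Real.exp (-(x 0 * t₁ + x 1 * t₂)) ≤
        Real.exp (-min (x 0) (x 1) * t₁) * Real.exp (-min (x 0) (x 1) * t₂) := by
      rw [← Real.exp_add, Real.exp_le_exp]
      nlinarith [mul_le_mul_of_nonneg_right (min_le_left (x 0) (x 1)) h₁,
        mul_le_mul_of_nonneg_right (min_le_right (x 0) (x 1)) h₂]
    rw [geomTerm, norm_mul, norm_mul, Complex.norm_real, Real.norm_eq_abs,
      abs_of_pos (Real.exp_pos _)]
    have h3 := hC i _ hU
    have h4 := hC' l _ hV
    calc _ ≤ Real.exp (-min (x 0) (x 1) * t₁) * Real.exp (-min (x 0) (x 1) * t₂) * C i * C' l := by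
          refine mul_le_mul (mul_le_mul hX h3 (norm_nonneg _) (by positivity)) h4 (norm_nonneg _) ?_
          exact mul_nonneg (by positivity) ((norm_nonneg _).trans h3)
      _ = _ := by ring

/-- At the origin all exponentials are `1`, and the sign `(-1) ^ (N + N)` disappears. -/
theorem geomFamily_zero {α β : ℂ} (x u v : Fin 2 → ℝ) (N : ℕ) :
    geomFamily α β x u v N N 0 0 = regularizedSum α β (2 * N + 1)
      (fun n m => (linForm (x 0 : ℂ) (u 0) (v 0) n m * linForm (x 1 : ℂ) (u 1) (v 1) n m) ^ N) := by
  simp [geomFamily, regularizedSum, geomTerm, mul_pow, ← two_mul, mul_assoc]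

/-! ### The double series -/

theorem linForm_pos {x u v : ℝ} (hx : 0 < x) (hu : 0 < u) (hv : 0 < v) (n m : ℕ) :
    0 < linForm x u v n m := by
  unfold linForm
  positivity

/-- Bounding one form below by a multiple of `n + 1` and the other by a multiple of `m + 1`
dominates the series by a product of two convergent series in one variable. -/
theorem summable_linForm {x u v : Fin 2 → ℝ} (hx : ∀ i, 0 < x i) (hu : ∀ i, 0 < u i)
    (hv : ∀ i, 0 < v i) {σ : ℝ} (hσ : 1 < σ) :
    Summable fun n : ℕ × ℕ => ((linForm (x 0) (u 0) (v 0) n.1 n.2 *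
      linForm (x 1) (u 1) (v 1) n.1 n.2) ^ σ)⁻¹ := by
  set c₀ := min (x 0) (u 0) with hc₀
  set c₁ := min (x 1) (v 1) with hc₁
  have hc₀p : 0 < c₀ := lt_min (hx 0) (hu 0)
  have hc₁p : 0 < c₁ := lt_min (hx 1) (hv 1)
  have h1 : Summable fun n : ℕ => (((n : ℝ) + 1) ^ σ)⁻¹ := by
    simpa using (summable_nat_add_iff 1).2 (Real.summable_nat_rpow_inv.2 hσ)
  have h2 := (h1.mul_of_nonneg h1 (fun n => by positivity) (fun n => by positivity)).mul_left
    ((c₀ * c₁) ^ σ)⁻¹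
  refine Summable.of_nonneg_of_le (fun n => ?_) (fun n => ?_) h2
  · have := mul_pos (linForm_pos (hx 0) (hu 0) (hv 0) n.1 n.2)
      (linForm_pos (hx 1) (hu 1) (hv 1) n.1 n.2)
    positivity
  · rw [← mul_inv, ← mul_inv, ← Real.mul_rpow (by positivity) (by positivity),
      ← Real.mul_rpow (by positivity) (by positivity)]
    refine inv_anti₀ (by positivity) (Real.rpow_le_rpow (by positivity) ?_ (by linarith))
    have e0 : c₀ * (n.1 + 1) ≤ linForm (x 0) (u 0) (v 0) n.1 n.2 := by
      unfold linForm
      have a1 : c₀ ≤ x 0 := min_le_left _ _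
      have a2 : (n.1 : ℝ) * c₀ ≤ n.1 * u 0 :=
        mul_le_mul_of_nonneg_left (min_le_right _ _) n.1.cast_nonneg
      have a3 : 0 ≤ (n.2 : ℝ) * v 0 := mul_nonneg n.2.cast_nonneg (hv 0).le
      linarith
    have e1 : c₁ * (n.2 + 1) ≤ linForm (x 1) (u 1) (v 1) n.1 n.2 := by
      unfold linForm
      have a1 : c₁ ≤ x 1 := min_le_left _ _
      have a2 : (n.2 : ℝ) * c₁ ≤ n.2 * v 1 :=
        mul_le_mul_of_nonneg_left (min_le_right _ _) n.2.cast_nonneg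
      have a3 : 0 ≤ (n.1 : ℝ) * u 1 := mul_nonneg n.1.cast_nonneg (hu 1).le
      linarith
    calc c₀ * c₁ * ((n.1 + 1) * (n.2 + 1)) = c₀ * (n.1 + 1) * (c₁ * (n.2 + 1)) := by ring
      _ ≤ _ := mul_le_mul e0 e1 (by positivity) (e0.trans' (by positivity))

theorem integral_mellinKernel_exp {A B : ℝ} (hA : 0 < A) (hB : 0 < B) {s : ℂ} (hs : 0 < s.re) :
    ∫ t, mellinKernel s t * (Real.exp (-(A * t.1 + B * t.2)) : ℂ) ∂quadrant =
      Gamma s ^ 2 / ((A * B : ℝ) : ℂ) ^ s := by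
  have h : ∀ A : ℝ, 0 < A → ∫ t in Ioi (0 : ℝ), (t : ℂ) ^ (s - 1) * (Real.exp (-(A * t)) : ℂ) =
      Gamma s / (A : ℂ) ^ s := by
    intro A hA
    have := integral_cpow_mul_exp_neg_mul_Ioi (a := s) (r := A) hs (by simpa using hA)
    push_cast
    rw [this, one_div, Complex.inv_cpow, div_eq_inv_mul]
    rw [Complex.arg_ofReal_of_nonneg hA.le]
    exact Real.pi_pos.ne
  have e : ∀ t : ℝ × ℝ, mellinKernel s t * (Real.exp (-(A * t.1 + B * t.2)) : ℂ) =
      ((t.1 : ℂ) ^ (s - 1) * (Real.exp (-(A * t.1)) : ℂ)) *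
      ((t.2 : ℂ) ^ (s - 1) * (Real.exp (-(B * t.2)) : ℂ)) := by
    intro t
    rw [mellinKernel, neg_add, Real.exp_add]
    push_cast
    ring
  simp_rw [e]
  rw [quadrant, integral_prod_mul (fun t : ℝ => (t : ℂ) ^ (s - 1) * (Real.exp (-(A * t)) : ℂ))
    (fun t : ℝ => (t : ℂ) ^ (s - 1) * (Real.exp (-(B * t)) : ℂ)), h A hA, h B hB]
  push_cast
  rw [Complex.mul_cpow_ofReal_nonneg hA.le hB.le]
  ring

/-- On the quadrant the norm of the integrand is the same integrand at the real point `Re s`, so the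
previous evaluation applies there. -/
theorem integral_norm_mellinKernel_exp {A B : ℝ} (hA : 0 < A) (hB : 0 < B) {s : ℂ}
    (hs : 0 < s.re) :
    ∫ t, ‖mellinKernel s t * (Real.exp (-(A * t.1 + B * t.2)) : ℂ)‖ ∂quadrant =
      Real.Gamma s.re ^ 2 * ((A * B) ^ s.re)⁻¹ := by
  have h := integral_mellinKernel_exp hA hB (s := (s.re : ℂ)) (by simpa using hs)
  have e : ∀ᵐ t ∂quadrant, mellinKernel (s.re : ℂ) t * (Real.exp (-(A * t.1 + B * t.2)) : ℂ) =
      ((‖mellinKernel s t * (Real.exp (-(A * t.1 + B * t.2)) : ℂ)‖ : ℝ) : ℂ) := by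
    filter_upwards [ae_quadrant] with t ht
    rw [norm_mul, norm_mellinKernel s ht, Complex.norm_real, Real.norm_eq_abs,
      abs_of_pos (Real.exp_pos _), Real.mul_rpow ht.1.le ht.2.le, mellinKernel]
    push_cast [Complex.ofReal_cpow ht.1.le, Complex.ofReal_cpow ht.2.le]
    ring
  rw [integral_congr_ae e, integral_complex_ofReal] at h
  apply Complex.ofReal_injective
  rw [h, Complex.ofReal_mul (_ ^ 2), Complex.ofReal_inv, Complex.ofReal_cpow (mul_pos hA hB).le,
    Complex.ofReal_pow, Complex.Gamma_ofReal, div_eq_mul_inv]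

theorem hasSum_geomTerm {α β : ℂ} (hα : ‖α‖ = 1) (hβ : ‖β‖ = 1) (X : ℝ) {U V : ℝ} (hU : 0 < U)
    (hV : 0 < V) : HasSum (fun n : ℕ × ℕ => α ^ n.1 * β ^ n.2 *
      (Real.exp (-(X + n.1 * U + n.2 * V)) : ℂ)) (geomTerm α β 0 0 X U V) := by
  have hg : ∀ {α : ℂ}, ‖α‖ = 1 → ∀ {U : ℝ}, 0 < U → ‖α * (Real.exp (-U) : ℂ)‖ < 1 := by
    intro α hα U hU
    rw [norm_mul, hα, one_mul, Complex.norm_real, Real.norm_eq_abs, abs_of_pos (Real.exp_pos _)]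
    simpa using hU
  have h1 := hasSum_geometric_of_norm_lt_one (hg hα hU)
  have h2 := hasSum_geometric_of_norm_lt_one (hg hβ hV)
  have h3 := (h1.mul h2 (summable_mul_of_summable_norm
    (summable_norm_geometric_of_norm_lt_one (hg hα hU))
    (summable_norm_geometric_of_norm_lt_one (hg hβ hV)))).mul_left (Real.exp (-X) : ℂ)
  have e : geomTerm α β 0 0 X U V = (Real.exp (-X) : ℂ) *
      ((1 - α * (Real.exp (-U) : ℂ))⁻¹ * (1 - β * (Real.exp (-V) : ℂ))⁻¹) := by
    simp [geomTerm, mul_assoc]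
  rw [e]
  refine (congrArg (fun f => HasSum f _) (funext fun n => ?_)).mpr h3
  rw [neg_add, neg_add, Real.exp_add, Real.exp_add, ← mul_neg, ← mul_neg, Real.exp_nat_mul,
    Real.exp_nat_mul]
  push_cast
  ring

/-- The analytic continuation of the double series `∑ α ^ n β ^ m / (L₀ L₁) ^ s` of two positive
linear forms, and its values at the non-positive integers. -/
theorem exists_entire_doubleSeries {α β : ℂ} (hα : ‖α‖ = 1) (hα1 : α ≠ 1) (hβ : ‖β‖ = 1)
    (hβ1 : β ≠ 1) {x u v : Fin 2 → ℝ} (hx : ∀ i, 0 < x i) (hu : ∀ i, 0 < u i)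
    (hv : ∀ i, 0 < v i) : ∃ Z : ℂ → ℂ, Differentiable ℂ Z ∧
      (∀ s : ℂ, 1 < s.re → HasSum (fun n : ℕ × ℕ => α ^ n.1 * β ^ n.2 /
        ((linForm (x 0) (u 0) (v 0) n.1 n.2 * linForm (x 1) (u 1) (v 1) n.1 n.2 : ℝ) : ℂ) ^ s)
        (Z s)) ∧
      ∀ N : ℕ, Z (-N) = regularizedSum α β (2 * N + 1) fun n m =>
        (linForm (x 0 : ℂ) (u 0) (v 0) n m * linForm (x 1 : ℂ) (u 1) (v 1) n m) ^ N := by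
  have hF := isDecayingFamily_geomFamily hα hα1 hβ hβ1 hx hu hv
  obtain ⟨Z, hZ, hZ1, hZ2⟩ := hF.exists_entire
  refine ⟨Z, hZ, fun s hs => ?_, fun N => by rw [hZ2, geomFamily_zero]⟩
  have hs0 : 0 < s.re := by linarith
  rw [hZ1 s hs0]
  set A : ℕ × ℕ → ℝ := fun n => linForm (x 0) (u 0) (v 0) n.1 n.2 with hAd
  set B : ℕ × ℕ → ℝ := fun n => linForm (x 1) (u 1) (v 1) n.1 n.2 with hBd
  have hA : ∀ n, 0 < A n := fun n => linForm_pos (hx 0) (hu 0) (hv 0) n.1 n.2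
  have hB : ∀ n, 0 < B n := fun n => linForm_pos (hx 1) (hu 1) (hv 1) n.1 n.2
  set f : ℕ × ℕ → ℝ × ℝ → ℂ := fun n t => α ^ n.1 * β ^ n.2 *
    (mellinKernel s t * (Real.exp (-(A n * t.1 + B n * t.2)) : ℂ)) with hf
  have hint : ∀ n, Integrable (f n) quadrant := by
    intro n
    refine Integrable.const_mul ?_ _
    refine integrable_mellinKernel_mul (f := fun t₁ t₂ => (Real.exp (-(A n * t₁ + B n * t₂)) : ℂ))
      (by fun_prop) (C := 1) (c := min (A n) (B n)) (lt_min (hA n) (hB n)) ?_ hs0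
    intro t₁ t₂ h₁ h₂
    rw [Complex.norm_real, Real.norm_eq_abs, abs_of_pos (Real.exp_pos _), one_mul, ← Real.exp_add,
      Real.exp_le_exp]
    nlinarith [mul_le_mul_of_nonneg_right (min_le_left (A n) (B n)) h₁,
      mul_le_mul_of_nonneg_right (min_le_right (A n) (B n)) h₂]
  have hnorm : ∀ n, ∫ t, ‖f n t‖ ∂quadrant = Real.Gamma s.re ^ 2 * ((A n * B n) ^ s.re)⁻¹ := by
    intro n
    rw [← integral_norm_mellinKernel_exp (hA n) (hB n) hs0]
    refine integral_congr_ae (Eventually.of_forall fun t => ?_)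
    simp [hf, hα, hβ]
  -- Sum and integral are interchanged by absolute convergence; this is where `Re s > 1` is used.
  have key := hasSum_integral_of_summable_integral_norm hint (by
    simp_rw [hnorm]
    exact (summable_linForm hx hu hv hs).mul_left _)
  have hG : Gamma s ^ 2 ≠ 0 := pow_ne_zero _ (Gamma_ne_zero_of_re_pos hs0)
  have hval : ∫ t, (∑' n, f n t) ∂quadrant = doubleMellin (geomFamily α β x u v 0 0) s := by
    refine integral_congr_ae ?_
    filter_upwards [ae_quadrant] with t ht
    have h := (hasSum_geomTerm hα hβ (x 0 * t.1 + x 1 * t.2) (U := u 0 * t.1 + u 1 * t.2)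
      (V := v 0 * t.1 + v 1 * t.2)
      (add_pos (mul_pos (hu 0) ht.1) (mul_pos (hu 1) ht.2))
      (add_pos (mul_pos (hv 0) ht.1) (mul_pos (hv 1) ht.2))).mul_left (mellinKernel s t)
    have h0 : geomFamily α β x u v 0 0 t.1 t.2 = geomTerm α β 0 0 (x 0 * t.1 + x 1 * t.2)
        (u 0 * t.1 + u 1 * t.2) (v 0 * t.1 + v 1 * t.2) := by
      simp [geomFamily, diffCoeff]
    rw [h0, ← h.tsum_eq]
    refine tsum_congr fun n => ?_
    simp only [hf, hAd, hBd, linForm]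
    rw [mul_left_comm]
    congr 5
    ring
  rw [hval] at key
  refine (congrArg (fun f => HasSum f _) (funext fun n => ?_)).mpr (key.div_const (Gamma s ^ 2))
  simp only [hf]
  rw [integral_const_mul, integral_mellinKernel_exp (hA n) (hB n) hs0]
  rw [← mul_one (_ / _), ← div_self hG]
  ring

end ConeZeta

namespace ConeZeta

/-! ### Roots of unity and powers of units in `ℤ_p` -/

section

variable {p : ℕ} [hp : Fact p.Prime]

theorem padicInt_natCast_dvd_iff (n : ℕ) : (p : ℤ_[p]) ∣ n ↔ p ∣ n := by
  have := PadicInt.norm_int_lt_one_iff_dvd (p := p) n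
  rw [← PadicInt.norm_lt_one_iff_dvd]
  exact_mod_cast this

theorem padicInt_not_sq_dvd : ¬ (p : ℤ_[p]) ^ 2 ∣ p := by
  intro h
  have h0 : (p : ℤ_[p]) ≠ 0 := by exact_mod_cast hp.out.ne_zero
  rw [pow_two] at h
  have h1 : (p : ℤ_[p]) ∣ ((1 : ℕ) : ℤ_[p]) := by
    simpa using (mul_dvd_mul_iff_left h0).1 (h.trans (mul_one (p : ℤ_[p])).symm.dvd)
  exact hp.out.one_lt.ne' (Nat.dvd_one.1 ((padicInt_natCast_dvd_iff 1).1 h1))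

theorem geom_sum_sub_dvd {x c : ℤ_[p]} (h : c ∣ x - 1) (n : ℕ) :
    c ∣ ∑ i ∈ Finset.range n, x ^ i - n := by
  have : (n : ℤ_[p]) = ∑ i ∈ Finset.range n, 1 := by simp
  rw [this, ← Finset.sum_sub_distrib]
  refine Finset.dvd_sum fun i _ => h.trans ?_
  simpa using sub_dvd_pow_sub_pow x 1 i

/-- If `x ≠ 1`, then `1 + x + ⋯ + x ^ (q - 1) = 0`. Modulo `p` this sum is `q`, so `q = p`; then
modulo `p ^ 2` it is `p`, which is absurd. For `p = 2` the last congruence requires `x ≡ 1` modulo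
`4`. -/
theorem eq_one_of_pow_prime_eq_one {x : ℤ_[p]} {q : ℕ} (hq : q.Prime) (hx : x ^ q = 1)
    (h1 : (p : ℤ_[p]) ∣ x - 1) (h2 : p = 2 → (p : ℤ_[p]) ^ 2 ∣ x - 1) : x = 1 := by
  by_contra hne
  have hs : ∑ i ∈ Finset.range q, x ^ i = 0 := by
    have := geom_sum_mul x q
    rw [hx, sub_self] at this
    exact (mul_eq_zero.1 this).resolve_right (sub_ne_zero.2 hne)
  have hpq : p ∣ q := by
    rw [← padicInt_natCast_dvd_iff]
    simpa [hs] using geom_sum_sub_dvd h1 q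
  obtain rfl := (Nat.prime_dvd_prime_iff_eq hp.out hq).1 hpq
  rcases hp.out.eq_two_or_odd' with h | h
  · exact padicInt_not_sq_dvd (by simpa [hs] using geom_sum_sub_dvd (h2 h) p)
  · obtain ⟨b, hb⟩ := h1
    have := odd_sq_dvd_geom_sum₂_sub (R := ℤ_[p]) (a := 1) (b := b) h
    rw [show (1 : ℤ_[p]) + p * b = x by rw [← hb]; ring] at this
    simp only [one_pow, mul_one, hs, zero_sub, dvd_neg] at this
    exact padicInt_not_sq_dvd this

theorem eq_one_of_pow_eq_one {x : ℤ_[p]} {n : ℕ} (hn : n ≠ 0) (hx : x ^ n = 1)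
    (h : (p : ℤ_[p]) ^ 2 ∣ x - 1) : x = 1 := by
  induction n using induction_on_primes generalizing x with
  | zero => exact absurd rfl hn
  | one => simpa using hx
  | prime_mul q n hq ih =>
    have hd : (p : ℤ_[p]) ^ 2 ∣ x ^ n - 1 := h.trans (by simpa using sub_dvd_pow_sub_pow x 1 n)
    have h1 : x ^ n = 1 := eq_one_of_pow_prime_eq_one hq (by rw [← pow_mul, mul_comm, hx])
      ((dvd_pow_self _ two_ne_zero).trans hd) (fun _ => hd)
    exact ih (right_ne_zero_of_mul hn) h1 h

theorem norm_eq_one_of_mem_torsion (g : CommGroup.torsion ℚ_[p]ˣ) : ‖((g : ℚ_[p]ˣ) : ℚ_[p])‖ = 1 := by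
  obtain ⟨n, hn, h⟩ := isOfFinOrder_iff_pow_eq_one.1 g.2
  have h1 : ((g : ℚ_[p]ˣ) : ℚ_[p]) ^ n = 1 := by rw [← Units.val_pow_eq_pow_val, h, Units.val_one]
  have h2 := congrArg norm h1
  rw [norm_pow, norm_one] at h2
  exact (pow_eq_one_iff_of_nonneg (norm_nonneg _) hn.ne').1 h2

/-- The inclusion of the roots of unity of `ℚ_p` in `ℤ_p`. -/
def torsionToInt : CommGroup.torsion ℚ_[p]ˣ →* ℤ_[p] where
  toFun g := ⟨((g : ℚ_[p]ˣ) : ℚ_[p]), (norm_eq_one_of_mem_torsion g).le⟩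
  map_one' := rfl
  map_mul' _ _ := rfl

theorem norm_torsionToInt (g : CommGroup.torsion ℚ_[p]ˣ) : ‖torsionToInt g‖ = 1 := by
  rw [PadicInt.norm_def]
  exact norm_eq_one_of_mem_torsion g

theorem torsionToInt_injective : Function.Injective (torsionToInt (p := p)) := by
  intro g h hgh
  apply Subtype.ext
  apply Units.ext
  exact congrArg (fun z : ℤ_[p] => (z : ℚ_[p])) hgh

theorem exists_torsionToInt_pow_eq_one (g : CommGroup.torsion ℚ_[p]ˣ) :
    ∃ n, n ≠ 0 ∧ torsionToInt g ^ n = 1 := by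
  obtain ⟨n, hn, h⟩ := isOfFinOrder_iff_pow_eq_one.1 g.2
  refine ⟨n, hn.ne', ?_⟩
  rw [← map_pow, show g ^ n = 1 from Subtype.ext h, map_one]

/-- A root of unity congruent to `1` modulo `p ^ 2` is trivial, so reduction modulo `p ^ 2` is
injective on the torsion. The square serves to include `p = 2`. -/
instance : Finite (CommGroup.torsion ℚ_[p]ˣ) := by
  have : NeZero (p ^ 2) := ⟨pow_ne_zero 2 hp.out.ne_zero⟩
  refine Finite.of_injective (fun g => PadicInt.toZModPow 2 (torsionToInt (p := p) g)) ?_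
  intro g h hgh
  rw [← div_eq_one]
  apply torsionToInt_injective
  rw [map_one]
  obtain ⟨n, hn, hn1⟩ := exists_torsionToInt_pow_eq_one (g / h)
  refine eq_one_of_pow_eq_one hn hn1 ?_
  rw [← Ideal.mem_span_singleton, ← PadicInt.ker_toZModPow, RingHom.mem_ker, map_sub, map_one,
    div_eq_mul_inv, map_mul, map_mul]
  simp only at hgh
  rw [hgh, ← map_mul, ← map_mul, mul_inv_cancel, map_one, map_one, sub_self]

theorem numRootsOfUnity_pos : 0 < numRootsOfUnity p := Nat.card_pos

theorem torsionToInt_pow (g : CommGroup.torsion ℚ_[p]ˣ) :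
    torsionToInt g ^ numRootsOfUnity p = 1 := by
  rw [← map_pow, numRootsOfUnity, pow_card_eq_one', map_one]

theorem dvd_pow_sub_self (x : ℤ_[p]) : (p : ℤ_[p]) ∣ x ^ p - x := by
  rw [← Ideal.mem_span_singleton, ← PadicInt.maximalIdeal_eq_span_p, ← PadicInt.ker_toZMod,
    RingHom.mem_ker, map_sub, map_pow, ZMod.pow_card, sub_self]

theorem dvd_pow_sub_one {x : ℤ_[p]} (hx : ‖x‖ = 1) : (p : ℤ_[p]) ∣ x ^ (p - 1) - 1 := by
  have h := dvd_pow_sub_self x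
  obtain ⟨y, hy⟩ := PadicInt.isUnit_iff.2 hx
  have : x ^ p - x = x * (x ^ (p - 1) - 1) := by
    rw [mul_sub, mul_one, ← pow_succ', Nat.sub_add_cancel hp.out.one_le]
  rw [this, ← hy] at h
  rw [← hy]
  exact (Units.dvd_mul_left).1 h

/-- The Teichmüller representative, obtained by applying Hensel's lemma to `X ^ (p - 1) - 1`. -/
theorem exists_torsion_dvd_sub {x : ℤ_[p]} (hx : ‖x‖ = 1) :
    ∃ g : CommGroup.torsion ℚ_[p]ˣ, (p : ℤ_[p]) ∣ x - torsionToInt g := by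
  set F : Polynomial ℤ_[p] := Polynomial.X ^ (p - 1) - 1 with hF
  have hp1 : p - 1 ≠ 0 := (Nat.sub_pos_of_lt hp.out.one_lt).ne'
  have hd : ‖Polynomial.aeval x (Polynomial.derivative F)‖ = 1 := by
    simp only [hF, Polynomial.derivative_sub, Polynomial.derivative_X_pow, Polynomial.derivative_one,
      sub_zero, map_mul, map_pow, Polynomial.aeval_X, norm_mul, norm_pow, hx, one_pow, mul_one]
    simp
  have hv : ‖Polynomial.aeval x F‖ < ‖Polynomial.aeval x (Polynomial.derivative F)‖ ^ 2 := by
    rw [hd, one_pow, PadicInt.norm_lt_one_iff_dvd]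
    simpa [hF] using dvd_pow_sub_one hx
  obtain ⟨z, hz, hzx, -⟩ := hensels_lemma hv
  rw [hd] at hzx
  have hz1 : z ^ (p - 1) = 1 := by simpa [hF, sub_eq_zero] using hz
  have hzQ : (z : ℚ_[p]) ^ (p - 1) = 1 := by
    rw [← PadicInt.coe_pow, hz1, PadicInt.coe_one]
  set u : ℚ_[p]ˣ := Units.ofPowEqOne (z : ℚ_[p]) (p - 1) hzQ hp1 with hu
  have hu1 : u ∈ CommGroup.torsion ℚ_[p]ˣ := by
    refine isOfFinOrder_iff_pow_eq_one.2 ⟨p - 1, Nat.pos_of_ne_zero hp1, Units.ext ?_⟩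
    rw [Units.val_pow_eq_pow_val]
    exact hzQ
  refine ⟨⟨u, hu1⟩, ?_⟩
  have : torsionToInt ⟨u, hu1⟩ = z := rfl
  rw [this, ← PadicInt.norm_lt_one_iff_dvd, norm_sub_rev]
  exact hzx

theorem dvd_pow_numRootsOfUnity_sub_one {x : ℤ_[p]} (hx : ‖x‖ = 1) :
    (p : ℤ_[p]) ∣ x ^ numRootsOfUnity p - 1 := by
  obtain ⟨g, hg⟩ := exists_torsion_dvd_sub hx
  rw [← torsionToInt_pow g]
  exact hg.trans (sub_dvd_pow_sub_pow _ _ _)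

/-- Half of the number of roots of unity of `ℚ_p`; it is prime to `p`. -/
theorem exists_numRootsOfUnity_eq : ∃ W, numRootsOfUnity p = 2 * W ∧ ¬ p ∣ W ∧
    (p ≠ 2 → ¬ p ∣ numRootsOfUnity p) := by
  have hodd : p ≠ 2 → ¬ p ∣ numRootsOfUnity p := by
    intro h2 hdvd
    obtain ⟨g, hg⟩ := exists_prime_orderOf_dvd_card' p hdvd
    have hgp : torsionToInt g ^ p = 1 := by
      have := pow_orderOf_eq_one g
      rw [hg] at this
      rw [← map_pow, this, map_one]
    have h1 : torsionToInt g = 1 := by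
      refine eq_one_of_pow_prime_eq_one hp.out hgp ?_ (fun h => absurd h h2)
      rw [← hgp, ← dvd_neg, neg_sub]
      exact dvd_pow_sub_self _
    rw [← map_one torsionToInt] at h1
    rw [torsionToInt_injective h1, orderOf_one] at hg
    exact hp.out.one_lt.ne hg
  obtain ⟨W, hW⟩ := two_dvd_numRootsOfUnity p
  refine ⟨W, hW, fun hdvd => ?_, hodd⟩
  by_cases h2 : p = 2
  · obtain ⟨k, hk⟩ := hdvd
    obtain ⟨g, hg⟩ := IsCyclic.exists_ofOrder_eq_natCard (α := CommGroup.torsion ℚ_[p]ˣ)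
    -- For `p = 2`, if `4` divided the number of roots of unity, `g ^ k` would have order `4`. It is
    -- a unit, hence `≡ 1` modulo `2`, so its square is `≡ 1` modulo `4` and therefore equal to `1`:
    -- a contradiction.
    have hc : orderOf g = k * (p * p) := by
      rw [hg, ← numRootsOfUnity, hW, hk, h2]
      ring
    have hk0 : k ≠ 0 := by
      rintro rfl
      have := numRootsOfUnity_pos (p := p)
      rw [hW, hk] at this
      simp at this
    have hp1 : ((g ^ k) ^ p) ^ p = 1 := by
      rw [← pow_mul, ← pow_mul, ← hc, pow_orderOf_eq_one]
    have hsq : torsionToInt ((g ^ k) ^ p) = 1 := by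
      have hsqd : (p : ℤ_[p]) ^ 2 ∣ torsionToInt ((g ^ k) ^ p) - 1 := by
        obtain ⟨n, hn, hn1⟩ := exists_torsionToInt_pow_eq_one (g ^ k)
        have hu : ‖torsionToInt (g ^ k)‖ = 1 := norm_torsionToInt _
        have := dvd_pow_sub_one hu
        have h1 : p - 1 = 1 := by omega
        rw [h1, pow_one] at this
        have := dvd_sub_pow_of_dvd_sub (p := p) this 1
        simpa using this
      exact eq_one_of_pow_prime_eq_one hp.out (by rw [← map_pow, hp1, map_one])
        ((dvd_pow_self _ two_ne_zero).trans hsqd) (fun _ => hsqd)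
    rw [← map_one torsionToInt] at hsq
    have h3 := torsionToInt_injective hsq
    rw [← pow_mul] at h3
    have h4 := Nat.le_of_dvd (Nat.pos_of_ne_zero (mul_ne_zero hk0 hp.out.ne_zero))
      (orderOf_dvd_of_pow_eq_one h3)
    rw [hc, ← mul_assoc] at h4
    have h5 : 0 < k * p := Nat.pos_of_ne_zero (mul_ne_zero hk0 hp.out.ne_zero)
    have := hp.out.one_lt
    nlinarith
  · exact hodd h2 (hW ▸ hdvd.mul_left 2)

/-- Write `w` for the number of roots of unity. Then `x ^ w ≡ 1` modulo `p`, and raising to the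
power `p ^ k` improves the modulus to `p ^ (k + 1)`. One power is given away because for `p = 2` the
two divisibility hypotheses share a factor `2` and only yield `w * p ^ k ∣ d`. -/
theorem norm_pow_sub_one_le {x : ℤ_[p]} (hx : ‖x‖ = 1) {d k : ℕ} (h1 : numRootsOfUnity p ∣ d)
    (h2 : p ^ (k + 1) ∣ d) : ‖x ^ d - 1‖ ≤ (p : ℝ) ^ (-(k : ℤ)) := by
  have key : ∀ n k : ℕ, numRootsOfUnity p * p ^ k ∣ n →
      ‖x ^ n - 1‖ ≤ (p : ℝ) ^ (-((k : ℕ) : ℤ)) := by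
    rintro _ k ⟨j, rfl⟩
    have ha := dvd_sub_pow_of_dvd_sub (dvd_pow_numRootsOfUnity_sub_one hx) k
    rw [one_pow, ← pow_mul] at ha
    have hb : (p : ℤ_[p]) ^ k ∣ x ^ (numRootsOfUnity p * p ^ k * j) - 1 := by
      refine ((pow_dvd_pow _ k.le_succ).trans ha).trans ?_
      rw [pow_mul x _ j]
      simpa using sub_dvd_pow_sub_pow (x ^ (numRootsOfUnity p * p ^ k)) 1 j
    rwa [PadicInt.norm_le_pow_iff_mem_span_pow, Ideal.mem_span_singleton]
  obtain ⟨W, hW, hpW, hodd⟩ := exists_numRootsOfUnity_eq (p := p)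
  refine key d k ?_
  by_cases hp2 : p = 2
  · have : W * p ^ (k + 1) ∣ d := by
      refine Nat.Coprime.mul_dvd_of_dvd_of_dvd ?_ ((Dvd.intro_left 2 hW.symm).trans h1) h2
      exact (Nat.Coprime.pow_left _ ((Nat.Prime.coprime_iff_not_dvd hp.out).2 hpW)).symm
    refine (dvd_of_eq ?_).trans this
    rw [hW, pow_succ, show 2 * W * p ^ k = W * (p ^ k * 2) by ring]
    congr 2
    exact hp2.symm
  · refine (mul_dvd_mul_left _ (pow_dvd_pow p k.le_succ)).trans ?_
    refine Nat.Coprime.mul_dvd_of_dvd_of_dvd ?_ h1 h2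
    exact (Nat.Coprime.pow_left _ ((Nat.Prime.coprime_iff_not_dvd hp.out).2 (hodd hp2))).symm

theorem exists_interpolationSet_near (s : interpolationDomain p) (k : ℕ) :
    ∃ m ∈ interpolationSet p, ‖(s : ℤ_[p]) - (m : ℤ)‖ ≤ (p : ℝ) ^ (-(k : ℤ)) := by
  obtain ⟨W, hW, hpW, -⟩ := exists_numRootsOfUnity_eq (p := p)
  obtain ⟨s, t, rfl⟩ := s
  have hu : IsUnit (W : ℤ_[p]) := by
    rw [PadicInt.isUnit_iff]
    refine le_antisymm (PadicInt.norm_le_one _) (not_lt.1 fun h => ?_)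
    rw [PadicInt.norm_lt_one_iff_dvd, padicInt_natCast_dvd_iff] at h
    exact hpW h
  obtain ⟨w, hw⟩ := hu
  -- One wants `1 - 2 W n` close to `1 + 2 t`, so `n` must approximate `-t / W`, which makes sense
  -- because `W` is a unit. Adding `p ^ k` does not affect the congruence and ensures `n ≥ 1`, hence
  -- a nonpositive `m`.
  set r : ℤ_[p] := -(((w⁻¹ : ℤ_[p]ˣ) : ℤ_[p]) * t) with hr
  set n : ℕ := r.appr k + p ^ k with hn
  have hn1 : 1 ≤ n := le_add_left (Nat.one_le_pow _ _ hp.out.pos)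
  have hWpos : 1 ≤ W := by
    have := numRootsOfUnity_pos (p := p)
    omega
  refine ⟨1 - 2 * W * n, ⟨?_, ?_⟩, ?_⟩
  · have : (1 : ℤ) ≤ W * n := by exact_mod_cast Nat.mul_pos hWpos hn1
    linarith [this, mul_assoc (2 : ℤ) W n]
  · rw [hW]
    refine (Int.modEq_iff_dvd.2 ⟨n, ?_⟩)
    push_cast
    ring
  · rw [PadicInt.norm_le_pow_iff_mem_span_pow, Ideal.mem_span_singleton]
    have h1 := Ideal.mem_span_singleton.1 (PadicInt.appr_spec k r)
    have h2 : (p : ℤ_[p]) ^ k ∣ (n : ℤ_[p]) - r := by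
      rw [hn, ← dvd_neg]
      push_cast
      have := dvd_sub h1 (dvd_refl ((p : ℤ_[p]) ^ k))
      refine this.trans (dvd_of_eq (by ring))
    refine (h2.mul_left (2 * W)).trans (dvd_of_eq ?_)
    push_cast
    rw [mul_sub, hr, ← hw]
    linear_combination (2 * t) * w.mul_inv

end

end ConeZeta

namespace ConeZeta

/-! ### `ℤ_p` inside `ℂ_p` and Mahler coefficients -/

section

open Filter Topology

variable {p : ℕ} [hp : Fact p.Prime]

/-- The embedding of `ℤ_p` in `ℂ_p`. -/
noncomputable def intToComplex (p : ℕ) [Fact p.Prime] : ℤ_[p] →+* ℂ_[p] :=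
  (algebraMap ℚ_[p] ℂ_[p]).comp PadicInt.Coe.ringHom

theorem intToComplex_apply (x : ℤ_[p]) : intToComplex p x = algebraMap ℚ_[p] ℂ_[p] (x : ℚ_[p]) := rfl

@[simp] theorem norm_intToComplex (x : ℤ_[p]) : ‖intToComplex p x‖ = ‖x‖ := by
  rw [intToComplex_apply, norm_algebraMap', PadicInt.norm_def]

theorem isometry_intToComplex : Isometry (intToComplex p) :=
  AddMonoidHomClass.isometry_of_norm _ norm_intToComplex

instance : NonarchimedeanRing ℂ_[p] where
  is_nonarchimedean := NonarchimedeanAddGroup.is_nonarchimedean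

/-- The coefficients of the Mahler expansion of `h` in the functions `y ↦ choose (y - 1) i`. -/
noncomputable def mahlerCoeff (h : C(ℤ_[p], ℤ_[p])) (i : ℕ) : ℤ_[p] :=
  (fwdDiff 1)^[i] (fun x => h (x + 1)) 0

/-- Composition with the translation by `1`. -/
noncomputable def shiftMap (h : C(ℤ_[p], ℤ_[p])) : C(ℤ_[p], ℤ_[p]) := ⟨fun x => h (x + 1), by fun_prop⟩

theorem tendsto_mahlerCoeff (h : C(ℤ_[p], ℤ_[p])) : Tendsto (mahlerCoeff h) atTop (𝓝 0) :=
  PadicInt.fwdDiff_tendsto_zero (shiftMap h)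

/-- Mahler's theorem for `x ↦ h (x + 1)`, evaluated at `y - 1`. -/
theorem hasSum_mahlerCoeff (h : C(ℤ_[p], ℤ_[p])) (y : ℤ_[p]) :
    HasSum (fun i => mahlerCoeff h i * Ring.choose (y - 1) i) (h y) := by
  have h1 := ContinuousMap.hasSum_apply (PadicInt.hasSum_mahler (shiftMap h)) (y - 1)
  have e : h y = shiftMap h (y - 1) := by simp [shiftMap]
  rw [e]
  refine (congrArg (fun f => HasSum f _) (funext fun n => ?_)).mpr h1
  simp [PadicInt.mahlerTerm_apply, mahler_apply, mahlerCoeff, shiftMap, mul_comm]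

/-- Iterated differences are integral combinations of values, so in an ultrametric space they do not
exceed the sup norm. -/
theorem norm_mahlerCoeff_sub_le {h h' : C(ℤ_[p], ℤ_[p])} {C : ℝ} (hC : 0 ≤ C)
    (hh : ∀ x, ‖h x - h' x‖ ≤ C) (i : ℕ) : ‖mahlerCoeff h i - mahlerCoeff h' i‖ ≤ C := by
  have e : mahlerCoeff h i - mahlerCoeff h' i = (fwdDiff 1)^[i] (shiftMap (h - h')) 0 := by
    have : (shiftMap (h - h') : ℤ_[p] → ℤ_[p]) =
        (shiftMap h : ℤ_[p] → ℤ_[p]) + (-1 : ℤ_[p]) • (shiftMap h' : ℤ_[p] → ℤ_[p]) := by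
      ext x
      simp [shiftMap, sub_eq_add_neg]
    rw [this, fwdDiff_iter_add, fwdDiff_iter_const_smul]
    simp [mahlerCoeff, shiftMap, sub_eq_add_neg]
  rw [e]
  refine (IsUltrametricDist.norm_fwdDiff_iter_apply_le _ _ _ _).trans ?_
  exact (ContinuousMap.norm_le _ hC).2 fun x => hh (x + 1)

/-- The pairing of `h ⊗ h` with the double sequence `a`. -/
noncomputable def pairing (a : ℕ × ℕ → ℂ_[p]) (h : C(ℤ_[p], ℤ_[p])) : ℂ_[p] :=
  ∑' n : ℕ × ℕ, intToComplex p (mahlerCoeff h n.1 * mahlerCoeff h n.2) * a n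

theorem tendsto_mul_cofinite {d : ℕ → ℤ_[p]} (hd : Tendsto d atTop (𝓝 0)) :
    Tendsto (fun n : ℕ × ℕ => d n.1 * d n.2) cofinite (𝓝 0) := by
  rw [NormedAddGroup.tendsto_nhds_zero]
  intro ε hε
  rw [← Nat.cofinite_eq_atTop] at hd
  have h := (NormedAddGroup.tendsto_nhds_zero.1 hd) ε hε
  rw [eventually_cofinite] at h ⊢
  refine (h.prod h).subset fun n hn => ?_
  have hn : ¬ ‖d n.1 * d n.2‖ < ε := hn
  rw [norm_mul] at hn
  constructor
  · intro h1
    exact hn (lt_of_le_of_lt (mul_le_of_le_one_right (norm_nonneg _) (PadicInt.norm_le_one _)) h1)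
  · intro h1
    exact hn (lt_of_le_of_lt (mul_le_of_le_one_left (norm_nonneg _) (PadicInt.norm_le_one _)) h1)

theorem summable_mul_bounded {d : ℕ → ℤ_[p]} (hd : Tendsto d atTop (𝓝 0)) {a : ℕ × ℕ → ℂ_[p]}
    (ha : ∀ n, ‖a n‖ ≤ 1) : Summable fun n : ℕ × ℕ => intToComplex p (d n.1 * d n.2) * a n := by
  refine NonarchimedeanAddGroup.summable_of_tendsto_cofinite_zero ?_
  refine squeeze_zero_norm (fun n => ?_) (tendsto_norm_zero.comp (tendsto_mul_cofinite hd))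
  rw [norm_mul, norm_intToComplex]
  exact mul_le_of_le_one_right (norm_nonneg _) (ha n)

theorem hasSum_pairing {a : ℕ × ℕ → ℂ_[p]} (ha : ∀ n, ‖a n‖ ≤ 1) (h : C(ℤ_[p], ℤ_[p])) :
    HasSum (fun n : ℕ × ℕ => intToComplex p (mahlerCoeff h n.1 * mahlerCoeff h n.2) * a n)
      (pairing a h) :=
  (summable_mul_bounded (tendsto_mahlerCoeff h) ha).hasSum

/-- The pairing is quadratic in `h`, but all Mahler coefficients have norm at most `1`. Changing one
factor at a time therefore gives a Lipschitz bound with constant `1` in the sup norm. -/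
theorem norm_pairing_sub_le {a : ℕ × ℕ → ℂ_[p]} (ha : ∀ n, ‖a n‖ ≤ 1) {h h' : C(ℤ_[p], ℤ_[p])}
    {C : ℝ} (hC : 0 ≤ C) (hh : ∀ x, ‖h x - h' x‖ ≤ C) : ‖pairing a h - pairing a h'‖ ≤ C := by
  rw [← ((hasSum_pairing ha h).sub (hasSum_pairing ha h')).tsum_eq]
  refine IsUltrametricDist.norm_tsum_le_of_forall_le_of_nonneg hC fun n => ?_
  have e : mahlerCoeff h n.1 * mahlerCoeff h n.2 - mahlerCoeff h' n.1 * mahlerCoeff h' n.2 =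
      mahlerCoeff h n.1 * (mahlerCoeff h n.2 - mahlerCoeff h' n.2) +
      (mahlerCoeff h n.1 - mahlerCoeff h' n.1) * mahlerCoeff h' n.2 := by ring
  rw [← sub_mul, ← map_sub, norm_mul, norm_intToComplex, e]
  refine (mul_le_of_le_one_right (norm_nonneg _) (ha n)).trans ?_
  refine (IsUltrametricDist.norm_add_le_max _ _).trans (max_le ?_ ?_)
  · rw [norm_mul]
    exact (mul_le_of_le_one_left (norm_nonneg _) (PadicInt.norm_le_one _)).trans
      (norm_mahlerCoeff_sub_le hC hh _)
  · rw [norm_mul]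
    exact (mul_le_of_le_one_right (norm_nonneg _) (PadicInt.norm_le_one _)).trans
      (norm_mahlerCoeff_sub_le hC hh _)

/-! ### Power functions on the units -/

theorem norm_eq_one_iff_of_norm_sub_lt_one {x y : ℤ_[p]} (h : ‖x - y‖ < 1) : ‖x‖ = 1 ↔ ‖y‖ = 1 := by
  rw [← PadicInt.isUnit_iff, ← PadicInt.isUnit_iff]
  have key : ∀ {x y : ℤ_[p]}, ‖x - y‖ < 1 → IsUnit x → IsUnit y := by
    intro x y h hx
    rw [PadicInt.isUnit_iff] at *
    by_contra hy
    have hy' := lt_of_le_of_ne (PadicInt.norm_le_one y) hy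
    have := IsUltrametricDist.norm_add_le_max (x - y) y
    rw [sub_add_cancel, hx] at this
    exact absurd this (not_le.2 (max_lt h hy'))
  exact ⟨key h, key (by rwa [norm_sub_rev])⟩

open Classical in
-- Being a unit is unchanged under perturbations of norm less than `1`, so extension by `0` keeps
-- the Lipschitz bound; at distance at least `1` the bound is trivial.
theorem continuous_unit_ite {g : ℤ_[p] → ℤ_[p]}
    (hg : ∀ x y, ‖x‖ = 1 → ‖y‖ = 1 → ‖g x - g y‖ ≤ ‖x - y‖) :
    Continuous fun x => if ‖x‖ = 1 then g x else 0 := by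
  refine (LipschitzWith.of_dist_le' (K := 1) fun x y => ?_).continuous
  rw [one_mul, dist_eq_norm, dist_eq_norm]
  rcases lt_or_ge ‖x - y‖ 1 with h | h
  · have := norm_eq_one_iff_of_norm_sub_lt_one h
    by_cases hx : ‖x‖ = 1
    · rw [if_pos hx, if_pos (this.1 hx)]
      exact hg x y hx (this.1 hx)
    · rw [if_neg hx, if_neg (fun hy => hx (this.2 hy))]
      simp
  · exact (PadicInt.norm_le_one _).trans h

theorem norm_pow_sub_pow_le (x y : ℤ_[p]) (N : ℕ) : ‖x ^ N - y ^ N‖ ≤ ‖x - y‖ := by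
  obtain ⟨c, hc⟩ := sub_dvd_pow_sub_pow x y N
  rw [hc, norm_mul]
  exact mul_le_of_le_one_right (norm_nonneg _) (PadicInt.norm_le_one _)

open Classical in
/-- The function which is `x ^ N` on the units of `ℤ_p`, and `0` elsewhere. -/
noncomputable def unitPow (p : ℕ) [Fact p.Prime] (N : ℕ) : C(ℤ_[p], ℤ_[p]) :=
  ⟨fun x => if ‖x‖ = 1 then x ^ N else 0,
    continuous_unit_ite fun x y _ _ => norm_pow_sub_pow_le x y N⟩

theorem inv_sub_inv {x y : ℤ_[p]} (hx : ‖x‖ = 1) (hy : ‖y‖ = 1) :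
    x.inv - y.inv = x.inv * y.inv * (y - x) := by
  linear_combination y.inv * PadicInt.mul_inv hx - x.inv * PadicInt.mul_inv hy

open Classical in
/-- The function which is `x⁻¹` on the units of `ℤ_p`, and `0` elsewhere. -/
noncomputable def unitInv (p : ℕ) [Fact p.Prime] : C(ℤ_[p], ℤ_[p]) :=
  ⟨fun x => if ‖x‖ = 1 then x.inv else 0,
    continuous_unit_ite fun x y hx hy => by
      rw [inv_sub_inv hx hy, norm_mul, norm_sub_rev]
      exact mul_le_of_le_one_left (norm_nonneg _) (PadicInt.norm_le_one _)⟩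

theorem unitPow_of_norm_eq_one {x : ℤ_[p]} (hx : ‖x‖ = 1) (N : ℕ) : unitPow p N x = x ^ N :=
  if_pos hx

theorem unitPow_of_norm_ne_one {x : ℤ_[p]} (hx : ‖x‖ ≠ 1) (N : ℕ) : unitPow p N x = 0 :=
  if_neg hx

theorem unitInv_of_norm_eq_one {x : ℤ_[p]} (hx : ‖x‖ = 1) : unitInv p x = x.inv := if_pos hx

theorem unitInv_of_norm_ne_one {x : ℤ_[p]} (hx : ‖x‖ ≠ 1) : unitInv p x = 0 := if_neg hx

theorem norm_unitPow_sub_le {N N' k : ℕ} (hN : N' ≤ N) (h1 : numRootsOfUnity p ∣ N - N')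
    (h2 : p ^ (k + 1) ∣ N - N') (x : ℤ_[p]) :
    ‖unitPow p N x - unitPow p N' x‖ ≤ (p : ℝ) ^ (-(k : ℤ)) := by
  by_cases hx : ‖x‖ = 1
  · rw [unitPow_of_norm_eq_one hx, unitPow_of_norm_eq_one hx]
    have e : x ^ N - x ^ N' = x ^ N' * (x ^ (N - N') - 1) := by
      rw [mul_sub, ← pow_add, Nat.add_sub_cancel' hN, mul_one]
    rw [e, norm_mul, norm_pow, hx, one_pow, one_mul]
    exact norm_pow_sub_one_le hx h1 h2
  · rw [unitPow_of_norm_ne_one hx, unitPow_of_norm_ne_one hx, sub_self, norm_zero]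
    positivity

/-- On units, `x ^ N` and `x⁻¹` differ by a unit multiple of `x ^ (N + 1) - 1`. Hence the value at
`1` is the pairing with `x⁻¹`. -/
theorem norm_unitPow_sub_unitInv_le {N k : ℕ} (h1 : numRootsOfUnity p ∣ N + 1)
    (h2 : p ^ (k + 1) ∣ N + 1) (x : ℤ_[p]) :
    ‖unitPow p N x - unitInv p x‖ ≤ (p : ℝ) ^ (-(k : ℤ)) := by
  by_cases hx : ‖x‖ = 1
  · rw [unitPow_of_norm_eq_one hx, unitInv_of_norm_eq_one hx]
    have e : x * (x ^ N - x.inv) = x ^ (N + 1) - 1 := by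
      rw [mul_sub, PadicInt.mul_inv hx, pow_succ']
    have e2 : ‖x ^ N - x.inv‖ = ‖x ^ (N + 1) - 1‖ := by rw [← e, norm_mul, hx, one_mul]
    rw [e2]
    exact norm_pow_sub_one_le hx h1 h2
  · rw [unitPow_of_norm_ne_one hx, unitInv_of_norm_ne_one hx, sub_self, norm_zero]
    positivity

/-! ### The Mahler coefficients of `x⁻¹` on the units -/

/-- Orthogonality: multiplication by a primitive root permutes the roots and multiplies the sum by
`ζ₀ ^ k`, which is not `1` unless `p ∣ k`. -/
theorem sum_pow_nthRootsFinset (k : ℕ) :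
    ∑ ζ ∈ Polynomial.nthRootsFinset p (1 : ℂ_[p]), ζ ^ k = if p ∣ k then (p : ℂ_[p]) else 0 := by
  have : NeZero (p : ℂ_[p]) := ⟨by exact_mod_cast hp.out.ne_zero⟩
  have : NeZero p := ⟨hp.out.ne_zero⟩
  obtain ⟨ζ₀, hζ₀⟩ := HasEnoughRootsOfUnity.exists_primitiveRoot ℂ_[p] p
  split_ifs with h
  · obtain ⟨j, rfl⟩ := h
    have : ∀ ζ ∈ Polynomial.nthRootsFinset p (1 : ℂ_[p]), ζ ^ (p * j) = 1 := by
      intro ζ hζ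
      rw [pow_mul, (Polynomial.mem_nthRootsFinset hp.out.pos _).1 hζ, one_pow]
    rw [Finset.sum_congr rfl this]
    simp [hζ₀.card_nthRootsFinset]
  · have h1 : ζ₀ ^ k ≠ 1 := fun h1 => h (hζ₀.dvd_of_pow_eq_one k h1)
    have h2 : ∑ ζ ∈ Polynomial.nthRootsFinset p (1 : ℂ_[p]), ζ ^ k =
        ζ₀ ^ k * ∑ ζ ∈ Polynomial.nthRootsFinset p (1 : ℂ_[p]), ζ ^ k := by
      rw [Finset.mul_sum]
      have hne : ζ₀ ≠ 0 := hζ₀.ne_zero hp.out.ne_zero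
      refine Finset.sum_bij' (fun ζ _ => ζ₀⁻¹ * ζ) (fun ζ _ => ζ₀ * ζ) ?_ ?_ ?_ ?_ ?_
      · intro ζ hζ
        rw [Polynomial.mem_nthRootsFinset hp.out.pos] at hζ ⊢
        rw [mul_pow, hζ, inv_pow, hζ₀.pow_eq_one, inv_one, one_mul]
      · intro ζ hζ
        rw [Polynomial.mem_nthRootsFinset hp.out.pos] at hζ ⊢
        rw [mul_pow, hζ, hζ₀.pow_eq_one, one_mul]
      · intro ζ _
        rw [mul_inv_cancel_left₀ hne]
      · intro ζ _
        rw [inv_mul_cancel_left₀ hne]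
      · intro ζ _
        rw [← mul_pow, mul_inv_cancel_left₀ hne]
    have h3 : (1 - ζ₀ ^ k) * ∑ ζ ∈ Polynomial.nthRootsFinset p (1 : ℂ_[p]), ζ ^ k = 0 := by
      rw [sub_mul, one_mul, ← h2, sub_self]
    exact (mul_eq_zero.1 h3).resolve_left (sub_ne_zero.2 h1.symm)

theorem rootSum_eq (n : ℕ) : rootSum p n = p * ∑ k ∈ Finset.range (n + 1),
    (-1) ^ (n - k) * (n.choose k : ℂ_[p]) * if p ∣ k then 1 else 0 := by
  unfold rootSum
  have : ∀ ζ : ℂ_[p], (ζ - 1) ^ n = ∑ k ∈ Finset.range (n + 1),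
      (-1) ^ (n - k) * (n.choose k : ℂ_[p]) * ζ ^ k := by
    intro ζ
    rw [sub_eq_add_neg, add_pow]
    refine Finset.sum_congr rfl fun k _ => ?_
    ring
  simp_rw [this]
  rw [Finset.sum_comm, Finset.mul_sum]
  refine Finset.sum_congr rfl fun k _ => ?_
  rw [← Finset.mul_sum, sum_pow_nthRootsFinset]
  split_ifs <;> ring

theorem norm_natCast_eq_one_iff (k : ℕ) : ‖(k : ℤ_[p])‖ = 1 ↔ ¬ p ∣ k := by
  rw [← padicInt_natCast_dvd_iff, ← PadicInt.norm_lt_one_iff_dvd, not_lt]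
  exact ⟨fun h => h.ge, fun h => le_antisymm (PadicInt.norm_le_one _) h⟩

theorem natCast_mul_unitInv (k : ℕ) :
    (k : ℤ_[p]) * unitInv p k = if p ∣ k then 0 else 1 := by
  split_ifs with h
  · rw [unitInv_of_norm_ne_one (fun h1 => (norm_natCast_eq_one_iff k).1 h1 h), mul_zero]
  · rw [unitInv_of_norm_eq_one ((norm_natCast_eq_one_iff k).2 h),
      PadicInt.mul_inv ((norm_natCast_eq_one_iff k).2 h)]

/-- The identity `(i + 1) * choose i k = (k + 1) * choose (i + 1) (k + 1)` provides the factor `k +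
1` that turns the inverse at `k + 1` into the indicator of `p ∤ k + 1`. -/
theorem succ_mul_mahlerCoeff_unitInv (i : ℕ) : ((i : ℤ_[p]) + 1) * mahlerCoeff (unitInv p) i =
    ∑ k ∈ Finset.range (i + 1), (-1) ^ (i - k) * ((i + 1).choose (k + 1) : ℤ_[p]) *
      if p ∣ k + 1 then 0 else 1 := by
  rw [mahlerCoeff, fwdDiff_iter_eq_sum_shift, Finset.mul_sum]
  refine Finset.sum_congr rfl fun k _ => ?_
  rw [← natCast_mul_unitInv]
  have h : ((i + 1 : ℕ) : ℤ_[p]) * i.choose k = (i + 1).choose (k + 1) * (k + 1 : ℕ) := by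
    exact_mod_cast congrArg (Nat.cast : ℕ → ℤ_[p]) (Nat.add_one_mul_choose_eq i k)
  simp only [zsmul_eq_mul, nsmul_eq_mul, mul_one, zero_add]
  push_cast at h ⊢
  linear_combination (-1) ^ (i - k) * unitInv p (k + 1) * h

/-- The full alternating sum of the `choose (i + 1) k` vanishes, so its part over `p ∤ k` is minus
its part over `p ∣ k`; by orthogonality the latter is `c_{i+1} / p`. -/
theorem intToComplex_mahlerCoeff_unitInv (i : ℕ) :
    intToComplex p (mahlerCoeff (unitInv p) i) = -(rootSum p (i + 1) / (p * (i + 1))) := by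
  have hp0 : (p : ℂ_[p]) ≠ 0 := by exact_mod_cast hp.out.ne_zero
  have hi0 : (i : ℂ_[p]) + 1 ≠ 0 := by exact_mod_cast i.succ_ne_zero
  have h := congrArg (intToComplex p) (succ_mul_mahlerCoeff_unitInv (p := p) i)
  simp only [map_mul, map_add, map_natCast, map_one, map_sum, map_pow, map_neg] at h
  have h0 : ∑ k ∈ Finset.range (i + 1 + 1), (-1) ^ (i + 1 - k) * ((i + 1).choose k : ℂ_[p]) = 0 := by
    have := add_pow (1 : ℂ_[p]) (-1) (i + 1)
    rw [add_neg_cancel, zero_pow i.succ_ne_zero] at this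
    rw [this]
    refine Finset.sum_congr rfl fun k _ => ?_
    ring
  have hr := rootSum_eq (p := p) (i + 1)
  have h1 : ∑ k ∈ Finset.range (i + 1 + 1), (-1) ^ (i + 1 - k) * ((i + 1).choose k : ℂ_[p]) *
      (if p ∣ k then 1 else 0) = -∑ k ∈ Finset.range (i + 1 + 1),
        (-1) ^ (i + 1 - k) * ((i + 1).choose k : ℂ_[p]) * (if p ∣ k then 0 else 1) := by
    rw [eq_neg_iff_add_eq_zero, ← Finset.sum_add_distrib]
    refine Eq.trans ?_ h0
    refine Finset.sum_congr rfl fun k _ => ?_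
    split_ifs <;> ring
  have h2 : ∑ k ∈ Finset.range (i + 1 + 1), (-1) ^ (i + 1 - k) * ((i + 1).choose k : ℂ_[p]) *
      (if p ∣ k then 0 else 1) = (i + 1) * intToComplex p (mahlerCoeff (unitInv p) i) := by
    rw [Finset.sum_range_succ', h]
    simp only [dvd_zero, if_true, mul_zero, add_zero, Nat.add_sub_add_right]
    refine Finset.sum_congr rfl fun k _ => ?_
    split_ifs <;> simp
  rw [hr, h1, h2]
  field_simp

/-! ### The ring `ℤ_p[μ_f]` -/

theorem intToComplex_mem_cyclotomicInts (f : ℕ) (x : ℤ_[p]) :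
    intToComplex p x ∈ cyclotomicInts p f :=
  Subring.subset_closure (Or.inl ⟨x, rfl⟩)

theorem norm_le_one_of_mem_cyclotomicInts {f : ℕ} (hf : f ≠ 0) {x : ℂ_[p]}
    (hx : x ∈ cyclotomicInts p f) : ‖x‖ ≤ 1 := by
  induction hx using Subring.closure_induction with
  | mem x hx =>
    rcases hx with ⟨y, rfl⟩ | hx
    · exact (norm_intToComplex y).trans_le (PadicInt.norm_le_one y)
    · have h := congrArg norm (show x ^ f = 1 from hx)
      rw [norm_pow, norm_one] at h
      exact ((pow_eq_one_iff_of_nonneg (norm_nonneg _) hf).1 h).le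
  | zero => simp
  | one => simp
  | add x y _ _ hx hy => exact (IsUltrametricDist.norm_add_le_max x y).trans (max_le hx hy)
  | neg x _ hx => rwa [norm_neg]
  | mul x y _ _ hx hy =>
    rw [norm_mul]
    exact mul_le_one₀ hx (norm_nonneg _) hy

/-- The roots of unity are closed under multiplication, so their `ℤ_p`-span is already a ring. This
exhibits `ℤ_p[μ_f]` as a continuous image of a finite power of `ℤ_p`, hence as a compact set. -/
theorem mem_cyclotomicInts_iff {f : ℕ} (hf : f ≠ 0) (x : ℂ_[p]) : x ∈ cyclotomicInts p f ↔
    ∃ c : Polynomial.nthRootsFinset f (1 : ℂ_[p]) → ℤ_[p], x = ∑ ζ, intToComplex p (c ζ) * ζ := by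
  have hf' : 0 < f := Nat.pos_of_ne_zero hf
  constructor
  · have single : ∀ (y : ℤ_[p]) (ζ : ℂ_[p]), ζ ^ f = 1 →
        ∃ c : Polynomial.nthRootsFinset f (1 : ℂ_[p]) → ℤ_[p],
          intToComplex p y * ζ = ∑ ζ, intToComplex p (c ζ) * ζ := by
      intro y ζ hζ
      classical
      refine ⟨Pi.single ⟨ζ, (Polynomial.mem_nthRootsFinset hf' _).2 hζ⟩ y, ?_⟩
      rw [Finset.sum_eq_single (⟨ζ, (Polynomial.mem_nthRootsFinset hf' _).2 hζ⟩ :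
        Polynomial.nthRootsFinset f (1 : ℂ_[p]))]
      · simp
      · intro b _ hb
        simp [Pi.single_eq_of_ne hb]
      · simp
    have sum : ∀ {ι : Type} (s : Finset ι) (g : ι → ℂ_[p]),
        (∀ i ∈ s, ∃ c : Polynomial.nthRootsFinset f (1 : ℂ_[p]) → ℤ_[p],
          g i = ∑ ζ, intToComplex p (c ζ) * ζ) →
        ∃ c : Polynomial.nthRootsFinset f (1 : ℂ_[p]) → ℤ_[p],
          ∑ i ∈ s, g i = ∑ ζ, intToComplex p (c ζ) * ζ := by
      intro ι s g h
      classical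
      induction s using Finset.induction_on with
      | empty => exact ⟨0, by simp⟩
      | insert a s ha ih =>
        obtain ⟨c, hc⟩ := ih fun i hi => h i (Finset.mem_insert_of_mem hi)
        obtain ⟨c', hc'⟩ := h a (Finset.mem_insert_self a s)
        refine ⟨c' + c, ?_⟩
        rw [Finset.sum_insert ha, hc, hc', ← Finset.sum_add_distrib]
        simp [add_mul]
    intro hx
    induction hx using Subring.closure_induction with
    | mem x hx =>
      rcases hx with ⟨y, rfl⟩ | hx
      · simpa [intToComplex_apply] using single y 1 (one_pow f)
      · simpa using single 1 x hx
    | zero => exact ⟨0, by simp⟩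
    | one => simpa using single 1 1 (one_pow f)
    | add x y _ _ hx hy =>
      obtain ⟨c, rfl⟩ := hx
      obtain ⟨c', rfl⟩ := hy
      exact ⟨c + c', by simp [add_mul, Finset.sum_add_distrib]⟩
    | neg x _ hx =>
      obtain ⟨c, rfl⟩ := hx
      exact ⟨-c, by simp⟩
    | mul x y _ _ hx hy =>
      obtain ⟨c, rfl⟩ := hx
      obtain ⟨c', rfl⟩ := hy
      rw [Finset.sum_mul_sum]
      refine sum _ _ fun i _ => sum _ _ fun j _ => ?_
      have hij : (i * j : ℂ_[p]) ^ f = 1 := by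
        rw [mul_pow, (Polynomial.mem_nthRootsFinset hf' _).1 i.2,
          (Polynomial.mem_nthRootsFinset hf' _).1 j.2, one_mul]
      obtain ⟨d, hd⟩ := single (c i * c' j) (i * j) hij
      exact ⟨d, by rw [← hd, map_mul]; ring⟩
  · rintro ⟨c, rfl⟩
    refine Subring.sum_mem _ fun ζ _ => Subring.mul_mem _ (intToComplex_mem_cyclotomicInts f _) ?_
    exact Subring.subset_closure (Or.inr ((Polynomial.mem_nthRootsFinset hf' _).1 ζ.2))

theorem isClosed_cyclotomicInts {f : ℕ} (hf : f ≠ 0) : IsClosed (cyclotomicInts p f : Set ℂ_[p]) := by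
  have h : (cyclotomicInts p f : Set ℂ_[p]) = Set.range
      fun c : Polynomial.nthRootsFinset f (1 : ℂ_[p]) → ℤ_[p] => ∑ ζ, intToComplex p (c ζ) * ζ := by
    ext x
    rw [SetLike.mem_coe, mem_cyclotomicInts_iff hf]
    simp [eq_comm]
  rw [h]
  refine (isCompact_range ?_).isClosed
  refine continuous_finsetSum _ fun ζ _ => Continuous.mul ?_ continuous_const
  exact isometry_intToComplex.continuous.comp (continuous_apply ζ)

/-- Since the powers of `α` over a full period sum to `0`, one has `(1 - α) * ∑ i α ^ i = -f`, and
`f` is a unit of `ℤ_p`. This makes the denominators of the cone series invertible integrally. -/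
theorem inv_one_sub_mem_cyclotomicInts {f : ℕ} (hf : f ≠ 0) (hpf : ¬ p ∣ f) {α : ℂ_[p]}
    (hα : α ^ f = 1) (hα1 : α ≠ 1) : (1 - α)⁻¹ ∈ cyclotomicInts p f := by
  have hα' : α ∈ cyclotomicInts p f := Subring.subset_closure (Or.inr hα)
  have h1 : (1 - α) * ∑ i ∈ Finset.range f, (i : ℂ_[p]) * α ^ i = -f := by
    have key : ∀ n : ℕ, (1 - α) * ∑ i ∈ Finset.range n, (i : ℂ_[p]) * α ^ i =
        ∑ i ∈ Finset.range n, α ^ (i + 1) - n * α ^ n := by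
      intro n
      induction n with
      | zero => simp
      | succ n ih =>
        rw [Finset.sum_range_succ, mul_add, ih, Finset.sum_range_succ]
        push_cast
        ring
    rw [key, hα]
    have hs : ∑ i ∈ Finset.range f, α ^ (i + 1) = 0 := by
      simp_rw [pow_succ, ← Finset.sum_mul]
      have h2 := geom_sum_mul α f
      rw [hα, sub_self] at h2
      rw [(mul_eq_zero.1 h2).resolve_right (sub_ne_zero.2 hα1), zero_mul]
    rw [hs]
    ring
  have hf0 : (f : ℂ_[p]) ≠ 0 := by exact_mod_cast hf
  have hu : ‖(f : ℤ_[p])‖ = 1 := (norm_natCast_eq_one_iff f).2 hpf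
  have hinv : intToComplex p (f : ℤ_[p]).inv = (f : ℂ_[p])⁻¹ := by
    refine eq_inv_of_mul_eq_one_right ?_
    rw [← map_natCast (intToComplex p), ← map_mul, PadicInt.mul_inv hu, map_one]
  have h2 : (1 - α)⁻¹ = intToComplex p (f : ℤ_[p]).inv *
      (-∑ i ∈ Finset.range f, (i : ℂ_[p]) * α ^ i) := by
    rw [hinv]
    refine inv_eq_of_mul_eq_one_right ?_
    rw [mul_left_comm, mul_neg, h1, neg_neg, inv_mul_cancel₀ hf0]
  rw [h2]
  refine Subring.mul_mem _ (intToComplex_mem_cyclotomicInts f _) (Subring.neg_mem _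
    (Subring.sum_mem _ fun i _ => Subring.mul_mem _ ?_ (Subring.pow_mem _ hα' i)))
  exact natCast_mem _ i

theorem pairing_mem_cyclotomicInts {f : ℕ} (hf : f ≠ 0) {a : ℕ × ℕ → ℂ_[p]}
    (ha : ∀ n, a n ∈ cyclotomicInts p f) (h : C(ℤ_[p], ℤ_[p])) :
    pairing a h ∈ cyclotomicInts p f := by
  have hs := hasSum_pairing (fun n => norm_le_one_of_mem_cyclotomicInts hf (ha n)) h
  refine (isClosed_cyclotomicInts hf).mem_of_tendsto hs (Eventually.of_forall fun s => ?_)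
  exact Subring.sum_mem _ fun n _ =>
    Subring.mul_mem _ (intToComplex_mem_cyclotomicInts f _) (ha n)

end

end ConeZeta

namespace ConeZeta

/-! ### Embeddings of the number field in `ℂ_p` -/

section

open Filter Topology IsDedekindDomain

variable {p : ℕ} [hp : Fact p.Prime]

theorem norm_le_one_of_isIntegral {x : ℂ_[p]} (hx : (Int.castRingHom ℂ_[p]).IsIntegralElem x) :
    ‖x‖ ≤ 1 := by
  obtain ⟨P, hP, h⟩ := hx
  by_contra! hlt
  rw [Polynomial.eval₂_eq_sum_range, Finset.sum_range_succ, hP.coeff_natDegree, map_one,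
    one_mul] at h
  rcases Nat.eq_zero_or_pos P.natDegree with h0 | h0
  · rw [h0] at h
    simp at h
  · have h1 : x ^ P.natDegree = -∑ i ∈ Finset.range P.natDegree, Int.castRingHom ℂ_[p] (P.coeff i) * x ^ i :=
      eq_neg_of_add_eq_zero_right h
    have h2 : ‖x ^ P.natDegree‖ ≤ ‖x‖ ^ (P.natDegree - 1) := by
      rw [h1, norm_neg]
      refine IsUltrametricDist.norm_sum_le_of_forall_le_of_nonneg (by positivity) fun i hi => ?_
      rw [eq_intCast, norm_mul, norm_pow]
      refine (mul_le_of_le_one_left (by positivity)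
        (IsUltrametricDist.norm_intCast_le_one _ _)).trans ?_
      have := Finset.mem_range.1 hi
      exact pow_le_pow_right₀ hlt.le (by omega)
    rw [norm_pow] at h2
    exact absurd h2 (not_le.2 (pow_lt_pow_right₀ hlt (by omega)))

variable {k : Type*} [Field k] [NumberField k]

omit [NumberField k] in
theorem norm_algebraMap_le_one (ψ : k →+* ℂ_[p]) (y : 𝓞 k) : ‖ψ (y : k)‖ ≤ 1 := by
  obtain ⟨P, hP, h⟩ := NumberField.RingOfIntegers.isIntegral_coe y
  refine norm_le_one_of_isIntegral ⟨P, hP, ?_⟩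
  have h1 := congrArg ψ h
  rw [Polynomial.hom_eval₂, map_zero] at h1
  rwa [RingHom.ext_int (Int.castRingHom ℂ_[p]) (ψ.comp (algebraMap ℤ k))]

theorem norm_natCast_prime_lt_one : ‖(p : ℂ_[p])‖ < 1 := by
  have := norm_intToComplex (p : ℤ_[p])
  rw [map_natCast] at this
  rw [this, PadicInt.norm_lt_one_iff_dvd]

/-- The prime ideal `𝔭` is the one cut out by the embedding `ψ` of `k` in `ℂ_p`. -/
def IsAbove (ψ : k →+* ℂ_[p]) (𝔭 : HeightOneSpectrum (𝓞 k)) : Prop :=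
  ∀ y : 𝓞 k, ‖ψ (y : k)‖ < 1 ↔ y ∈ 𝔭.asIdeal

theorem isAbove_of_le {ψ : k →+* ℂ_[p]} {𝔭 : HeightOneSpectrum (𝓞 k)}
    (h : ∀ y ∈ 𝔭.asIdeal, ‖ψ (y : k)‖ < 1) : IsAbove ψ 𝔭 := by
  refine fun y => ⟨fun hy => ?_, h y⟩
  by_contra hy𝔭
  obtain ⟨z, hz⟩ := 𝔭.isMaximal.exists_inv hy𝔭
  obtain ⟨i, hi, hzi⟩ := hz
  have h1 : ‖ψ ((z * y + i : 𝓞 k) : k)‖ < 1 := by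
    push_cast
    rw [map_add, map_mul]
    refine (IsUltrametricDist.norm_add_le_max _ _).trans_lt (max_lt ?_ (h i hi))
    rw [norm_mul]
    exact (mul_le_of_le_one_left (norm_nonneg _) (norm_algebraMap_le_one ψ z)).trans_lt hy
  rw [hzi] at h1
  simp at h1

/-- Otherwise each prime contains an element whose image has norm `1`. Their product lies in `(p)`,
so its image has norm less than `1`: a contradiction. -/
theorem isAbove_or_isAbove (ψ : k →+* ℂ_[p]) {𝔭₁ 𝔭₂ : HeightOneSpectrum (𝓞 k)}
    (hsplit : Ideal.span {(p : 𝓞 k)} = 𝔭₁.asIdeal * 𝔭₂.asIdeal) :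
    IsAbove ψ 𝔭₁ ∨ IsAbove ψ 𝔭₂ := by
  by_contra! h
  have h1 : ∃ a ∈ 𝔭₁.asIdeal, ¬ ‖ψ (a : k)‖ < 1 := by
    by_contra! h1
    exact h.1 (isAbove_of_le h1)
  have h2 : ∃ a ∈ 𝔭₂.asIdeal, ¬ ‖ψ (a : k)‖ < 1 := by
    by_contra! h2
    exact h.2 (isAbove_of_le h2)
  obtain ⟨a, ha, ha1⟩ := h1
  obtain ⟨b, hb, hb1⟩ := h2
  have hab : a * b ∈ Ideal.span {(p : 𝓞 k)} := hsplit ▸ Ideal.mul_mem_mul ha hb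
  obtain ⟨c, hc⟩ := Ideal.mem_span_singleton.1 hab
  have h3 : ‖ψ ((a * b : 𝓞 k) : k)‖ < 1 := by
    rw [hc]
    push_cast
    rw [map_mul, norm_mul, map_natCast]
    exact (mul_le_of_le_one_right (norm_nonneg _) (norm_algebraMap_le_one ψ c)).trans_lt
      norm_natCast_prime_lt_one
  push_cast at h3
  rw [map_mul, norm_mul, le_antisymm (norm_algebraMap_le_one ψ a) (not_lt.1 ha1),
    le_antisymm (norm_algebraMap_le_one ψ b) (not_lt.1 hb1), one_mul] at h3
  exact lt_irrefl _ h3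

theorem card_quotient_eq (hk : Module.finrank ℚ k = 2) {𝔭₁ 𝔭₂ : HeightOneSpectrum (𝓞 k)}
    (hsplit : Ideal.span {(p : 𝓞 k)} = 𝔭₁.asIdeal * 𝔭₂.asIdeal) :
    Nat.card (𝓞 k ⧸ 𝔭₁.asIdeal) = p := by
  have h1 : Ideal.absNorm 𝔭₁.asIdeal * Ideal.absNorm 𝔭₂.asIdeal = p ^ 2 := by
    rw [← map_mul, ← hsplit, Ideal.absNorm_span_natCast, NumberField.RingOfIntegers.rank, hk]
  have hn : ∀ 𝔭 : HeightOneSpectrum (𝓞 k), Ideal.absNorm 𝔭.asIdeal ≠ 1 := fun 𝔭 h =>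
    𝔭.isPrime.ne_top (Ideal.absNorm_eq_one_iff.1 h)
  obtain ⟨i, hi, h⟩ := (Nat.dvd_prime_pow hp.out).1 (Dvd.intro _ h1)
  have : Nat.card (𝓞 k ⧸ 𝔭₁.asIdeal) = Ideal.absNorm 𝔭₁.asIdeal := rfl
  rw [this]
  interval_cases i
  · exact absurd (by simpa using h) (hn 𝔭₁)
  · simpa using h
  · rw [h] at h1
    have := Nat.eq_of_mul_eq_mul_left (pow_pos hp.out.pos 2) (h1.trans (mul_one _).symm)
    exact absurd this (hn 𝔭₂)

omit [NumberField k] in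
theorem exists_int_sub_mem {𝔭 : HeightOneSpectrum (𝓞 k)} (hcard : Nat.card (𝓞 k ⧸ 𝔭.asIdeal) = p)
    (b c : 𝓞 k) (hc : c ∉ 𝔭.asIdeal) : ∃ n : ℤ, b - n * c ∈ 𝔭.asIdeal := by
  have hc' : (Ideal.Quotient.mk 𝔭.asIdeal c) ≠ 0 := by
    rwa [ne_eq, Ideal.Quotient.eq_zero_iff_mem]
  obtain ⟨n, hn⟩ := AddSubgroup.mem_zmultiples_iff.1
    (mem_zmultiples_of_prime_card hcard hc' (g' := Ideal.Quotient.mk 𝔭.asIdeal b))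
  refine ⟨n, ?_⟩
  rw [← Ideal.Quotient.eq_zero_iff_mem, map_sub, ← hn, zsmul_eq_mul, map_mul, map_intCast, sub_self]

/-- The localisation of the ring of integers at `𝔭`, as a subset of `k`. -/
def localRing (𝔭 : HeightOneSpectrum (𝓞 k)) : Set k :=
  {x | ∃ b c : 𝓞 k, c ∉ 𝔭.asIdeal ∧ x * c = b}

omit [NumberField k] in
theorem norm_le_one_of_mem_localRing {ψ : k →+* ℂ_[p]} {𝔭 : HeightOneSpectrum (𝓞 k)}
    (hψ : IsAbove ψ 𝔭) {x : k} (hx : x ∈ localRing 𝔭) : ‖ψ x‖ ≤ 1 := by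
  obtain ⟨b, c, hc, h⟩ := hx
  have h1 : ‖ψ (c : k)‖ = 1 :=
    le_antisymm (norm_algebraMap_le_one ψ c) (not_lt.1 fun h => hc ((hψ c).1 h))
  have h2 := norm_algebraMap_le_one ψ b
  rwa [← h, map_mul, norm_mul, h1, mul_one] at h2

/-- The residue field is `𝔽_p`, so `x` is congruent to an integer modulo `𝔭`. To divide by `p`
itself, multiply numerator and denominator by an element of `𝔭'` outside `𝔭`: the numerator moves
into `𝔭 𝔭' = (p)` and the denominator stays outside `𝔭`. -/
theorem exists_int_add_mul {𝔭 𝔭' : HeightOneSpectrum (𝓞 k)} (hne : 𝔭 ≠ 𝔭')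
    (hsplit : Ideal.span {(p : 𝓞 k)} = 𝔭.asIdeal * 𝔭'.asIdeal)
    (hcard : Nat.card (𝓞 k ⧸ 𝔭.asIdeal) = p) {x : k} (hx : x ∈ localRing 𝔭) :
    ∃ n : ℤ, ∃ x' ∈ localRing 𝔭, x = n + p * x' := by
  obtain ⟨b, c, hc, h⟩ := hx
  obtain ⟨n, hn⟩ := exists_int_sub_mem hcard b c hc
  obtain ⟨e, he', he⟩ : ∃ e ∈ 𝔭'.asIdeal, e ∉ 𝔭.asIdeal := by
    by_contra! hle
    exact hne (HeightOneSpectrum.ext (𝔭'.isMaximal.eq_of_le 𝔭.isPrime.ne_top hle)).symm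
  have hmem : (b - n * c) * e ∈ Ideal.span {(p : 𝓞 k)} := hsplit ▸ Ideal.mul_mem_mul hn he'
  obtain ⟨g, hg⟩ := Ideal.mem_span_singleton.1 hmem
  have hc0 : (c : k) ≠ 0 := by
    intro h0
    have : c = 0 := by exact_mod_cast h0
    exact hc (this ▸ 𝔭.asIdeal.zero_mem)
  have he0 : (e : k) ≠ 0 := by
    intro h0
    have : e = 0 := by exact_mod_cast h0
    exact he (this ▸ 𝔭.asIdeal.zero_mem)
  have hg' : ((b : k) - n * c) * e = p * g := by
    have := congrArg (fun z : 𝓞 k => (z : k)) hg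
    push_cast at this
    exact this
  refine ⟨n, g / (c * e), ⟨g, c * e, fun h => ?_, ?_⟩, ?_⟩
  · exact (𝔭.isPrime.mem_or_mem h).elim hc he
  · push_cast
    field_simp
  · field_simp
    rw [← hg', ← h]
    ring

theorem exists_int_add_pow_mul {𝔭 𝔭' : HeightOneSpectrum (𝓞 k)} (hne : 𝔭 ≠ 𝔭')
    (hsplit : Ideal.span {(p : 𝓞 k)} = 𝔭.asIdeal * 𝔭'.asIdeal)
    (hcard : Nat.card (𝓞 k ⧸ 𝔭.asIdeal) = p) {x : k} (hx : x ∈ localRing 𝔭) (M : ℕ) :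
    ∃ n : ℤ, ∃ x' ∈ localRing 𝔭, x = n + p ^ M * x' := by
  induction M with
  | zero => exact ⟨0, x, hx, by simp⟩
  | succ M ih =>
    obtain ⟨n, x', hx', h⟩ := ih
    obtain ⟨m, x'', hx'', h'⟩ := exists_int_add_mul hne hsplit hcard hx'
    refine ⟨n + p ^ M * m, x'', hx'', ?_⟩
    rw [h, h']
    push_cast
    ring

theorem norm_natCast_pow (M : ℕ) : ‖(p : ℂ_[p]) ^ M‖ = ((p : ℝ)⁻¹) ^ M := by
  have := norm_intToComplex (p : ℤ_[p])
  rw [map_natCast, PadicInt.norm_p] at this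
  rw [norm_pow, this]

theorem tendsto_inv_pow : Tendsto (fun M : ℕ => ((p : ℝ)⁻¹) ^ M) atTop (𝓝 0) :=
  tendsto_pow_atTop_nhds_zero_of_lt_one (by positivity)
    (inv_lt_one_of_one_lt₀ (by exact_mod_cast hp.out.one_lt))

/-- The integers approximating `x` modulo powers of `p` converge to `ψ x`, and the image of `ℤ_p` is
compact, hence closed. -/
theorem exists_intToComplex_eq {ψ : k →+* ℂ_[p]} {𝔭 𝔭' : HeightOneSpectrum (𝓞 k)}
    (hψ : IsAbove ψ 𝔭) (hne : 𝔭 ≠ 𝔭')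
    (hsplit : Ideal.span {(p : 𝓞 k)} = 𝔭.asIdeal * 𝔭'.asIdeal)
    (hcard : Nat.card (𝓞 k ⧸ 𝔭.asIdeal) = p) {x : k} (hx : x ∈ localRing 𝔭) :
    ∃ z : ℤ_[p], intToComplex p z = ψ x := by
  choose n x' hx' h using exists_int_add_pow_mul hne hsplit hcard hx
  have hcl : IsClosed (Set.range (intToComplex p)) :=
    (isCompact_range isometry_intToComplex.continuous).isClosed
  have ht : Tendsto (fun M => intToComplex p (n M)) atTop (𝓝 (ψ x)) := by
    rw [tendsto_iff_norm_sub_tendsto_zero]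
    refine squeeze_zero (fun _ => norm_nonneg _) (fun M => ?_) (tendsto_inv_pow (p := p))
    have e : intToComplex p (n M) - ψ x = -((p : ℂ_[p]) ^ M * ψ (x' M)) := by
      conv_lhs => rw [h M]
      simp
    rw [e, norm_neg, norm_mul, norm_natCast_pow]
    exact mul_le_of_le_one_right (by positivity) (norm_le_one_of_mem_localRing hψ (hx' M))
  exact hcl.mem_of_tendsto ht (Eventually.of_forall fun M => ⟨_, rfl⟩)

/-- The approximating integers depend on the prime and not on the embedding, so two embeddings above
the same prime have the same limits. -/
theorem eq_of_isAbove {ψ ψ' : k →+* ℂ_[p]} {𝔭 𝔭' : HeightOneSpectrum (𝓞 k)}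
    (hψ : IsAbove ψ 𝔭) (hψ' : IsAbove ψ' 𝔭) (hne : 𝔭 ≠ 𝔭')
    (hsplit : Ideal.span {(p : 𝓞 k)} = 𝔭.asIdeal * 𝔭'.asIdeal)
    (hcard : Nat.card (𝓞 k ⧸ 𝔭.asIdeal) = p) : ψ = ψ' := by
  have key : ∀ y : 𝓞 k, ψ (y : k) = ψ' (y : k) := by
    intro y
    have hy : (y : k) ∈ localRing 𝔭 :=
      ⟨y, 1, fun h => 𝔭.isPrime.ne_top ((Ideal.eq_top_iff_one _).2 h), by simp⟩
    rw [← sub_eq_zero, ← norm_eq_zero]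
    refine le_antisymm (ge_of_tendsto' (tendsto_inv_pow (p := p)) fun M => ?_) (norm_nonneg _)
    obtain ⟨n, x', hx', h⟩ := exists_int_add_pow_mul hne hsplit hcard hy M
    have e : ψ (y : k) - ψ' (y : k) = (p : ℂ_[p]) ^ M * (ψ x' - ψ' x') := by
      rw [h]
      simp
      ring
    rw [e, norm_mul, norm_natCast_pow]
    refine mul_le_of_le_one_right (by positivity) ?_
    rw [sub_eq_add_neg]
    exact (IsUltrametricDist.norm_add_le_max _ _).trans
      (max_le (norm_le_one_of_mem_localRing hψ hx') (by rw [norm_neg]; exact norm_le_one_of_mem_localRing hψ' hx'))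
  exact IsFractionRing.ringHom_ext (A := 𝓞 k) key

/-- Write `x` as a fraction with numerator or denominator outside `𝔭`. In the only bad case `x * n =
d` with `n ∈ 𝔭` and `d ∉ 𝔭`, so `x` has negative order at `𝔭`, although every element of `I` has
order at least that of `I`, which is `0`. -/
theorem mem_localRing_of_mem {𝔭 : HeightOneSpectrum (𝓞 k)} {I : FractionalIdeal (𝓞 k)⁰ k}
    (hc : FractionalIdeal.count k 𝔭 I = 0) {x : k} (hx : x ∈ I) : x ∈ localRing 𝔭 := by
  obtain ⟨n, d, h | h⟩ := 𝔭.exists_primeCompl_mul_eq_or_mul_eq (K := k) x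
  · exact ⟨n, d, d.2, h⟩
  · by_cases hn : n ∈ 𝔭.asIdeal
    swap
    · exact ⟨d, n, hn, h⟩
    exfalso
    have hd0 : (d : 𝓞 k) ≠ 0 := fun h0 => d.2 (h0 ▸ 𝔭.asIdeal.zero_mem)
    have hdk : algebraMap (𝓞 k) k d ≠ 0 := by
      rwa [ne_eq, FaithfulSMul.algebraMap_eq_zero_iff]
    have hx0 : x ≠ 0 := by
      rintro rfl
      rw [zero_mul] at h
      exact hdk h.symm
    have hn0 : n ≠ 0 := by
      rintro rfl
      rw [map_zero, mul_zero] at h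
      exact hdk h.symm
    have cnt : ∀ r : 𝓞 k, r ≠ 0 → 𝔭.intValuation r =
        WithZero.exp (-(FractionalIdeal.count k 𝔭 (Ideal.span {r} : Ideal (𝓞 k)))) := by
      intro r hr
      rw [FractionalIdeal.count_coe k 𝔭 (by simpa using hr), 𝔭.intValuation_if_neg hr]
    have hcd : FractionalIdeal.count k 𝔭 (Ideal.span {(d : 𝓞 k)} : Ideal (𝓞 k)) = 0 := by
      have h1 := (𝔭.intValuation_eq_one_iff_mem_primeCompl d).2 d.2
      rw [cnt _ hd0, ← WithZero.exp_zero, WithZero.exp_inj] at h1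
      simpa using h1
    have hcn : 0 < FractionalIdeal.count k 𝔭 (Ideal.span {n} : Ideal (𝓞 k)) := by
      have h1 := (𝔭.intValuation_lt_one_iff_mem n).2 hn
      rw [cnt _ hn0, ← WithZero.exp_zero, WithZero.exp_lt_exp] at h1
      linarith
    have hsx : FractionalIdeal.spanSingleton (𝓞 k)⁰ x ≠ 0 := by
      rwa [ne_eq, FractionalIdeal.spanSingleton_eq_zero_iff]
    have hle : FractionalIdeal.spanSingleton (𝓞 k)⁰ x ≤ I := by
      rwa [FractionalIdeal.spanSingleton_le_iff_mem]
    have hm := FractionalIdeal.count_mono k 𝔭 hsx hle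
    have hmul : FractionalIdeal.spanSingleton (𝓞 k)⁰ x * ((Ideal.span {n} : Ideal (𝓞 k)) :
        FractionalIdeal (𝓞 k)⁰ k) = ((Ideal.span {(d : 𝓞 k)} : Ideal (𝓞 k)) :
        FractionalIdeal (𝓞 k)⁰ k) := by
      rw [FractionalIdeal.coeIdeal_span_singleton, FractionalIdeal.coeIdeal_span_singleton,
        FractionalIdeal.spanSingleton_mul_spanSingleton, h]
    have hcm := FractionalIdeal.count_mul k 𝔭 hsx (I' := ((Ideal.span {n} : Ideal (𝓞 k)) :
        FractionalIdeal (𝓞 k)⁰ k))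
      (FractionalIdeal.coeIdeal_ne_zero.2 (by simpa using hn0))
    rw [hmul, hcd] at hcm
    rw [hc] at hm
    linarith

/-- If all of `I` had norm less than `1`, then so would `I * I⁻¹`, since `I⁻¹` also has order `0` at
`𝔭` and hence norms at most `1`; but `1` lies in that product. -/
theorem exists_mem_norm_eq_one {ψ : k →+* ℂ_[p]} {𝔭 : HeightOneSpectrum (𝓞 k)}
    (hψ : IsAbove ψ 𝔭) {I : FractionalIdeal (𝓞 k)⁰ k} (hI : I ≠ 0)
    (hc : FractionalIdeal.count k 𝔭 I = 0) : ∃ b ∈ I, ‖ψ b‖ = 1 := by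
  by_contra! h
  have hlt : ∀ b ∈ I, ‖ψ b‖ < 1 := fun b hb =>
    lt_of_le_of_ne (norm_le_one_of_mem_localRing hψ (mem_localRing_of_mem hc hb)) (h b hb)
  have hinv : ∀ c ∈ I⁻¹, ‖ψ c‖ ≤ 1 := fun c hc' =>
    norm_le_one_of_mem_localRing hψ (mem_localRing_of_mem
      (by rw [FractionalIdeal.count_inv, hc, neg_zero]) hc')
  have hall : ∀ x ∈ I * I⁻¹, ‖ψ x‖ < 1 := by
    intro x hx
    refine FractionalIdeal.mul_induction_on hx (fun b hb c hc' => ?_) (fun x y hx hy => ?_)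
    · rw [map_mul, norm_mul]
      exact (mul_le_of_le_one_right (norm_nonneg _) (hinv c hc')).trans_lt (hlt b hb)
    · rw [map_add]
      exact (IsUltrametricDist.norm_add_le_max _ _).trans_lt (max_lt hx hy)
  rw [mul_inv_cancel₀ hI] at hall
  have := hall 1 (FractionalIdeal.one_mem_one _)
  simp at this

end

end ConeZeta

namespace ConeZeta

/-! ### Products of two binomial series -/

section

open MvPowerSeries Finset

/-- The exponent `(i, l)`. -/
noncomputable def expo (n : ℕ × ℕ) : Fin 2 →₀ ℕ := Finsupp.single 0 n.1 + Finsupp.single 1 n.2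

@[simp] theorem expo_zero (n : ℕ × ℕ) : expo n 0 = n.1 := by simp [expo]

@[simp] theorem expo_one (n : ℕ × ℕ) : expo n 1 = n.2 := by simp [expo]

theorem expo_surjective (e : Fin 2 →₀ ℕ) : expo (e 0, e 1) = e := by
  ext i
  fin_cases i <;> simp

theorem degree_expo (n : ℕ × ℕ) : (expo n).degree = n.1 + n.2 := by
  rw [Finsupp.degree_eq_sum, Fin.sum_univ_two, expo_zero, expo_one]

/-- The product of two binomial series over a binomial ring. -/
noncomputable def binomSeries {A : Type*} [CommRing A] [BinomialRing A] (u : Fin 2 → A) :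
    MvPowerSeries (Fin 2) A :=
  fun n => Ring.choose (u 0) (n 0) * Ring.choose (u 1) (n 1)

theorem binomialProd_eq {K : Type*} [Field K] [CharZero K] (u : Fin 2 → K) :
    binomialProd u = binomSeries u := rfl

variable {A B : Type*} [CommRing A] [BinomialRing A] [CommRing B] [BinomialRing B]

theorem coeff_binomSeries (u : Fin 2 → A) (e : Fin 2 →₀ ℕ) :
    coeff e (binomSeries u) = Ring.choose (u 0) (e 0) * Ring.choose (u 1) (e 1) := rfl

theorem map_binomSeries (φ : A →+* B) (u : Fin 2 → A) :
    MvPowerSeries.map φ (binomSeries u) = binomSeries fun i => φ (u i) := by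
  ext e
  rw [coeff_map, coeff_binomSeries, coeff_binomSeries, map_mul, Ring.map_choose, Ring.map_choose]

theorem constantCoeff_binomSeries (u : Fin 2 → A) : constantCoeff (binomSeries u) = 1 := by
  rw [← coeff_zero_eq_constantCoeff_apply, coeff_binomSeries]
  simp

theorem binomSeries_zero : binomSeries (0 : Fin 2 → A) = 1 := by
  ext e
  rw [coeff_binomSeries, coeff_one, Pi.zero_apply, Pi.zero_apply, Ring.choose_zero_ite,
    Ring.choose_zero_ite]
  have : e = 0 ↔ e 0 = 0 ∧ e 1 = 0 := by
    rw [Finsupp.ext_iff, Fin.forall_fin_two]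
    simp
  simp only [this]
  split_ifs <;> simp_all

/-- The Vandermonde identity in each of the two variables. -/
theorem binomSeries_add (u v : Fin 2 → A) :
    binomSeries (u + v) = binomSeries u * binomSeries v := by
  ext e
  rw [coeff_binomSeries, Pi.add_apply, Pi.add_apply, Ring.add_choose_eq _ (Commute.all _ _),
    Ring.add_choose_eq _ (Commute.all _ _), sum_mul_sum, ← sum_product', coeff_mul]
  refine sum_nbij' (fun x => (expo (x.1.1, x.2.1), expo (x.1.2, x.2.2)))
    (fun y => ((y.1 0, y.2 0), (y.1 1, y.2 1))) ?_ ?_ ?_ ?_ ?_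
  · rintro ⟨⟨a, b⟩, ⟨c, d⟩⟩ h
    simp only [mem_product, HasAntidiagonal.mem_antidiagonal] at h ⊢
    rw [← expo_surjective e, ← h.1, ← h.2]
    ext i
    fin_cases i <;> simp
  · rintro ⟨y, z⟩ h
    simp only [mem_product, HasAntidiagonal.mem_antidiagonal] at h ⊢
    rw [← h]
    simp
  · rintro ⟨⟨a, b⟩, ⟨c, d⟩⟩ h
    simp
  · rintro ⟨y, z⟩ h
    simp [expo_surjective]
  · rintro ⟨⟨a, b⟩, ⟨c, d⟩⟩ h
    simp only [coeff_binomSeries, expo_zero, expo_one]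
    ring

theorem binomSeries_nsmul (n : ℕ) (u : Fin 2 → A) : binomSeries (n • u) = binomSeries u ^ n := by
  induction n with
  | zero => rw [zero_smul, binomSeries_zero, pow_zero]
  | succ n ih => rw [succ_nsmul, binomSeries_add, ih, pow_succ]

theorem choose_one_left (n : ℕ) : Ring.choose (1 : A) n = Nat.choose 1 n := by
  rw [← Ring.choose_natCast, Nat.cast_one]

theorem binomSeries_one : binomSeries (1 : Fin 2 → A) = (1 + X 0) * (1 + X 1) := by
  have h : ∀ (i : Fin 2), binomSeries (Pi.single i (1 : A)) = 1 + X i := by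
    intro i
    ext e
    rw [coeff_binomSeries, map_add, coeff_one, coeff_X]
    have h0 : e = 0 ↔ e 0 = 0 ∧ e 1 = 0 := by
      rw [Finsupp.ext_iff, Fin.forall_fin_two]
      simp
    fin_cases i
    · have h1 : e = Finsupp.single 0 1 ↔ e 0 = 1 ∧ e 1 = 0 := by
        rw [Finsupp.ext_iff, Fin.forall_fin_two]
        simp
      simp only [Fin.zero_eta, Pi.single_eq_same, ne_eq, one_ne_zero, not_false_eq_true,
        Pi.single_eq_of_ne, h0, h1, choose_one_left, Ring.choose_zero_ite]
      rcases Nat.lt_trichotomy (e 0) 1 with h | h | h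
      · have : e 0 = 0 := by omega
        simp [this]
      · simp [h]
      · simp [Nat.choose_eq_zero_of_lt h, show e 0 ≠ 0 by omega, show e 0 ≠ 1 by omega]
    · have h1 : e = Finsupp.single 1 1 ↔ e 0 = 0 ∧ e 1 = 1 := by
        rw [Finsupp.ext_iff, Fin.forall_fin_two]
        simp
      simp only [Fin.mk_one, Pi.single_eq_same, ne_eq, zero_ne_one, not_false_eq_true,
        Pi.single_eq_of_ne, h0, h1, choose_one_left, Ring.choose_zero_ite]
      rcases Nat.lt_trichotomy (e 1) 1 with h | h | h
      · have : e 1 = 0 := by omega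
        simp [this]
      · simp [h]
      · simp [Nat.choose_eq_zero_of_lt h, show e 1 ≠ 0 by omega, show e 1 ≠ 1 by omega]
  rw [← h 0, ← h 1, ← binomSeries_add]
  congr 1
  ext i
  fin_cases i <;> simp

theorem inv_one_add_X_mul {K : Type*} [Field K] [CharZero K] :
    ((1 + X 0) * (1 + X 1) : MvPowerSeries (Fin 2) K)⁻¹ = binomSeries (-1) := by
  rw [MvPowerSeries.inv_eq_iff_mul_eq_one, ← binomSeries_one, ← binomSeries_add, neg_add_cancel,
    binomSeries_zero]
  rw [← binomSeries_one, constantCoeff_binomSeries]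
  exact one_ne_zero

end

/-! ### Evaluation of power series with integral coefficients -/

section

open MvPowerSeries Filter Topology

variable {p : ℕ} [hp : Fact p.Prime] {R : Subring ℂ_[p]}

/-- The functional `∑ d i * d l * a_{i,l}` on the power series `∑ a_{i,l} X₁ ^ i X₂ ^ l` with
coefficients in a subring of the unit ball of `ℂ_p`. -/
noncomputable def evalFunctional (hR : ∀ x ∈ R, ‖x‖ ≤ 1) {d : ℕ → ℤ_[p]} (hd : Tendsto d atTop (𝓝 0)) :
    MvPowerSeries (Fin 2) R →ₗ[R] ℂ_[p] where
  toFun F := ∑' n : ℕ × ℕ, intToComplex p (d n.1 * d n.2) * ((coeff (expo n) F : R) : ℂ_[p])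
  map_add' F G := by
    rw [← Summable.tsum_add (summable_mul_bounded hd fun n => hR _ (coeff (expo n) F).2)
      (summable_mul_bounded hd fun n => hR _ (coeff (expo n) G).2)]
    refine tsum_congr fun n => ?_
    simp [mul_add]
  map_smul' c F := by
    rw [RingHom.id_apply, Subring.smul_def, smul_eq_mul, ← tsum_mul_left]
    refine tsum_congr fun n => ?_
    simp only [coeff_smul, Subring.coe_mul]
    ring

variable (hR : ∀ x ∈ R, ‖x‖ ≤ 1) {d : ℕ → ℤ_[p]} (hd : Tendsto d atTop (𝓝 0))

theorem evalFunctional_apply (F : MvPowerSeries (Fin 2) R) : evalFunctional hR hd F =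
    ∑' n : ℕ × ℕ, intToComplex p (d n.1 * d n.2) * ((coeff (expo n) F : R) : ℂ_[p]) := rfl

/-- Continuity for the order filtration: only finitely many products `d i * d l` are not small, and
a series of high order has zero coefficients there. -/
theorem exists_norm_evalFunctional_le {ε : ℝ} (hε : 0 < ε) : ∃ M : ℕ, ∀ F : MvPowerSeries (Fin 2) R,
    (M : ℕ∞) ≤ F.order → ‖evalFunctional hR hd F‖ ≤ ε := by
  have h := (NormedAddGroup.tendsto_nhds_zero.1 (tendsto_mul_cofinite hd)) ε hε
  rw [eventually_cofinite] at h
  obtain ⟨M, hM⟩ := (h.image fun n => n.1 + n.2).bddAbove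
  refine ⟨M + 1, fun F hF => ?_⟩
  rw [evalFunctional_apply]
  refine IsUltrametricDist.norm_tsum_le_of_forall_le_of_nonneg hε.le fun n => ?_
  rw [norm_mul, norm_intToComplex]
  by_cases hn : ‖d n.1 * d n.2‖ < ε
  · exact (mul_le_of_le_one_right (norm_nonneg _) (hR _ (coeff (expo n) F).2)).trans hn.le
  · have h1 : n.1 + n.2 ≤ M := hM ⟨n, hn, rfl⟩
    have h2 : coeff (expo n) F = 0 := by
      refine coeff_of_lt_order (lt_of_lt_of_le ?_ hF)
      rw [degree_expo]
      exact_mod_cast Nat.lt_succ_of_le h1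
    rw [h2]
    simpa using hε.le

theorem fwdDiff_iter_evalFunctional (E V : MvPowerSeries (Fin 2) R) (i n : ℕ) :
    (fwdDiff 1)^[i] (fun n => evalFunctional hR hd (E * V ^ n)) n =
      evalFunctional hR hd (E * (V - 1) ^ i * V ^ n) := by
  induction i generalizing n with
  | zero => simp
  | succ i ih =>
    rw [Function.iterate_succ_apply', fwdDiff, ih, ih, ← map_sub]
    congr 1
    ring

/-- Differencing the sequence `T ^ n` multiplies it by `T - 1`, in either variable. -/
theorem diffCoeff_evalFunctional (E T₁ T₂ : MvPowerSeries (Fin 2) R) (i l : ℕ) :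
    diffCoeff (fun n m => evalFunctional hR hd (E * T₁ ^ n * T₂ ^ m)) i l =
      evalFunctional hR hd (E * (T₁ - 1) ^ i * (T₂ - 1) ^ l) := by
  rw [diffCoeff]
  have h : (fun n => (fwdDiff 1)^[l] (fun m => evalFunctional hR hd (E * T₁ ^ n * T₂ ^ m)) 0) =
      fun n => evalFunctional hR hd (E * (T₂ - 1) ^ l * T₁ ^ n) := by
    ext n
    rw [fwdDiff_iter_evalFunctional]
    congr 1
    ring
  rw [h, fwdDiff_iter_evalFunctional]
  congr 1
  ring

/-- Since `1 - a t = (1 - a) - a (t - 1)`, the inverse expands as a geometric series in `t - 1` with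
coefficients `a ^ i / (1 - a) ^ (i + 1)`; here it is cut at order `M` with its exact remainder. -/
theorem geom_decomposition {S : Type*} [CommRing S] {a c t g : S} (hc : c * (1 - a) = 1)
    (hg : (1 - a * t) * g = 1) (M : ℕ) :
    g = ∑ i ∈ Finset.range M, a ^ i * c ^ (i + 1) * (t - 1) ^ i + (a * c) ^ M * g * (t - 1) ^ M := by
  induction M with
  | zero => simp
  | succ M ih =>
    have h : g = c + a * c * g * (t - 1) := by
      linear_combination (-g) * hc + c * hg
    rw [Finset.sum_range_succ, add_assoc]
    nth_rewrite 1 [ih]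
    congr 1
    linear_combination (a * c) ^ M * (t - 1) ^ M * h

theorem mul_sub_mul_eq_of_eq_add {S : Type*} [CommRing S] (e : S) {g₁ g₂ s₁ s₂ a b v₁ v₂ : S}
    (h₁ : g₁ = s₁ + a * g₁ * v₁) (h₂ : g₂ = s₂ + b * g₂ * v₂) :
    e * (g₁ * g₂) - e * (s₁ * s₂) = e * (a * g₁) * g₂ * v₁ + e * s₁ * (b * g₂) * v₂ := by
  linear_combination (e * g₂) * h₁ + (e * s₁) * h₂

/-- Expand both inverses in powers of `T₁ - 1` and `T₂ - 1`: the functional turns these powers into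
the mixed differences of `Q`, so the truncated expansion is literally the regularised sum. The
remainder has high order, hence small value, and the main term stops changing once the truncation
passes `M₀`. -/
theorem evalFunctional_geom {E T₁ T₂ G₁ G₂ : MvPowerSeries (Fin 2) R} {α β α' β' : R}
    (hT₁ : constantCoeff T₁ = 1) (hT₂ : constantCoeff T₂ = 1)
    (hα : α' * (1 - α) = 1) (hβ : β' * (1 - β) = 1)
    (hG₁ : (1 - C α * T₁) * G₁ = 1) (hG₂ : (1 - C β * T₂) * G₂ = 1) {Q : ℕ → ℕ → ℂ_[p]}
    (hQ : ∀ n m, evalFunctional hR hd (E * T₁ ^ n * T₂ ^ m) = Q n m) {M₀ : ℕ}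
    (hM₀ : ∀ i l, M₀ ≤ i ∨ M₀ ≤ l → diffCoeff Q i l = 0) :
    evalFunctional hR hd (E * (G₁ * G₂)) = regularizedSum (α : ℂ_[p]) β M₀ Q := by
  have hQ' : Q = fun n m => evalFunctional hR hd (E * T₁ ^ n * T₂ ^ m) := by
    ext n m
    exact (hQ n m).symm
  have hα0 : (α' : ℂ_[p]) = (1 - (α : ℂ_[p]))⁻¹ := eq_inv_of_mul_eq_one_left (by exact_mod_cast congrArg Subtype.val hα)
  have hβ0 : (β' : ℂ_[p]) = (1 - (β : ℂ_[p]))⁻¹ := eq_inv_of_mul_eq_one_left (by exact_mod_cast congrArg Subtype.val hβ)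
  have hCα : C (σ := Fin 2) α' * (1 - C α) = 1 := by rw [← map_one C, ← map_sub, ← map_mul, hα]
  have hCβ : C (σ := Fin 2) β' * (1 - C β) = 1 := by rw [← map_one C, ← map_sub, ← map_mul, hβ]
  have hreg : ∀ M, evalFunctional hR hd (E * ((∑ i ∈ Finset.range M, C α ^ i * C α' ^ (i + 1) * (T₁ - 1) ^ i) *
      ∑ l ∈ Finset.range M, C β ^ l * C β' ^ (l + 1) * (T₂ - 1) ^ l)) =
      ∑ i ∈ Finset.range M, ∑ l ∈ Finset.range M, diffCoeff Q i l * ((α : ℂ_[p]) ^ i / (1 - α) ^ (i + 1)) *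
        ((β : ℂ_[p]) ^ l / (1 - β) ^ (l + 1)) := by
    intro M
    rw [Finset.sum_mul_sum, Finset.mul_sum, map_sum]
    refine Finset.sum_congr rfl fun i _ => ?_
    rw [Finset.mul_sum, map_sum]
    refine Finset.sum_congr rfl fun l _ => ?_
    have e : E * (C α ^ i * C α' ^ (i + 1) * (T₁ - 1) ^ i * (C β ^ l * C β' ^ (l + 1) * (T₂ - 1) ^ l)) =
        (α ^ i * α' ^ (i + 1) * (β ^ l * β' ^ (l + 1))) • (E * (T₁ - 1) ^ i * (T₂ - 1) ^ l) := by
      rw [smul_eq_C_mul]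
      simp only [map_mul, map_pow]
      ring
    rw [e, map_smul, ← diffCoeff_evalFunctional, ← hQ', Subring.smul_def, smul_eq_mul]
    push_cast
    rw [hα0, hβ0]
    simp only [div_eq_mul_inv, inv_pow]
    ring
  have hlarge : ∀ M, M₀ ≤ M → (∑ i ∈ Finset.range M, ∑ l ∈ Finset.range M, diffCoeff Q i l *
      ((α : ℂ_[p]) ^ i / (1 - α) ^ (i + 1)) * ((β : ℂ_[p]) ^ l / (1 - β) ^ (l + 1))) =
      regularizedSum (α : ℂ_[p]) β M₀ Q := by
    intro M hM
    rw [regularizedSum]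
    have hsub := Finset.range_mono hM
    refine (Finset.sum_subset hsub fun i _ hi => ?_).symm.trans (Finset.sum_congr rfl fun i _ => ?_) |>.trans rfl
    · refine Finset.sum_eq_zero fun l _ => ?_
      rw [hM₀ i l (Or.inl (by simpa using hi)), zero_mul, zero_mul]
    · refine (Finset.sum_subset hsub fun l _ hl => ?_).symm
      rw [hM₀ i l (Or.inr (by simpa using hl)), zero_mul, zero_mul]
  rw [← sub_eq_zero, ← norm_eq_zero]
  refine le_antisymm (le_of_forall_gt_imp_ge_of_dense fun ε hε => ?_) (norm_nonneg _)
  obtain ⟨M₁, hM₁⟩ := exists_norm_evalFunctional_le hR hd hε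
  set M := max M₀ M₁
  rw [← hlarge M (le_max_left _ _), ← hreg, ← map_sub]
  refine hM₁ _ ?_
  have ord : ∀ (H V : MvPowerSeries (Fin 2) R), constantCoeff V = 1 → (M₁ : ℕ∞) ≤ (H * (V - 1) ^ M).order := by
    intro H V hV
    have h1 : ((M : ℕ) : ℕ∞) ≤ ((V - 1) ^ M).order :=
      le_order_pow_of_constantCoeff_eq_zero M (by rw [map_sub, hV, map_one, sub_self])
    exact ((Nat.cast_le.2 (le_max_right M₀ M₁)).trans h1).trans (le_add_self.trans le_order_mul)
  have d1 := geom_decomposition hCα hG₁ M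
  have d2 := geom_decomposition hCβ hG₂ M
  set P₁ := ∑ i ∈ Finset.range M, C α ^ i * C α' ^ (i + 1) * (T₁ - 1) ^ i
  set P₂ := ∑ l ∈ Finset.range M, C β ^ l * C β' ^ (l + 1) * (T₂ - 1) ^ l
  have e : E * (G₁ * G₂) - E * (P₁ * P₂) = E * ((C α * C α') ^ M * G₁) * G₂ * (T₁ - 1) ^ M +
      E * P₁ * ((C β * C β') ^ M * G₂) * (T₂ - 1) ^ M :=
    mul_sub_mul_eq_of_eq_add E d1 d2
  rw [e]
  exact (le_min (ord _ _ hT₁) (ord _ _ hT₂)).trans min_order_le_add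

/-- Mahler's theorem in each variable; the product of the two expansions is the double series. -/
theorem evalFunctional_binomSeries (φ : ℤ_[p] →+* R) (hφ : ∀ z, (φ z : ℂ_[p]) = intToComplex p z)
    (h : C(ℤ_[p], ℤ_[p])) (z : Fin 2 → ℤ_[p]) :
    evalFunctional hR (tendsto_mahlerCoeff h) (MvPowerSeries.map φ (binomSeries (z - 1))) =
      intToComplex p (h (z 0) * h (z 1)) := by
  have h0 : ∀ i, HasSum (fun n => intToComplex p (mahlerCoeff h n * Ring.choose (z i - 1) n))
      (intToComplex p (h (z i))) := fun i =>
    (hasSum_mahlerCoeff h (z i)).map (intToComplex p) isometry_intToComplex.continuous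
  have h2 := HasSum.mul_of_nonarchimedean (h0 0) (h0 1)
  rw [map_mul, evalFunctional_apply, ← h2.tsum_eq]
  refine tsum_congr fun n => ?_
  rw [coeff_map, hφ, coeff_binomSeries, ← map_mul, ← map_mul]
  congr 1
  simp only [expo_zero, expo_one, Pi.sub_apply, Pi.one_apply]
  ring

end

end ConeZeta

namespace ConeZeta

/-! ### The pairing of a power function with a quotient of binomial series -/

section

open MvPowerSeries Filter Topology

variable {p : ℕ} [hp : Fact p.Prime]

/-- The series `e (1 + X) ^ (y - 1) / ((1 - α (1 + X) ^ u) (1 - β (1 + X) ^ v))`. -/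
noncomputable def quotientSeries (e α β : ℂ_[p]) (y u v : Fin 2 → ℂ_[p]) :
    MvPowerSeries (Fin 2) ℂ_[p] :=
  C e * binomSeries (y - 1) * ((1 - C α * binomSeries u) * (1 - C β * binomSeries v))⁻¹

theorem constantCoeff_one_sub_mul_binomSeries {A : Type*} [CommRing A] [BinomialRing A] (α : A)
    (u : Fin 2 → A) : constantCoeff (1 - C α * binomSeries u) = 1 - α := by
  rw [map_sub, map_mul, constantCoeff_binomSeries, map_one, constantCoeff_C, mul_one]

variable {f : ℕ} (hf : f ≠ 0) (hpf : ¬ p ∣ f) {e α β : ℂ_[p]} (he : e ^ f = 1) (hα : α ^ f = 1)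
  (hβ : β ^ f = 1) (hα1 : α ≠ 1) (hβ1 : β ≠ 1) (y u v : Fin 2 → ℤ_[p])

/-- The embedding of `ℤ_p` in `ℤ_p[μ_f]`. -/
noncomputable def intToCyclotomic (p : ℕ) [Fact p.Prime] (f : ℕ) : ℤ_[p] →+* cyclotomicInts p f :=
  (intToComplex p).codRestrict (cyclotomicInts p f) (intToComplex_mem_cyclotomicInts f)

theorem coe_intToCyclotomic (f : ℕ) (z : ℤ_[p]) :
    (intToCyclotomic p f z : ℂ_[p]) = intToComplex p z := rfl

include hf hpf he hα hβ hα1 hβ1 in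
-- As `1 - α` and `1 - β` are invertible in `ℤ_p[μ_f]`, the quotient can be formed over that ring.
-- There `evalFunctional` is available, and `E T₁ ^ n T₂ ^ m` is a single binomial series whose
-- exponents are linear forms minus `1`.
theorem exists_quotientSeries_eq_map : ∃ F : MvPowerSeries (Fin 2) (cyclotomicInts p f),
    MvPowerSeries.map (cyclotomicInts p f).subtype F =
      quotientSeries e α β (fun i => intToComplex p (y i)) (fun i => intToComplex p (u i))
        (fun i => intToComplex p (v i)) ∧
    ∀ (h : C(ℤ_[p], ℤ_[p])) (M : ℕ) (Q : ℕ → ℕ → ℂ_[p]),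
      (∀ n m, Q n m = intToComplex p (h (linForm (y 0) (u 0) (v 0) n m) *
        h (linForm (y 1) (u 1) (v 1) n m))) →
      (∀ i l, M ≤ i ∨ M ≤ l → diffCoeff Q i l = 0) →
      evalFunctional (fun _ => norm_le_one_of_mem_cyclotomicInts hf) (tendsto_mahlerCoeff h) F =
        e * regularizedSum α β M Q := by
  have root_mem : ∀ {x : ℂ_[p]}, x ^ f = 1 → x ∈ cyclotomicInts p f := fun hx =>
    Subring.subset_closure (Or.inr hx)
  have inv_spec : ∀ {x : ℂ_[p]}, x ≠ 1 → (1 - x)⁻¹ * (1 - x) = 1 := fun hx =>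
    inv_mul_cancel₀ (sub_ne_zero.2 (Ne.symm hx))
  have hα' : (⟨_, inv_one_sub_mem_cyclotomicInts hf hpf hα hα1⟩ : cyclotomicInts p f) *
      (1 - ⟨α, root_mem hα⟩) = 1 := Subtype.ext (inv_spec hα1)
  have hβ' : (⟨_, inv_one_sub_mem_cyclotomicInts hf hpf hβ hβ1⟩ : cyclotomicInts p f) *
      (1 - ⟨β, root_mem hβ⟩) = 1 := Subtype.ext (inv_spec hβ1)
  set T : (Fin 2 → ℤ_[p]) → MvPowerSeries (Fin 2) (cyclotomicInts p f) := fun z =>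
    MvPowerSeries.map (intToCyclotomic p f) (binomSeries z) with hT
  have hT1 : ∀ z, constantCoeff (T z) = 1 := fun z => by
    rw [hT]
    simp only [constantCoeff_map, constantCoeff_binomSeries, map_one]
  have unit : ∀ (γ γ' : cyclotomicInts p f) (z : Fin 2 → ℤ_[p]), γ' * (1 - γ) = 1 →
      ∃ G, (1 - C γ * T z) * G = 1 := by
    intro γ γ' z h
    refine IsUnit.exists_right_inv ?_
    rw [MvPowerSeries.isUnit_iff_constantCoeff, map_sub, map_mul, hT1, map_one, constantCoeff_C,
      mul_one]
    exact IsUnit.of_mul_eq_one_right _ h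
  obtain ⟨G₁, hG₁⟩ := unit _ _ u hα'
  obtain ⟨G₂, hG₂⟩ := unit _ _ v hβ'
  have hmapT : ∀ z, MvPowerSeries.map (cyclotomicInts p f).subtype (T z) =
      binomSeries fun i => intToComplex p (z i) := by
    intro z
    rw [← map_binomSeries, hT]
    ext n
    simp only [coeff_map]
    rfl
  refine ⟨C ⟨e, root_mem he⟩ * T (y - 1) * (G₁ * G₂), ?_, ?_⟩
  · rw [quotientSeries, MvPowerSeries.eq_mul_inv_iff_mul_eq]
    · rw [map_mul, map_mul, hmapT, map_C]
      have h1 := congrArg (MvPowerSeries.map (cyclotomicInts p f).subtype) hG₁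
      have h2 := congrArg (MvPowerSeries.map (cyclotomicInts p f).subtype) hG₂
      simp only [map_mul, map_sub, map_one, map_C, hmapT] at h1 h2
      have h3 : (binomSeries fun i => intToComplex p ((y - 1) i)) =
          binomSeries ((fun i => intToComplex p (y i)) - 1) := by
        congr 1
        ext i
        simp
      rw [h3, map_mul]
      calc _ = C e * binomSeries ((fun i => intToComplex p (y i)) - 1) *
            (((1 - C α * binomSeries fun i => intToComplex p (u i)) *
              MvPowerSeries.map (cyclotomicInts p f).subtype G₁) *
            ((1 - C β * binomSeries fun i => intToComplex p (v i)) *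
              MvPowerSeries.map (cyclotomicInts p f).subtype G₂)) := by
            simp only [Subring.subtype_apply]
            ring
        _ = _ := by
            simp only [Subring.subtype_apply] at h1 h2
            rw [h1, h2, mul_one, mul_one]
    · rw [map_mul, constantCoeff_one_sub_mul_binomSeries, constantCoeff_one_sub_mul_binomSeries]
      exact mul_ne_zero (sub_ne_zero.2 (Ne.symm hα1)) (sub_ne_zero.2 (Ne.symm hβ1))
  · intro h M Q hQ hM
    rw [mul_assoc, ← smul_eq_C_mul, map_smul, Subring.smul_def, smul_eq_mul]
    congr 1
    refine evalFunctional_geom _ _ (hT1 u) (hT1 v) hα' hβ' hG₁ hG₂ (fun n m => ?_) hM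
    have e1 : T (y - 1) * T u ^ n * T v ^ m =
        MvPowerSeries.map (intToCyclotomic p f)
          (binomSeries ((fun i => linForm (y i) (u i) (v i) n m) - 1)) := by
      rw [hT]
      simp only [← map_pow, ← map_mul, ← binomSeries_nsmul, ← binomSeries_add]
      congr 2
      ext i
      simp only [Pi.add_apply, Pi.sub_apply, Pi.smul_apply, Pi.one_apply, linForm]
      simp only [nsmul_eq_mul]
      ring
    rw [e1, evalFunctional_binomSeries _ _ (coe_intToCyclotomic f), hQ]

include hf hpf he hα hβ hα1 hβ1 in
theorem coeff_quotientSeries_mem (n : Fin 2 →₀ ℕ) :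
    coeff n (quotientSeries e α β (fun i => intToComplex p (y i)) (fun i => intToComplex p (u i))
        (fun i => intToComplex p (v i))) ∈ cyclotomicInts p f := by
  obtain ⟨F, hF, -⟩ := exists_quotientSeries_eq_map hf hpf he hα hβ hα1 hβ1 y u v
  rw [← hF, coeff_map]
  exact (coeff n F).2

include hf hpf he hα hβ hα1 hβ1 in
theorem pairing_quotientSeries (h : C(ℤ_[p], ℤ_[p])) (M : ℕ) (Q : ℕ → ℕ → ℂ_[p])
    (hQ : ∀ n m, Q n m = intToComplex p (h (linForm (y 0) (u 0) (v 0) n m) *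
        h (linForm (y 1) (u 1) (v 1) n m)))
    (hM : ∀ i l, M ≤ i ∨ M ≤ l → diffCoeff Q i l = 0) :
    pairing (fun n => coeff (expo n) (quotientSeries e α β (fun i => intToComplex p (y i))
      (fun i => intToComplex p (u i)) (fun i => intToComplex p (v i)))) h =
        e * regularizedSum α β M Q := by
  obtain ⟨F, hF, hF'⟩ := exists_quotientSeries_eq_map hf hpf he hα hβ hα1 hβ1 y u v
  rw [← hF' h M Q hQ hM, ← hF]
  rfl

theorem diffCoeff_zero {K : Type*} [CommRing K] (i l : ℕ) : diffCoeff (fun _ _ => (0 : K)) i l = 0 := by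
  rw [diffCoeff_eq_sum]
  simp

theorem norm_linForm_eq_one_iff (y u v : ℤ_[p]) (n m : ℕ) :
    ‖linForm y (p * u) (p * v) n m‖ = 1 ↔ ‖y‖ = 1 := by
  refine norm_eq_one_iff_of_norm_sub_lt_one ?_
  rw [PadicInt.norm_lt_one_iff_dvd]
  exact ⟨n * u + m * v, by rw [linForm]; ring⟩

include hf hpf he hα hβ hα1 hβ1 in
open Classical in
-- The increments are multiples of `p`, so all values of each linear form are units or none are.
-- Hence along the progression the truncated power function is either the full polynomial or zero in
-- the product.
theorem pairing_quotientSeries_unitPow (N : ℕ) :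
    pairing (fun n => coeff (expo n) (quotientSeries e α β (fun i => intToComplex p (y i))
      (fun i => intToComplex p (p * u i)) (fun i => intToComplex p (p * v i)))) (unitPow p N) =
      if ‖y 0‖ = 1 ∧ ‖y 1‖ = 1 then
        e * regularizedSum α β (2 * N + 1) fun n m =>
          (linForm (intToComplex p (y 0)) (intToComplex p (p * u 0)) (intToComplex p (p * v 0)) n m *
            linForm (intToComplex p (y 1)) (intToComplex p (p * u 1)) (intToComplex p (p * v 1)) n m) ^ N
      else 0 := by
  have map_lin : ∀ (φ : ℤ_[p] →+* ℂ_[p]) (a b c : ℤ_[p]) (n m : ℕ),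
      φ (linForm a b c n m) = linForm (φ a) (φ b) (φ c) n m := by
    intro φ a b c n m
    simp [linForm]
  split_ifs with hy
  · refine pairing_quotientSeries hf hpf he hα hβ hα1 hβ1 y (fun i => p * u i) (fun i => p * v i) _ _ _
      (fun n m => ?_) fun i l hil => ?_
    · rw [unitPow_of_norm_eq_one ((norm_linForm_eq_one_iff _ _ _ n m).2 hy.1),
        unitPow_of_norm_eq_one ((norm_linForm_eq_one_iff _ _ _ n m).2 hy.2), ← mul_pow, ← map_lin,
        ← map_lin, ← map_mul, ← map_pow]
    · simp only [mul_pow]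
      exact diffCoeff_linForm_pow_eq_zero (fun i => intToComplex p (y i))
        (fun i => intToComplex p (p * u i)) (fun i => intToComplex p (p * v i)) N N i l (by omega)
  · refine (pairing_quotientSeries hf hpf he hα hβ hα1 hβ1 y (fun i => p * u i) (fun i => p * v i) _ 0
      (fun _ _ => 0) (fun n m => ?_) fun i l hil => diffCoeff_zero i l).trans ?_
    · rw [not_and_or] at hy
      rcases hy with hy | hy
      · rw [unitPow_of_norm_ne_one (fun h => hy ((norm_linForm_eq_one_iff _ _ _ n m).1 h)), zero_mul,
          map_zero]
      · rw [unitPow_of_norm_ne_one (x := linForm (y 1) _ _ n m)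
          (fun h => hy ((norm_linForm_eq_one_iff _ _ _ n m).1 h)), mul_zero, map_zero]
    · simp [regularizedSum]

end

end ConeZeta

namespace ConeZeta

/-! ### Interpolation of the pairings with power functions -/

section

open Filter Topology

variable {p : ℕ} [hp : Fact p.Prime]

/-- The inclusion of `M(p)` in `D(p)`. -/
noncomputable def interpolationPoint (m : interpolationSet p) : interpolationDomain p :=
  ⟨(m : ℤ), intCast_mem_interpolationDomain m.2⟩

theorem denseRange_interpolationPoint : DenseRange (interpolationPoint (p := p)) := by
  intro s
  rw [Metric.mem_closure_iff]
  intro ε hε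
  obtain ⟨k, hk⟩ := exists_pow_lt_of_lt_one hε
    (inv_lt_one_of_one_lt₀ (show (1 : ℝ) < p by exact_mod_cast hp.out.one_lt))
  obtain ⟨m, hm, h⟩ := exists_interpolationSet_near s k
  refine ⟨_, ⟨⟨m, hm⟩, rfl⟩, lt_of_le_of_lt ?_ hk⟩
  rw [Subtype.dist_eq, dist_eq_norm]
  simpa [interpolationPoint, zpow_neg, inv_pow] using h

/-- The value at `m ∈ M(p)` of the pairing of `a` with `x ↦ x ^ (-m)`. -/
noncomputable def pairingValue (a : ℕ × ℕ → ℂ_[p]) (m : ℤ) : ℂ_[p] :=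
  pairing a (unitPow p (-m).toNat)

/-- The constant `p` absorbs the power of `p` lost in comparing power functions; when the distance
is `1` the bound is trivial. -/
theorem norm_pairingValue_sub_le {a : ℕ × ℕ → ℂ_[p]} (ha : ∀ n, ‖a n‖ ≤ 1)
    (m m' : interpolationSet p) :
    ‖pairingValue a m - pairingValue a m'‖ ≤ p * ‖((m : ℤ) : ℤ_[p]) - ((m' : ℤ) : ℤ_[p])‖ := by
  wlog hle : (m : ℤ) ≤ m' generalizing m m' with H
  · rw [norm_sub_rev, norm_sub_rev ((m : ℤ) : ℤ_[p])]
    exact H m' m (not_le.1 hle).le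
  by_cases h0 : ((m : ℤ) : ℤ_[p]) - ((m' : ℤ) : ℤ_[p]) = 0
  · rw [sub_eq_zero] at h0
    rw [Subtype.ext (Int.cast_injective h0) (a1 := m) (a2 := m')]
    simp
  obtain ⟨k, hk⟩ : ∃ k : ℕ, ‖((m : ℤ) : ℤ_[p]) - ((m' : ℤ) : ℤ_[p])‖ = (p : ℝ) ^ (-(k : ℤ)) :=
    ⟨_, PadicInt.norm_eq_zpow_neg_valuation h0⟩
  have hp1 : (1 : ℝ) < p := by exact_mod_cast hp.out.one_lt
  have hN : (((-(m : ℤ)).toNat - (-(m' : ℤ)).toNat : ℕ) : ℤ) = m' - m := by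
    have := m.2.1
    have := m'.2.1
    omega
  rw [pairingValue, pairingValue, hk]
  refine norm_pairing_sub_le ha (by positivity) fun x => ?_
  rcases Nat.eq_zero_or_pos k with rfl | hkpos
  · refine (PadicInt.norm_le_one _).trans ?_
    simpa using hp1.le
  · obtain ⟨k, rfl⟩ := Nat.exists_eq_succ_of_ne_zero hkpos.ne'
    refine (norm_unitPow_sub_le (k := k) (by omega) ?_ ?_ x).trans ?_
    · rw [← Int.natCast_dvd_natCast, hN]
      exact (m.2.2.trans m'.2.2.symm).dvd
    · rw [← Int.natCast_dvd_natCast, hN]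
      have h2 : ((p ^ (k + 1) : ℕ) : ℤ) ∣ (m : ℤ) - m' := by
        rw [← Int.cast_sub] at hk
        have := PadicInt.norm_int_le_pow_iff_dvd.1 hk.le
        exact_mod_cast this
      exact (dvd_sub_comm).1 h2
    · rw [← zpow_one_add₀ (by positivity)]
      refine le_of_eq ?_
      congr 1
      push_cast
      ring

theorem exists_continuous_interpolation {a : ℕ × ℕ → ℂ_[p]} (ha : ∀ n, ‖a n‖ ≤ 1) :
    ∃ z : interpolationDomain p → ℂ_[p], Continuous z ∧
      ∀ m : interpolationSet p, z (interpolationPoint m) = pairingValue a m := by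
  -- The uniformity on `M(p)` is the `p`-adic one, pulled back from `D(p)`, so that the values
  -- extend along a dense inclusion.
  let _ : UniformSpace (interpolationSet p) := UniformSpace.comap interpolationPoint inferInstance
  have hu : IsUniformInducing (interpolationPoint (p := p)) := ⟨rfl⟩
  have hc : UniformContinuous fun m : interpolationSet p => pairingValue a m := by
    rw [(hu.basis_uniformity Metric.uniformity_basis_dist).uniformContinuous_iff
      Metric.uniformity_basis_dist]
    intro ε hε
    have hp0 : (0 : ℝ) < p := by exact_mod_cast hp.out.pos
    refine ⟨ε / p, by positivity, fun m m' h => ?_⟩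
    have h' : dist (interpolationPoint m) (interpolationPoint m') < ε / p := h
    rw [Subtype.dist_eq, dist_eq_norm, lt_div_iff₀ hp0, mul_comm] at h'
    show dist _ _ < ε
    rw [dist_eq_norm]
    exact (norm_pairingValue_sub_le ha m m').trans_lt h'
  exact ⟨_, (uniformContinuous_uniformly_extend hu denseRange_interpolationPoint hc).continuous,
    fun m => uniformly_extend_of_ind hu denseRange_interpolationPoint hc m⟩

theorem eq_of_interpolates {z z' : interpolationDomain p → ℂ_[p]} (hz : Continuous z)
    (hz' : Continuous z')
    (h : ∀ m : interpolationSet p, z (interpolationPoint m) = z' (interpolationPoint m)) : z = z' :=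
  denseRange_interpolationPoint.equalizer hz hz' (funext h)

theorem interpolation_one {a : ℕ × ℕ → ℂ_[p]} (ha : ∀ n, ‖a n‖ ≤ 1)
    {z : interpolationDomain p → ℂ_[p]} (hz : Continuous z)
    (h : ∀ m : interpolationSet p, z (interpolationPoint m) = pairingValue a m) :
    z ⟨1, one_mem_interpolationDomain p⟩ = pairing a (unitInv p) := by
  have hp1 : (1 : ℝ) < p := by exact_mod_cast hp.out.one_lt
  set w := numRootsOfUnity p
  have hw : 0 < w := numRootsOfUnity_pos
  -- Points of `M(p)` tending to `1`: the corresponding exponents satisfy `N + 1 = w * p ^ (k + 1)`,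
  -- just what is needed to compare with `x⁻¹`.
  let M : ℕ → interpolationSet p := fun k => ⟨1 - w * p ^ (k + 1), by
    refine ⟨?_, ?_⟩
    · have : 0 < w * p ^ (k + 1) := Nat.mul_pos hw (pow_pos hp.out.pos _)
      have : (0 : ℤ) < w * p ^ (k + 1) := by exact_mod_cast this
      linarith
    · exact (Int.modEq_iff_dvd.2 ⟨p ^ (k + 1), by ring⟩)⟩
  have hp0 : Tendsto (fun k : ℕ => ((p : ℝ)⁻¹) ^ k) atTop (𝓝 0) := tendsto_inv_pow
  have hM : Tendsto (fun k => interpolationPoint (M k)) atTop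
      (𝓝 ⟨1, one_mem_interpolationDomain p⟩) := by
    rw [tendsto_iff_dist_tendsto_zero]
    refine squeeze_zero (fun _ => dist_nonneg) (fun k => ?_) hp0
    rw [Subtype.dist_eq, dist_eq_norm]
    have e : ((interpolationPoint (M k)).1 - 1 : ℤ_[p]) = -(w * p * p ^ k) := by
      simp only [interpolationPoint, M]
      push_cast
      ring
    rw [e, norm_neg, norm_mul, norm_pow, PadicInt.norm_p]
    exact mul_le_of_le_one_left (by positivity) (PadicInt.norm_le_one _)
  have h1 : Tendsto (fun k => z (interpolationPoint (M k))) atTop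
      (𝓝 (z ⟨1, one_mem_interpolationDomain p⟩)) := (hz.tendsto _).comp hM
  refine tendsto_nhds_unique h1 ?_
  rw [tendsto_iff_norm_sub_tendsto_zero]
  refine squeeze_zero (fun _ => norm_nonneg _) (fun k => ?_) hp0
  rw [h, pairingValue]
  refine norm_pairing_sub_le ha (by positivity) fun x => ?_
  have hN : (((-(M k : ℤ)).toNat + 1 : ℕ) : ℤ) = w * p ^ (k + 1) := by
    have := (M k).2.1
    have e : ((M k : ℤ)) = 1 - w * p ^ (k + 1) := rfl
    push_cast
    omega
  have hN' : (-(M k : ℤ)).toNat + 1 = w * p ^ (k + 1) := by exact_mod_cast hN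
  refine (norm_unitPow_sub_unitInv_le (k := k) ?_ ?_ x).trans (le_of_eq ?_)
  · rw [hN']
    exact dvd_mul_right _ _
  · rw [hN']
    exact dvd_mul_left _ _
  · rw [zpow_neg, inv_pow, zpow_natCast]

theorem hasSum_pairing_unitInv {a : ℕ × ℕ → ℂ_[p]} (ha : ∀ n, ‖a n‖ ≤ 1) :
    HasSum (fun n : ℕ × ℕ => 1 / (p : ℂ_[p]) ^ 2 * (rootSum p (n.1 + 1) * rootSum p (n.2 + 1) * a n /
      (((n.1 : ℂ_[p]) + 1) * ((n.2 : ℂ_[p]) + 1)))) (pairing a (unitInv p)) := by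
  refine (congrArg (fun f => HasSum f _) (funext fun n => ?_)).mpr (hasSum_pairing ha (unitInv p))
  rw [map_mul, intToComplex_mahlerCoeff_unitInv, intToComplex_mahlerCoeff_unitInv]
  have hp0 : (p : ℂ_[p]) ≠ 0 := by exact_mod_cast hp.out.ne_zero
  have h1 : (n.1 : ℂ_[p]) + 1 ≠ 0 := by exact_mod_cast Nat.succ_ne_zero n.1
  have h2 : (n.2 : ℂ_[p]) + 1 ≠ 0 := by exact_mod_cast Nat.succ_ne_zero n.2
  field_simp

theorem pairing_sum {ι : Type*} (s : Finset ι) {a : ι → ℕ × ℕ → ℂ_[p]}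
    (ha : ∀ i ∈ s, ∀ n, ‖a i n‖ ≤ 1) (h : C(ℤ_[p], ℤ_[p])) :
    pairing (fun n => ∑ i ∈ s, a i n) h = ∑ i ∈ s, pairing (a i) h := by
  refine HasSum.tsum_eq ?_
  refine (congrArg (fun f => HasSum f _) (funext fun n => ?_)).mpr
    (hasSum_sum fun i hi => hasSum_pairing (ha i hi) h)
  rw [Finset.mul_sum]

end

end ConeZeta

namespace ConeZeta

/-! ### The index of a principal ideal and the embeddings in `ℂ_p` -/

section

open IsDedekindDomain

variable {p : ℕ} [hp : Fact p.Prime] {k : Type*} [Field k] [NumberField k]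
  (hk : Module.finrank ℚ k = 2) {𝔭₁ 𝔭₂ : HeightOneSpectrum (𝓞 k)} (h𝔭 : 𝔭₁ ≠ 𝔭₂)
  (hsplit : Ideal.span {(p : 𝓞 k)} = 𝔭₁.asIdeal * 𝔭₂.asIdeal)
  {I : FractionalIdeal (𝓞 k)⁰ k} (hI : I ≠ 0)
  (hI𝔭₁ : FractionalIdeal.count k 𝔭₁ I = 0) (hI𝔭₂ : FractionalIdeal.count k 𝔭₂ I = 0)

include hk h𝔭 hsplit in
-- There are two embeddings, each above one of the two primes, and distinct embeddings cannot lie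
-- above the same prime.
theorem exists_isAbove : (∃ ψ : k →+* ℂ_[p], IsAbove ψ 𝔭₁) ∧ ∃ ψ : k →+* ℂ_[p], IsAbove ψ 𝔭₂ := by
  have hsplit' : Ideal.span {(p : 𝓞 k)} = 𝔭₂.asIdeal * 𝔭₁.asIdeal := by rw [hsplit, mul_comm]
  have hcard := NumberField.Embeddings.card k ℂ_[p]
  rw [hk] at hcard
  obtain ⟨ψ, ψ', hne⟩ := Fintype.exists_pair_of_one_lt_card (α := k →+* ℂ_[p]) (by omega)
  rcases isAbove_or_isAbove ψ hsplit with h | h <;> rcases isAbove_or_isAbove ψ' hsplit with h' | h'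
  · exact absurd (eq_of_isAbove h h' h𝔭 hsplit (card_quotient_eq hk hsplit)) hne
  · exact ⟨⟨ψ, h⟩, ⟨ψ', h'⟩⟩
  · exact ⟨⟨ψ', h'⟩, ⟨ψ, h⟩⟩
  · exact absurd (eq_of_isAbove h h' h𝔭.symm hsplit' (card_quotient_eq hk hsplit')) hne

include hk h𝔭 hsplit hI𝔭₁ hI𝔭₂ in
theorem exists_intToComplex_eq_of_mem (ψ : k →+* ℂ_[p]) {x : k} (hx : x ∈ I) :
    ∃ z : ℤ_[p], intToComplex p z = ψ x := by
  have hsplit' : Ideal.span {(p : 𝓞 k)} = 𝔭₂.asIdeal * 𝔭₁.asIdeal := by rw [hsplit, mul_comm]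
  rcases isAbove_or_isAbove ψ hsplit with h | h
  · exact exists_intToComplex_eq h h𝔭 hsplit (card_quotient_eq hk hsplit)
      (mem_localRing_of_mem hI𝔭₁ hx)
  · exact exists_intToComplex_eq h h𝔭.symm hsplit' (card_quotient_eq hk hsplit')
      (mem_localRing_of_mem hI𝔭₂ hx)

include hk h𝔭 hsplit in
theorem mem_span_of_forall_norm_lt_one {c : 𝓞 k} (hc : ∀ ψ : k →+* ℂ_[p], ‖ψ (c : k)‖ < 1) :
    ∃ d : 𝓞 k, c = p * d := by
  obtain ⟨⟨ψ₁, h₁⟩, ⟨ψ₂, h₂⟩⟩ := exists_isAbove hk h𝔭 hsplit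
  have hcop : IsCoprime 𝔭₁.asIdeal 𝔭₂.asIdeal :=
    Ideal.isCoprime_of_isMaximal fun h => h𝔭 (HeightOneSpectrum.ext h)
  have hmem : c ∈ 𝔭₁.asIdeal * 𝔭₂.asIdeal := by
    rw [Ideal.mul_eq_inf_of_isCoprime hcop]
    exact ⟨(h₁ c).1 (hc ψ₁), (h₂ c).1 (hc ψ₂)⟩
  rw [← hsplit] at hmem
  exact Ideal.mem_span_singleton.1 hmem

/-- An infinite index would be recorded as `0`, which `p` divides. The quotient is finitely
generated and torsion over `ℤ`: if `x / a = b / c`, the norm of `c` is a multiple of `c` and carries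
`x` into `(a)`. -/
theorem principalIndex_ne_zero {a : (I : Submodule (𝓞 k) k)} (ha : (a : k) ≠ 0) :
    principalIndex a ≠ 0 := by
  have hfg : Module.Finite (𝓞 k) (I : Submodule (𝓞 k) k) :=
    Module.Finite.iff_fg.2 (I.fg_of_isNoetherianRing le_rfl)
  have : Module.Finite ℤ (I : Submodule (𝓞 k) k) := Module.Finite.trans (𝓞 k) _
  set N := Submodule.span (𝓞 k) {a} with hN
  have htors : Module.IsTorsion ℤ ((I : Submodule (𝓞 k) k) ⧸ N) := by
    intro x
    obtain ⟨x, rfl⟩ := N.mkQ_surjective x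
    obtain ⟨⟨b, c⟩, hbc⟩ := IsLocalization.surj (M := (𝓞 k)⁰) ((x : k) / a)
    have hc0 : (c : 𝓞 k) ≠ 0 := nonZeroDivisors.ne_zero c.2
    obtain ⟨e, he⟩ := Ideal.mem_span_singleton.1 (Ideal.absNorm_mem (Ideal.span {(c : 𝓞 k)}))
    set n := Ideal.absNorm (Ideal.span {(c : 𝓞 k)})
    have hn : (n : ℤ) ≠ 0 := by
      rw [Nat.cast_ne_zero, ne_eq, Ideal.absNorm_eq_zero_iff, Ideal.span_singleton_eq_bot]
      exact hc0
    refine ⟨⟨n, mem_nonZeroDivisors_of_ne_zero hn⟩, ?_⟩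
    have hmem : (n : ℤ) • x ∈ N := by
      refine Submodule.mem_span_singleton.2 ⟨e * b, Subtype.ext ?_⟩
      have h1 : (x : k) * ((c : 𝓞 k) : k) = b * (a : k) := by
        have h2 : (x : k) / (a : k) * ((c : 𝓞 k) : k) = b := hbc
        rw [← h2]
        field_simp
      have h3 : (n : k) = ((c : 𝓞 k) : k) * e := by
        have := congrArg (fun z : 𝓞 k => (z : k)) he
        push_cast at this
        exact this
      have h4 : ((e : k) * b) * (a : k) = n * (x : k) := by
        rw [h3]
        linear_combination (-(e : k)) * h1
      simpa [Algebra.smul_def] using h4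
    have h5 : N.mkQ ((n : ℤ) • x) = 0 := (Submodule.Quotient.mk_eq_zero N).2 hmem
    rw [map_zsmul] at h5
    exact h5
  have : Finite ((I : Submodule (𝓞 k) k) ⧸ N) := Module.finite_of_fg_torsion _ htors
  have : Finite ((I : Submodule (𝓞 k) k) ⧸ N.toAddSubgroup) := this
  exact Nat.card_pos.ne'

include hk h𝔭 hsplit hI hI𝔭₁ hI𝔭₂ in
-- If the index is prime to `p`, apply it to some `b ∈ I` with `|ψ(b)| = 1`: the result is a
-- multiple of `a`, so `ψ(a)` is a unit. Conversely, if `p` divides the index, Cauchy's theorem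
-- gives `y ∉ (a)` with `p y = c a`. If all `ψ(a)` were units, `c` would lie in both primes, hence
-- be divisible by `p`, and `y` would be in `(a)`.
theorem not_dvd_principalIndex_iff {a : (I : Submodule (𝓞 k) k)} (ha : (a : k) ≠ 0) :
    ¬ p ∣ principalIndex a ↔ ∀ ψ : k →+* ℂ_[p], ‖ψ (a : k)‖ = 1 := by
  have norm_le : ∀ (ψ : k →+* ℂ_[p]) {x : k}, x ∈ I → ‖ψ x‖ ≤ 1 := by
    intro ψ x hx
    obtain ⟨z, hz⟩ := exists_intToComplex_eq_of_mem hk h𝔭 hsplit hI𝔭₁ hI𝔭₂ ψ hx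
    rw [← hz, norm_intToComplex]
    exact PadicInt.norm_le_one z
  constructor
  · intro hn ψ
    obtain ⟨b, hb, hb1⟩ : ∃ b ∈ I, ‖ψ b‖ = 1 := by
      rcases isAbove_or_isAbove ψ hsplit with h | h
      · exact exists_mem_norm_eq_one h hI hI𝔭₁
      · exact exists_mem_norm_eq_one h hI hI𝔭₂
    have hmem := AddSubgroup.nsmul_index_mem (Submodule.span (𝓞 k) {a}).toAddSubgroup ⟨b, hb⟩
    obtain ⟨c, hc⟩ := Submodule.mem_span_singleton.1 hmem
    have hc' : (c : k) * a = principalIndex a * b := by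
      have := congrArg Subtype.val hc
      simpa [principalIndex, Algebra.smul_def] using this
    have h1 : ‖ψ (principalIndex a : k)‖ = 1 := by
      have := (norm_natCast_eq_one_iff (p := p) (principalIndex a)).2 hn
      rwa [← norm_intToComplex, map_natCast, ← map_natCast ψ] at this
    have h2 : ‖ψ (c : k)‖ * ‖ψ (a : k)‖ = 1 := by
      rw [← norm_mul, ← map_mul, hc', map_mul, norm_mul, h1, hb1, one_mul]
    refine le_antisymm (norm_le ψ a.2) ?_
    rw [← h2]
    exact mul_le_of_le_one_left (norm_nonneg _) (norm_algebraMap_le_one ψ c)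
  · intro hn hdvd
    have h0 := principalIndex_ne_zero ha
    set N := (Submodule.span (𝓞 k) {a}).toAddSubgroup with hN
    have hcard : p ∣ Nat.card ((I : Submodule (𝓞 k) k) ⧸ N) := hdvd
    have : Finite ((I : Submodule (𝓞 k) k) ⧸ N) := Nat.finite_of_card_ne_zero h0
    obtain ⟨y, hy⟩ := exists_prime_addOrderOf_dvd_card' p hcard
    obtain ⟨y, rfl⟩ := QuotientAddGroup.mk_surjective y
    have hy0 : y ∉ N := by
      intro hyN
      rw [(QuotientAddGroup.eq_zero_iff y).2 hyN, addOrderOf_zero] at hy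
      exact hp.out.one_lt.ne hy
    have hpy : p • y ∈ N := by
      rw [← QuotientAddGroup.eq_zero_iff, QuotientAddGroup.mk_nsmul, ← hy]
      exact addOrderOf_nsmul_eq_zero _
    obtain ⟨c, hc⟩ := Submodule.mem_span_singleton.1 hpy
    have hc' : (c : k) * a = p * (y : k) := by
      have := congrArg Subtype.val hc
      simpa [Algebra.smul_def] using this
    obtain ⟨d, rfl⟩ := mem_span_of_forall_norm_lt_one hk h𝔭 hsplit (c := c) (fun ψ => by
      have : ‖ψ (c : k)‖ * ‖ψ (a : k)‖ = ‖(p : ℂ_[p])‖ * ‖ψ (y : k)‖ := by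
        rw [← norm_mul, ← map_mul, hc', map_mul, norm_mul, map_natCast]
      rw [hn ψ, mul_one] at this
      rw [this]
      exact (mul_le_of_le_one_right (norm_nonneg _) (norm_le ψ y.2)).trans_lt norm_natCast_prime_lt_one)
    refine hy0 (Submodule.mem_span_singleton.2 ⟨d, Subtype.ext ?_⟩)
    have hp0 : (p : k) ≠ 0 := by exact_mod_cast hp.out.ne_zero
    have h2 : (d : k) * a = y := by
      push_cast at hc'
      rw [mul_assoc] at hc'
      exact mul_left_cancel₀ hp0 hc'
    simpa [Algebra.smul_def] using h2

end

/-! ### Orders of the values of the character -/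

section

variable {k : Type*} [Field k] {I : Submodule (𝓞 k) k} {ξ : AddChar I QBar}
  {𝔣 : Ideal (𝓞 k)} {f : ℕ}

theorem character_pow_eq_one (h𝔣 : annihilator ξ = 𝔣)
    (hf : 𝔣.comap (algebraMap ℤ (𝓞 k)) = Ideal.span {(f : ℤ)}) (x : I) : ξ x ^ f = 1 := by
  have h1 : (f : ℤ) ∈ 𝔣.comap (algebraMap ℤ (𝓞 k)) := hf ▸ Ideal.mem_span_singleton_self _
  rw [Ideal.mem_comap, ← h𝔣] at h1
  have h2 := h1 x
  rw [← AddChar.map_nsmul_eq_pow, ← h2]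
  congr 1
  simp [Nat.cast_smul_eq_nsmul]

/-- If `f = p g`, coprimality puts `g` itself in `𝔣`, contradicting the minimality of `f`. -/
theorem not_dvd_of_isCoprime {p : ℕ} (hp : p.Prime) (hf_pos : 0 < f)
    (hf : 𝔣.comap (algebraMap ℤ (𝓞 k)) = Ideal.span {(f : ℤ)})
    (hp𝔣 : IsCoprime (Ideal.span {(p : 𝓞 k)}) 𝔣) : ¬ p ∣ f := by
  rintro ⟨g, hg⟩
  obtain ⟨a, ha, b, hb, hab⟩ := Ideal.isCoprime_iff_exists.1 hp𝔣
  obtain ⟨c, rfl⟩ := Ideal.mem_span_singleton.1 ha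
  have hfm : (f : 𝓞 k) ∈ 𝔣 := by
    have h1 : (f : ℤ) ∈ 𝔣.comap (algebraMap ℤ (𝓞 k)) := hf ▸ Ideal.mem_span_singleton_self _
    simpa using h1
  have hgm : (g : 𝓞 k) ∈ 𝔣 := by
    have e : (g : 𝓞 k) = c * f + g * b := by
      rw [hg]
      push_cast
      linear_combination (-(g : 𝓞 k)) * hab
    rw [e]
    exact 𝔣.add_mem (𝔣.mul_mem_left _ hfm) (𝔣.mul_mem_left _ hb)
  have h2 : (g : ℤ) ∈ 𝔣.comap (algebraMap ℤ (𝓞 k)) := by simpa using hgm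
  rw [hf, Ideal.mem_span_singleton, Int.natCast_dvd_natCast] at h2
  have hg0 : 0 < g := Nat.pos_of_ne_zero fun h => by simp [h] at hg; omega
  have := Nat.le_of_dvd hg0 h2
  have := hp.two_le
  nlinarith

theorem pow_prime_ne_one {K : Type*} [Field K] {p : ℕ} (hp : p.Prime) (hpf : ¬ p ∣ f) {x : K}
    (hx : x ^ f = 1) (hx1 : x ≠ 1) : x ^ p ≠ 1 := by
  intro h
  have h1 : orderOf x ∣ Nat.gcd f p := Nat.dvd_gcd (orderOf_dvd_of_pow_eq_one hx)
    (orderOf_dvd_of_pow_eq_one h)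
  rw [Nat.gcd_comm, (Nat.Prime.coprime_iff_not_dvd hp).2 hpf, Nat.dvd_one, orderOf_eq_one_iff] at h1
  exact hx1 h1

end

end ConeZeta

namespace ConeZeta

/-! ### Lattice points in the cone -/

section

variable {k : Type*} [Field k] [CharZero k] {I : Submodule (𝓞 k) k} {τ₁ τ₂ : I}

theorem eq_of_ratCast_mul_add_eq {t₁ t₂ : k} (hτ : LinearIndependent ℚ ![t₁, t₂]) {r t r' t' : ℚ}
    (h : (r : k) * t₁ + t * t₂ = r' * t₁ + t' * t₂) : r = r' ∧ t = t' := by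
  have h1 := LinearIndependent.pair_iff.1 hτ (r - r') (t - t') (by
    simp only [Algebra.smul_def, eq_ratCast]
    push_cast
    linear_combination h)
  exact ⟨sub_eq_zero.1 h1.1, sub_eq_zero.1 h1.2⟩

/-- The points of `I` in the half-open parallelogram. -/
abbrev ParallelogramPoint (τ₁ τ₂ : I) : Type _ := {a : I // (a : k) ∈ parallelogram (τ₁ : k) (τ₂ : k)}

/-- The point `x + i τ₁ + l τ₂` of the cone. -/
def basePoint {p : ℕ} (s : ParallelogramPoint τ₁ τ₂ × Fin p × Fin p) : I :=
  s.1.1 + (s.2.1 : ℕ) • τ₁ + (s.2.2 : ℕ) • τ₂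

/-- The point `x + (i + p n) τ₁ + (l + p m) τ₂` of the cone. -/
def conePoint {p : ℕ} (a : (ParallelogramPoint τ₁ τ₂ × Fin p × Fin p) × ℕ × ℕ) : I :=
  basePoint a.1 + (p * a.2.1) • τ₁ + (p * a.2.2) • τ₂

theorem coe_basePoint {p : ℕ} (s : ParallelogramPoint τ₁ τ₂ × Fin p × Fin p) :
    (basePoint s : k) = (s.1.1 : k) + ((s.2.1 : ℕ) : k) * (τ₁ : k) + ((s.2.2 : ℕ) : k) * (τ₂ : k) := by
  simp [basePoint]

theorem coe_conePoint {p : ℕ} (a : (ParallelogramPoint τ₁ τ₂ × Fin p × Fin p) × ℕ × ℕ) :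
    (conePoint a : k) = (a.1.1.1 : k) + ((a.1.2.1 + p * a.2.1 : ℕ) : k) * (τ₁ : k) +
      ((a.1.2.2 + p * a.2.2 : ℕ) : k) * (τ₂ : k) := by
  rw [conePoint]
  simp only [Submodule.coe_add, coe_basePoint, Submodule.coe_smul_of_tower, nsmul_eq_mul]
  push_cast
  ring

theorem conePoint_mem_cone {p : ℕ} (a : (ParallelogramPoint τ₁ τ₂ × Fin p × Fin p) × ℕ × ℕ) :
    (conePoint a : k) ∈ cone (τ₁ : k) (τ₂ : k) := by
  obtain ⟨r, t, hr, -, ht, -, h⟩ := a.1.1.2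
  refine ⟨r + (a.1.2.1 + p * a.2.1 : ℕ), t + (a.1.2.2 + p * a.2.2 : ℕ), by positivity, by positivity, ?_⟩
  rw [coe_conePoint, h]
  push_cast
  ring

theorem eq_of_add_natCast_eq {r r' : ℚ} {R R' : ℕ} (h : r + R = r' + R') (h1 : r - r' < 1)
    (h2 : r' - r < 1) : r = r' ∧ R = R' := by
  have h3 : (R : ℚ) < R' + 1 := by linarith
  have h4 : (R' : ℚ) < R + 1 := by linarith
  have h5 : R = R' := by
    have h3' : R < R' + 1 := by exact_mod_cast h3
    have h4' : R' < R + 1 := by exact_mod_cast h4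
    omega
  subst h5
  exact ⟨by linarith, rfl⟩

theorem eq_of_fin_add_mul_eq {p : ℕ} {i i' : Fin p} {n n' : ℕ}
    (h : (i : ℕ) + p * n = i' + p * n') : i = i' ∧ n = n' := by
  have hp : 0 < p := i.pos
  have h1 := congrArg (· % p) h
  have h2 := congrArg (· / p) h
  simp only [Nat.add_mul_mod_self_left, Nat.mod_eq_of_lt i.2, Nat.mod_eq_of_lt i'.2] at h1
  simp only [Nat.add_mul_div_left _ _ hp, Nat.div_eq_of_lt i.2, Nat.div_eq_of_lt i'.2, zero_add] at h2
  exact ⟨Fin.ext h1, h2⟩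

theorem conePoint_injective {p : ℕ} (hτ : LinearIndependent ℚ ![(τ₁ : k), (τ₂ : k)]) :
    Function.Injective (conePoint (τ₁ := τ₁) (τ₂ := τ₂) (p := p)) := by
  rintro ⟨⟨x, i, l⟩, n, m⟩ ⟨⟨x', i', l'⟩, n', m'⟩ h
  obtain ⟨r, t, hr, hr1, ht, ht1, hx⟩ := x.2
  obtain ⟨r', t', hr', hr1', ht', ht1', hx'⟩ := x'.2
  have h1 := congrArg (fun a : I => (a : k)) h
  simp only [coe_conePoint, hx, hx'] at h1
  obtain ⟨h2, h3⟩ := eq_of_ratCast_mul_add_eq hτ (r := r + (i + p * n : ℕ)) (t := t + (l + p * m : ℕ))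
    (r' := r' + (i' + p * n' : ℕ)) (t' := t' + (l' + p * m' : ℕ)) (by
      push_cast at h1 ⊢
      linear_combination h1)
  obtain ⟨rfl, h4⟩ := eq_of_add_natCast_eq h2 (by linarith) (by linarith)
  obtain ⟨rfl, h5⟩ := eq_of_add_natCast_eq h3 (by linarith) (by linarith)
  obtain ⟨rfl, rfl⟩ := eq_of_fin_add_mul_eq h4
  obtain ⟨rfl, rfl⟩ := eq_of_fin_add_mul_eq h5
  have : x = x' := Subtype.ext (Subtype.ext (hx.trans hx'.symm))
  rw [this]

theorem exists_conePoint_eq {p : ℕ} (hp : 0 < p) {a : I} (ha : (a : k) ∈ cone (τ₁ : k) (τ₂ : k)) :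
    ∃ b : (ParallelogramPoint τ₁ τ₂ × Fin p × Fin p) × ℕ × ℕ, conePoint b = a := by
  obtain ⟨r, t, hr, ht, h⟩ := ha
  -- The first coordinate of the parallelogram runs over `(0, 1]`, hence `⌈r⌉ - 1`; the second runs
  -- over `[0, 1)`, hence the floor of `t`.
  obtain ⟨R, hR1, hR2⟩ : ∃ R : ℕ, (R : ℚ) < r ∧ r ≤ R + 1 := by
    refine ⟨⌈r⌉₊ - 1, ?_, ?_⟩
    · refine Nat.lt_ceil.1 (Nat.sub_lt (Nat.ceil_pos.2 hr) one_pos)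
    · have : 1 ≤ ⌈r⌉₊ := Nat.ceil_pos.2 hr
      rw [Nat.cast_sub this]
      simpa using Nat.le_ceil r
  have hT1 := Nat.floor_le ht
  have hT2 := Nat.lt_floor_add_one t
  set T := ⌊t⌋₊
  let x : I := a - R • τ₁ - T • τ₂
  have hx : (x : k) ∈ parallelogram (τ₁ : k) (τ₂ : k) := by
    refine ⟨r - R, t - T, by linarith, by linarith, by linarith, by linarith, ?_⟩
    simp only [x, Submodule.coe_sub, Submodule.coe_smul_of_tower, nsmul_eq_mul, h]
    push_cast
    ring
  refine ⟨((⟨x, hx⟩, ⟨R % p, Nat.mod_lt _ hp⟩, ⟨T % p, Nat.mod_lt _ hp⟩), R / p, T / p), Subtype.ext ?_⟩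
  rw [coe_conePoint]
  simp only [Nat.mod_add_div, x, Submodule.coe_sub, Submodule.coe_smul_of_tower, nsmul_eq_mul]
  ring

theorem map_pos_of_mem_cone (φ : k →+* ℝ) {t₁ t₂ x : k} (h₁ : 0 < φ t₁) (h₂ : 0 < φ t₂)
    (hx : x ∈ cone t₁ t₂) : 0 < φ x := by
  obtain ⟨r, t, hr, ht, rfl⟩ := hx
  rw [map_add, map_mul, map_mul, map_ratCast, map_ratCast]
  have : (0 : ℝ) < r := by exact_mod_cast hr
  have : (0 : ℝ) ≤ t := by exact_mod_cast ht
  positivity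

theorem basePoint_mem_cone {p : ℕ} (s : ParallelogramPoint τ₁ τ₂ × Fin p × Fin p) :
    (basePoint s : k) ∈ cone (τ₁ : k) (τ₂ : k) := by
  have := conePoint_mem_cone (s, (0, 0))
  simpa [conePoint] using this

/-- After multiplication by a common denominator of `I`, the points become algebraic integers all of
whose conjugates are bounded. -/
theorem finite_parallelogramPoint {k : Type*} [Field k] [NumberField k]
    (I : FractionalIdeal (𝓞 k)⁰ k) (τ₁ τ₂ : (I : Submodule (𝓞 k) k)) :
    Finite (ParallelogramPoint τ₁ τ₂) := by
  obtain ⟨d, hd, hdI⟩ := I.isFractional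
  have hd0 : (d : k) ≠ 0 := by
    have := nonZeroDivisors.ne_zero hd
    exact_mod_cast this
  set B : ℝ := ∑ φ : k →+* ℂ, ‖φ d‖ * (‖φ τ₁‖ + ‖φ τ₂‖)
  have hfin := NumberField.Embeddings.finite_of_norm_le k ℂ B
  have : Finite {x : k | IsIntegral ℤ x ∧ ∀ φ : k →+* ℂ, ‖φ x‖ ≤ B} := hfin
  refine Finite.of_injective (β := {x : k | IsIntegral ℤ x ∧ ∀ φ : k →+* ℂ, ‖φ x‖ ≤ B})
    (fun a => ⟨(d : k) * (a.1 : k), ?_, fun φ => ?_⟩) fun a b hab => ?_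
  · obtain ⟨e, he⟩ := hdI a.1 a.1.2
    rw [Algebra.smul_def] at he
    have h1 : (d : k) * (a.1 : k) = e := he.symm
    rw [h1]
    exact e.isIntegral_coe
  · obtain ⟨r, t, hr, hr1, ht, ht1, h⟩ := a.2
    refine le_trans ?_ (Finset.single_le_sum (f := fun φ : k →+* ℂ => ‖φ d‖ * (‖φ τ₁‖ + ‖φ τ₂‖))
      (fun φ _ => by positivity) (Finset.mem_univ φ))
    rw [map_mul, norm_mul, h, map_add, map_mul, map_mul, map_ratCast, map_ratCast]
    refine mul_le_mul_of_nonneg_left ((norm_add_le _ _).trans (add_le_add ?_ ?_)) (norm_nonneg _)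
    · rw [norm_mul]
      refine mul_le_of_le_one_left (norm_nonneg _) ?_
      rw [Complex.norm_ratCast, abs_of_pos (by exact_mod_cast hr)]
      exact_mod_cast hr1
    · rw [norm_mul]
      refine mul_le_of_le_one_left (norm_nonneg _) ?_
      rw [Complex.norm_ratCast, abs_of_nonneg (by exact_mod_cast ht)]
      exact_mod_cast ht1.le
  · have h1 : (d : k) * (a.1 : k) = d * (b.1 : k) := congrArg Subtype.val hab
    exact Subtype.ext (Subtype.ext (mul_left_cancel₀ hd0 h1))

end

/-! ### Products over the embeddings of a quadratic field -/

section

instance isAlgClosed_qBar : IsAlgClosed QBar :=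
  (algebraicClosure.isAlgClosure ℚ ℂ).isAlgClosed

variable {k : Type*} [Field k] [NumberField k] {A : Type*} [Field A] [CharZero A] [IsAlgClosed A]

theorem prod_embeddings_eq (hk : Module.finrank ℚ k = 2) {σ₀ σ₁ : k →+* A} (hne : σ₀ ≠ σ₁) {M : Type*}
    [CommMonoid M] (g : (k →+* A) → M) : ∏ σ, g σ = g σ₀ * g σ₁ := by
  classical
  have hu : (Finset.univ : Finset (k →+* A)) = {σ₀, σ₁} := by
    refine (Finset.eq_univ_of_card _ ?_).symm
    rw [Finset.card_pair hne, NumberField.Embeddings.card, hk]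
  rw [hu, Finset.prod_pair hne]

theorem forall_embeddings_iff (hk : Module.finrank ℚ k = 2) {σ₀ σ₁ : k →+* A} (hne : σ₀ ≠ σ₁)
    (P : (k →+* A) → Prop) : (∀ σ, P σ) ↔ P σ₀ ∧ P σ₁ := by
  classical
  have hu : (Finset.univ : Finset (k →+* A)) = {σ₀, σ₁} := by
    refine (Finset.eq_univ_of_card _ ?_).symm
    rw [Finset.card_pair hne, NumberField.Embeddings.card, hk]
  refine ⟨fun h => ⟨h _, h _⟩, fun h σ => ?_⟩
  have := Finset.mem_univ σ
  rw [hu, Finset.mem_insert, Finset.mem_singleton] at this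
  rcases this with rfl | rfl
  · exact h.1
  · exact h.2

theorem exists_ne_embeddings (hk : Module.finrank ℚ k = 2) (A : Type*) [Field A] [CharZero A]
    [IsAlgClosed A] : ∃ ι : Fin 2 → (k →+* A), ι 0 ≠ ι 1 := by
  have hcard := NumberField.Embeddings.card k A
  rw [hk] at hcard
  obtain ⟨ψ, ψ', hne⟩ := Fintype.exists_pair_of_one_lt_card (α := k →+* A) (by omega)
  exact ⟨![ψ, ψ'], hne⟩

end

end ConeZeta

namespace ConeZeta

/-! ### The complex partial zeta function -/

section

variable {k : Type*} [Field k] [NumberField k] {I : Submodule (𝓞 k) k} {τ₁ τ₂ : I}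

/-- The regularised value at `-N` of the sum of `ξ(a) / (ι₁(a) ι₂(a)) ^ s` over the translates of a
base point by multiples of `p τ₁` and `p τ₂`. -/
noncomputable def baseValue {p : ℕ} (ξ : AddChar I QBar) (N : ℕ)
    (s : ParallelogramPoint τ₁ τ₂ × Fin p × Fin p) : QBar :=
  ξ (basePoint s) * regularizedSum (ξ τ₁ ^ p) (ξ τ₂ ^ p) (2 * N + 1) fun n m =>
    (∏ σ : k →+* QBar, linForm (σ (basePoint s : k)) (σ (p * (τ₁ : k))) (σ (p * (τ₂ : k))) n m) ^ N

open Classical in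
/-- The value at `-N` of the partial zeta function, as an algebraic number. -/
noncomputable def zetaValue (p : ℕ) [Fintype (ParallelogramPoint τ₁ τ₂)] (ξ : AddChar I QBar) (N : ℕ) :
    QBar :=
  ∑ s : ParallelogramPoint τ₁ τ₂ × Fin p × Fin p,
    if p ∣ principalIndex (basePoint s) then 0 else baseValue ξ N s

theorem linForm_map {K L : Type*} [CommRing K] [CommRing L] (φ : K →+* L) (x u v : K) (n m : ℕ) :
    φ (linForm x u v n m) = linForm (φ x) (φ u) (φ v) n m := by
  simp [linForm]

theorem map_conePoint {L : Type*} [CommRing L] {p : ℕ} (φ : k →+* L)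
    (s : ParallelogramPoint τ₁ τ₂ × Fin p × Fin p) (n m : ℕ) : φ (conePoint (s, (n, m)) : k) =
      linForm (φ (basePoint s : k)) (φ (p * (τ₁ : k))) (φ (p * (τ₂ : k))) n m := by
  rw [← linForm_map, coe_conePoint, coe_basePoint, linForm]
  congr 1
  push_cast
  ring

theorem addChar_conePoint {p : ℕ} (ξ : AddChar I QBar)
    (s : ParallelogramPoint τ₁ τ₂ × Fin p × Fin p) (n m : ℕ) : ξ (conePoint (s, (n, m))) =
      ξ (basePoint s) * ((ξ τ₁ ^ p) ^ n * (ξ τ₂ ^ p) ^ m) := by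
  rw [conePoint, AddChar.map_add_eq_mul, AddChar.map_add_eq_mul, AddChar.map_nsmul_eq_pow,
    AddChar.map_nsmul_eq_pow, pow_mul, pow_mul, mul_assoc]

omit [NumberField k] in
theorem exists_real_embedding [NumberField.IsTotallyReal k] (φ : k →+* ℂ) :
    ∃ ρ : k →+* ℝ, ∀ x, φ x = (ρ x : ℂ) := by
  have h := NumberField.IsTotallyReal.complexEmbedding_isReal φ
  exact ⟨h.embedding, fun x => (h.coe_embedding_apply x).symm⟩

variable [NumberField.IsTotallyReal k] (hk : Module.finrank ℚ k = 2) (ξ : AddChar I QBar)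
  {f : ℕ} (hf : f ≠ 0) (hξ : ∀ x, ξ x ^ f = 1) (hτ₁ : TotallyPositive (τ₁ : k))
  (hτ₂ : TotallyPositive (τ₂ : k)) {p : ℕ} (hp : 0 < p) (hξτ₁ : ξ τ₁ ^ p ≠ 1) (hξτ₂ : ξ τ₂ ^ p ≠ 1)

include hk hf hξ hτ₁ hτ₂ hp hξτ₁ hξτ₂ in
theorem exists_entire_basePoint (s : ParallelogramPoint τ₁ τ₂ × Fin p × Fin p) :
    ∃ Z : ℂ → ℂ, Differentiable ℂ Z ∧ (∀ z : ℂ, 1 < z.re →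
      HasSum (fun n : ℕ × ℕ => zetaTerm ξ z (conePoint (s, n))) (Z z)) ∧
      ∀ N : ℕ, Z (-N) = (baseValue ξ N s : QBar) := by
  obtain ⟨ι, hι⟩ := exists_ne_embeddings hk QBar
  choose ρ hρ using fun i => exists_real_embedding ((algebraMap QBar ℂ).comp (ι i))
  have hι' : (algebraMap QBar ℂ).comp (ι 0) ≠ (algebraMap QBar ℂ).comp (ι 1) := fun h =>
    hι (RingHom.ext fun x => (algebraMap QBar ℂ).injective (RingHom.congr_fun h x))
  have hnorm : ∀ a, ‖((ξ a : QBar) : ℂ)‖ = 1 := fun a =>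
    Complex.norm_eq_one_of_pow_eq_one (n := f) (by exact_mod_cast congrArg (algebraMap QBar ℂ) (hξ a)) hf
  have hne : ∀ {x : QBar}, x ≠ 1 → (x : ℂ) ≠ 1 := fun hx h => hx (by exact_mod_cast h)
  have hp0 : (0 : ℝ) < p := by exact_mod_cast hp
  obtain ⟨Z, hZ, hZs, hZN⟩ := exists_entire_doubleSeries
    (α := ((ξ τ₁ ^ p : QBar) : ℂ)) (β := ((ξ τ₂ ^ p : QBar) : ℂ))
    (by push_cast; rw [norm_pow, hnorm, one_pow]) (hne hξτ₁)
    (by push_cast; rw [norm_pow, hnorm, one_pow]) (hne hξτ₂)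
    (x := fun i => ρ i (basePoint s : k)) (u := fun i => ρ i (p * (τ₁ : k))) (v := fun i => ρ i (p * (τ₂ : k)))
    (fun i => map_pos_of_mem_cone (ρ i) (hτ₁ _) (hτ₂ _) (basePoint_mem_cone s))
    (fun i => by rw [map_mul, map_natCast]; exact mul_pos hp0 (hτ₁ _))
    (fun i => by rw [map_mul, map_natCast]; exact mul_pos hp0 (hτ₂ _))
  refine ⟨fun z => (ξ (basePoint s) : QBar) * Z z, hZ.const_mul _, fun z hz => ?_, fun N => ?_⟩
  · refine (congrArg (fun f => HasSum f _) (funext fun n => ?_)).mpr ((hZs z hz).mul_left _)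
    obtain ⟨n, m⟩ := n
    rw [zetaTerm, prod_embeddings_eq hk hι', hρ, hρ, map_conePoint, map_conePoint, addChar_conePoint]
    push_cast
    rw [mul_div_assoc]
  · simp only
    rw [hZN, baseValue]
    have h1 := map_regularizedSum (algebraMap QBar ℂ) (ξ τ₁ ^ p) (ξ τ₂ ^ p) (2 * N + 1) fun n m =>
      (∏ σ : k →+* QBar, linForm (σ (basePoint s : k)) (σ (p * (τ₁ : k))) (σ (p * (τ₂ : k))) n m) ^ N
    have h3 : (fun n m => (algebraMap QBar ℂ)
        ((∏ σ : k →+* QBar, linForm (σ (basePoint s : k)) (σ (p * (τ₁ : k))) (σ (p * (τ₂ : k))) n m) ^ N)) =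
        fun n m => (linForm ((ρ 0 (basePoint s : k) : ℝ) : ℂ) (ρ 0 (p * (τ₁ : k)) : ℝ) (ρ 0 (p * (τ₂ : k)) : ℝ) n m *
          linForm ((ρ 1 (basePoint s : k) : ℝ) : ℂ) (ρ 1 (p * (τ₁ : k)) : ℝ) (ρ 1 (p * (τ₂ : k)) : ℝ) n m) ^ N := by
      funext n m
      rw [map_pow, prod_embeddings_eq hk hι, map_mul, linForm_map, linForm_map]
      simp only [← hρ]
      rfl
    rw [← h3]
    exact congrArg (fun x : ℂ => (ξ (basePoint s) : QBar) * x) h1.symm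

include hk hf hξ hτ₁ hτ₂ hp hξτ₁ hξτ₂ in
-- By `hdvd` the summation condition is constant on each progression, so the series is the sum of
-- the double series over the admissible base points, and the continuations add up.
theorem exists_isPartialZeta [Fintype (ParallelogramPoint τ₁ τ₂)]
    (hτ : LinearIndependent ℚ ![(τ₁ : k), (τ₂ : k)])
    (hdvd : ∀ (s : ParallelogramPoint τ₁ τ₂ × Fin p × Fin p) (n : ℕ × ℕ),
      p ∣ principalIndex (conePoint (s, n)) ↔ p ∣ principalIndex (basePoint s)) :
    ∃ Z : ℂ → ℂ, IsPartialZeta p ξ τ₁ τ₂ Z ∧ ∀ N : ℕ, Z (-N) = (zetaValue (τ₁ := τ₁) (τ₂ := τ₂) p ξ N : QBar) := by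
  classical
  choose Z hZ hZs hZN using exists_entire_basePoint hk ξ hf hξ hτ₁ hτ₂ hp hξτ₁ hξτ₂
  set W : ℂ → ℂ := fun z => ∑ s, if p ∣ principalIndex (basePoint s) then 0 else Z s z with hW
  have hdiff : Differentiable ℂ W := by
    refine Differentiable.fun_sum fun s _ => ?_
    split_ifs
    · exact differentiable_const 0
    · exact hZ s
  have han : ∀ z, AnalyticAt ℂ W z := fun z =>
    (hdiff.differentiableOn (s := Set.univ)).analyticAt Filter.univ_mem
  refine ⟨W, ⟨fun z hz => ?_, fun z _ => (han z).meromorphicAt, fun m _ => han m⟩, fun N => ?_⟩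
  · refine (hasSum_subtype_iff_indicator (f := zetaTerm ξ z)).2 ?_
    rw [← (conePoint_injective (p := p) hτ).hasSum_iff]
    · have hslice : ∀ s : ParallelogramPoint τ₁ τ₂ × Fin p × Fin p,
          HasSum (fun a : (ParallelogramPoint τ₁ τ₂ × Fin p × Fin p) × ℕ × ℕ =>
            if a.1 = s then (if p ∣ principalIndex (basePoint s) then 0 else zetaTerm ξ z (conePoint a)) else 0)
            (if p ∣ principalIndex (basePoint s) then 0 else Z s z) := by
        intro s
        have hinj : Function.Injective (Prod.mk s : ℕ × ℕ → _) := Prod.mk_right_injective s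
        rw [← hinj.hasSum_iff]
        · simp only [Function.comp_def, if_true]
          split_ifs
          · exact hasSum_zero
          · exact hZs s z hz
        · intro a ha
          rw [if_neg]
          rintro rfl
          exact ha ⟨a.2, rfl⟩
      refine (congrArg (fun f => HasSum f _) (funext fun a => ?_)).mpr
        (hasSum_sum (s := Finset.univ) fun s _ => hslice s)
      rw [Finset.sum_ite_eq, if_pos (Finset.mem_univ _), Function.comp_apply, Set.indicator_apply]
      have hiff : conePoint a ∈ summationSet p τ₁ τ₂ ↔ ¬ p ∣ principalIndex (basePoint a.1) := by
        rw [← hdvd a.1 a.2]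
        exact and_iff_right (conePoint_mem_cone a)
      simp only [hiff]
      split_ifs <;> rfl
    · intro a ha
      refine Set.indicator_of_notMem (fun h => ha ?_) _
      exact exists_conePoint_eq hp h.1
  · rw [hW, zetaValue]
    push_cast
    refine Finset.sum_congr rfl fun s _ => ?_
    split_ifs
    · rfl
    · exact hZN s N

end

end ConeZeta

namespace ConeZeta

/-! ### The coefficients of the cone series in `ℂ_p` -/

section

open MvPowerSeries IsDedekindDomain

theorem map_inv_mvPowerSeries {K L : Type*} [Field K] [Field L] (φ : K →+* L)
    {F : MvPowerSeries (Fin 2) K} (hF : constantCoeff F ≠ 0) :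
    MvPowerSeries.map φ F⁻¹ = (MvPowerSeries.map φ F)⁻¹ := by
  rw [MvPowerSeries.eq_inv_iff_mul_eq_one, ← map_mul, MvPowerSeries.inv_mul_cancel _ hF, map_one]
  rw [constantCoeff_map]
  exact (map_ne_zero φ).2 hF

variable {p : ℕ} [hp : Fact p.Prime] {k : Type*} [Field k] [NumberField k]
  {I : Submodule (𝓞 k) k} {τ₁ τ₂ : I} [Fintype (ParallelogramPoint τ₁ τ₂)]
  {ξ : AddChar I QBar} (hξτ₁ : ξ τ₁ ≠ 1) (hξτ₂ : ξ τ₂ ≠ 1)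
  (hξτ₁' : ξ τ₁ ^ p ≠ 1) (hξτ₂' : ξ τ₂ ^ p ≠ 1) (ι : Fin 2 → (k →+* QBar)) (j : QBar →+* ℂ_[p])

/-- The contribution of a base point to the cone series. -/
noncomputable def baseSeries (ξ : AddChar I QBar) (ι : Fin 2 → (k →+* QBar)) (j : QBar →+* ℂ_[p])
    (s : ParallelogramPoint τ₁ τ₂ × Fin p × Fin p) : MvPowerSeries (Fin 2) ℂ_[p] :=
  quotientSeries (j (ξ (basePoint s))) (j (ξ τ₁ ^ p)) (j (ξ τ₂ ^ p))
    (fun i => j (ι i (basePoint s : k))) (fun i => j (ι i (p * (τ₁ : k))))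
    (fun i => j (ι i (p * (τ₂ : k))))

theorem sum_geom_mul_inv {S : Type*} [CommRing S] (c a b : S) (p : ℕ) :
    (∑ i : Fin p, ∑ l : Fin p, c * a ^ (i : ℕ) * b ^ (l : ℕ)) * ((1 - a) * (1 - b)) =
      c * ((1 - a ^ p) * (1 - b ^ p)) := by
  have h : ∀ x : S, (∑ i : Fin p, x ^ (i : ℕ)) * (1 - x) = 1 - x ^ p := fun x => by
    rw [Fin.sum_univ_eq_sum_range (fun i => x ^ i) p, geom_sum_mul_neg]
  have h1 : (∑ i : Fin p, ∑ l : Fin p, c * a ^ (i : ℕ) * b ^ (l : ℕ)) =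
      c * ((∑ i : Fin p, a ^ (i : ℕ)) * ∑ l : Fin p, b ^ (l : ℕ)) := by
    rw [Finset.sum_mul_sum, Finset.mul_sum]
    refine Finset.sum_congr rfl fun i _ => ?_
    rw [Finset.mul_sum]
    exact Finset.sum_congr rfl fun l _ => mul_assoc _ _ _
  rw [h1, ← h, ← h]
  ring

omit hp in
theorem mul_sum_mul_eq {S ι : Type*} [CommRing S] [Fintype ι] (b : S) (e : ι → S) {u v d d' : S}
    (hd : d * ((1 - u) * (1 - v)) = 1) (hd' : ((1 - u ^ p) * (1 - v ^ p)) * d' = 1) :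
    b * ((∑ x, e x) * d) =
      ∑ s : ι × Fin p × Fin p, b * e s.1 * u ^ (s.2.1 : ℕ) * v ^ (s.2.2 : ℕ) * d' := by
  have h : ∀ x, ∑ s : Fin p × Fin p, b * e x * u ^ (s.1 : ℕ) * v ^ (s.2 : ℕ) * d' = b * e x * d := by
    intro x
    rw [← Finset.sum_mul, Fintype.sum_prod_type]
    have h1 := sum_geom_mul_inv (b * e x) u v p
    set t := ∑ i : Fin p, ∑ l : Fin p, b * e x * u ^ (i : ℕ) * v ^ (l : ℕ)
    linear_combination (-t * d') * hd + (d * d') * h1 + (b * e x * d) * hd'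
  rw [Fintype.sum_prod_type, Fintype.sum_congr _ _ h, ← mul_assoc,
    Finset.mul_sum, Finset.sum_mul]

include hξτ₁ hξτ₂ hξτ₁' hξτ₂' in
-- Multiplying numerator and denominator by `∑ U ^ i`, `i < p`, replaces `1 - U` by `1 - U ^ p`, and
-- likewise for `V`. The new numerators are the base points, and the increments are now divisible by
-- `p`.
theorem sum_baseSeries : ((1 + X 0) * (1 + X 1))⁻¹ * MvPowerSeries.map j (coneSeries ξ τ₁ τ₂ ι) =
    ∑ s : ParallelogramPoint τ₁ τ₂ × Fin p × Fin p, baseSeries ξ ι j s := by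
  have hj : ∀ {x : QBar}, x ≠ 1 → (1 : ℂ_[p]) - j x ≠ 0 := fun hx h =>
    hx (j.injective (by rw [map_one]; exact (sub_eq_zero.1 h).symm))
  have hq : ∀ {x : QBar}, x ≠ 1 → (1 : QBar) - x ≠ 0 := fun hx => sub_ne_zero.2 (Ne.symm hx)
  set U : MvPowerSeries (Fin 2) ℂ_[p] := C (j (ξ τ₁)) * binomSeries fun i => j (ι i (τ₁ : k)) with hU
  set V : MvPowerSeries (Fin 2) ℂ_[p] := C (j (ξ τ₂)) * binomSeries fun i => j (ι i (τ₂ : k)) with hV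
  have hnat : ∀ (n : ℕ) (x : k), (fun i => j (ι i (n * x))) = n • fun i => j (ι i x) := by
    intro n x
    ext i
    simp
  have hpow : ∀ (a : QBar) (x : k), C (j (a ^ p)) * binomSeries (fun i => j (ι i (p * x))) =
      (C (j a) * binomSeries fun i => j (ι i x)) ^ p := by
    intro a x
    rw [hnat, binomSeries_nsmul, map_pow, map_pow, mul_pow]
  have hU0 : constantCoeff U = j (ξ τ₁) := by
    rw [hU, map_mul, constantCoeff_C, constantCoeff_binomSeries, mul_one]
  have hV0 : constantCoeff V = j (ξ τ₂) := by
    rw [hV, map_mul, constantCoeff_C, constantCoeff_binomSeries, mul_one]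
  have hD : constantCoeff ((1 - U) * (1 - V)) ≠ 0 := by
    rw [map_mul, map_sub, map_sub, hU0, hV0, map_one]
    exact mul_ne_zero (hj hξτ₁) (hj hξτ₂)
  have hDp : constantCoeff ((1 - U ^ p) * (1 - V ^ p)) ≠ 0 := by
    rw [map_mul, map_sub, map_sub, map_pow, map_pow, hU0, hV0, map_one, ← map_pow j, ← map_pow j]
    exact mul_ne_zero (hj hξτ₁') (hj hξτ₂')
  have hmap : MvPowerSeries.map j (coneSeries ξ τ₁ τ₂ ι) =
      (∑ x : ParallelogramPoint τ₁ τ₂, C (j (ξ x.1)) * binomSeries fun i => j (ι i (x.1 : k))) *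
        ((1 - U) * (1 - V))⁻¹ := by
    rw [coneSeries, map_mul, map_inv_mvPowerSeries]
    · simp only [finsum_eq_sum_of_fintype, map_sum, map_mul, map_sub, map_one, map_C,
        binomialProd_eq, map_binomSeries]
      rfl
    · rw [map_mul, binomialProd_eq, binomialProd_eq, constantCoeff_one_sub_mul_binomSeries,
        constantCoeff_one_sub_mul_binomSeries]
      exact mul_ne_zero (hq hξτ₁) (hq hξτ₂)
  have hbase : ∀ s : ParallelogramPoint τ₁ τ₂ × Fin p × Fin p, baseSeries ξ ι j s =
      (binomSeries (-1) * (C (j (ξ s.1.1)) * binomSeries fun i => j (ι i (s.1.1 : k)))) *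
        U ^ (s.2.1 : ℕ) * V ^ (s.2.2 : ℕ) * ((1 - U ^ p) * (1 - V ^ p))⁻¹ := by
    intro s
    rw [baseSeries, quotientSeries, hpow, hpow]
    congr 1
    have h1 : (fun i => j (ι i (basePoint s : k))) - 1 = -1 + (fun i => j (ι i (s.1.1 : k))) +
        (s.2.1 : ℕ) • (fun i => j (ι i (τ₁ : k))) + (s.2.2 : ℕ) • (fun i => j (ι i (τ₂ : k))) := by
      rw [← hnat, ← hnat]
      ext i
      simp only [Pi.add_apply, Pi.sub_apply, Pi.neg_apply, Pi.one_apply, coe_basePoint, map_add]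
      ring
    rw [h1, binomSeries_add, binomSeries_add, binomSeries_add, binomSeries_nsmul, binomSeries_nsmul,
      basePoint, AddChar.map_add_eq_mul, AddChar.map_add_eq_mul, AddChar.map_nsmul_eq_pow,
      AddChar.map_nsmul_eq_pow, hU, hV]
    simp only [map_mul, map_pow, mul_pow]
    ring
  rw [inv_one_add_X_mul, hmap, Fintype.sum_congr _ _ hbase]
  exact mul_sum_mul_eq _ _ (MvPowerSeries.inv_mul_cancel _ hD) (MvPowerSeries.mul_inv_cancel _ hDp)

include hξτ₁ hξτ₂ hξτ₁' hξτ₂' in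
theorem coneCoeff_eq_sum (n : ℕ × ℕ) : coneCoeff ξ τ₁ τ₂ ι j n.1 n.2 =
    ∑ s : ParallelogramPoint τ₁ τ₂ × Fin p × Fin p, coeff (expo n) (baseSeries ξ ι j s) := by
  rw [coneCoeff, sum_baseSeries hξτ₁ hξτ₂ hξτ₁' hξτ₂', map_sum]
  rfl

end

section

open MvPowerSeries IsDedekindDomain

variable {p : ℕ} [hp : Fact p.Prime] {k : Type*} [Field k] [NumberField k]
  {I : Submodule (𝓞 k) k} {τ₁ τ₂ : I}
  (hk : Module.finrank ℚ k = 2) {ξ : AddChar I QBar} {f : ℕ} (hf : f ≠ 0) (hpf : ¬ p ∣ f)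
  (hξ : ∀ x, ξ x ^ f = 1) (hξτ₁ : ξ τ₁ ^ p ≠ 1) (hξτ₂ : ξ τ₂ ^ p ≠ 1)
  (hint : ∀ (ψ : k →+* ℂ_[p]) (x : I), ∃ z : ℤ_[p], intToComplex p z = ψ (x : k))
  {ι : Fin 2 → (k →+* QBar)} (hι : ι 0 ≠ ι 1) (j : QBar →+* ℂ_[p])

include hf hpf hξ hξτ₁ hξτ₂ hint in
theorem coeff_baseSeries_mem (s : ParallelogramPoint τ₁ τ₂ × Fin p × Fin p) (n : ℕ × ℕ) :
    coeff (expo n) (baseSeries ξ ι j s) ∈ cyclotomicInts p f := by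
  have hj : ∀ {x : QBar}, x ≠ 1 → j x ≠ 1 := fun hx h => hx (j.injective (h.trans (map_one j).symm))
  have hpow : ∀ x, j (ξ x) ^ f = 1 := fun x => by rw [← map_pow, hξ, map_one]
  have hpow' : ∀ x, j (ξ x ^ p) ^ f = 1 := fun x => by rw [map_pow, pow_right_comm, hpow, one_pow]
  choose z hz using fun (x : I) (i : Fin 2) => hint (j.comp (ι i)) x
  have := coeff_quotientSeries_mem hf hpf (hpow (basePoint s)) (hpow' τ₁) (hpow' τ₂) (hj hξτ₁)
    (hj hξτ₂) (z (basePoint s)) (fun i => p * z τ₁ i) (fun i => p * z τ₂ i) (expo n)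
  simp only [map_mul, map_natCast, hz] at this
  simpa [baseSeries] using this

include hk hf hpf hξ hξτ₁ hξτ₂ hint hι in
-- The unit condition at the two embeddings `j ∘ ι i` is the index condition. When it holds, both
-- sides are images of one regularised sum over `QBar`; otherwise both vanish.
theorem pairing_baseSeries (s : ParallelogramPoint τ₁ τ₂ × Fin p × Fin p)
    (hs : ¬ p ∣ principalIndex (basePoint s) ↔ ∀ ψ : k →+* ℂ_[p], ‖ψ (basePoint s : k)‖ = 1)
    [Decidable (p ∣ principalIndex (basePoint s))] (N : ℕ) :
    pairing (fun n => coeff (expo n) (baseSeries ξ ι j s)) (unitPow p N) =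
      j (if p ∣ principalIndex (basePoint s) then 0 else baseValue ξ N s) := by
  have hj : ∀ {x : QBar}, x ≠ 1 → j x ≠ 1 := fun hx h => hx (j.injective (h.trans (map_one j).symm))
  have hpow : ∀ x, j (ξ x) ^ f = 1 := fun x => by rw [← map_pow, hξ, map_one]
  have hpow' : ∀ x, j (ξ x ^ p) ^ f = 1 := fun x => by rw [map_pow, pow_right_comm, hpow, one_pow]
  choose z hz using fun (x : I) (i : Fin 2) => hint (j.comp (ι i)) x
  have key := pairing_quotientSeries_unitPow hf hpf (hpow (basePoint s)) (hpow' τ₁) (hpow' τ₂) (hj hξτ₁)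
    (hj hξτ₂) (z (basePoint s)) (z τ₁) (z τ₂) N
  have hne : j.comp (ι 0) ≠ j.comp (ι 1) := fun h =>
    hι (RingHom.ext fun x => j.injective (RingHom.congr_fun h x))
  have hcond : (‖z (basePoint s) 0‖ = 1 ∧ ‖z (basePoint s) 1‖ = 1) ↔
      ¬ p ∣ principalIndex (basePoint s) := by
    rw [hs, ← norm_intToComplex, ← norm_intToComplex, hz, hz]
    exact (forall_embeddings_iff hk hne fun ψ => ‖ψ (basePoint s : k)‖ = 1).symm
  have hb : baseSeries ξ ι j s = quotientSeries (j (ξ (basePoint s))) (j (ξ τ₁ ^ p)) (j (ξ τ₂ ^ p))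
      (fun i => intToComplex p (z (basePoint s) i)) (fun i => intToComplex p (p * z τ₁ i))
      (fun i => intToComplex p (p * z τ₂ i)) := by
    simp [baseSeries, hz]
  rw [hb, key]
  simp only [hcond]
  rw [ite_not]
  split_ifs with h
  · rw [map_zero]
  · rw [baseValue, map_mul j, map_regularizedSum]
    congr 2
    funext n m
    rw [map_pow j, prod_embeddings_eq hk hι, map_mul j, linForm_map, linForm_map]
    simp only [map_mul, hz, map_natCast]
    rfl

end

end ConeZeta

/-! ### Assembly of the complex and `p`-adic sides -/

namespace ConeZeta

section

open IsDedekindDomain MvPowerSeries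

variable {p : ℕ} [hp : Fact p.Prime] {k : Type*} [Field k] [NumberField k]

theorem ne_zero_of_mem_cone [NumberField.IsTotallyReal k] {t₁ t₂ x : k} (h₁ : TotallyPositive t₁)
    (h₂ : TotallyPositive t₂) (hx : x ∈ cone t₁ t₂) : x ≠ 0 := by
  obtain ⟨ρ, -⟩ := exists_real_embedding (Classical.arbitrary (k →+* ℂ))
  rintro rfl
  have := map_pos_of_mem_cone ρ (h₁ ρ) (h₂ ρ) hx
  rw [map_zero] at this
  exact lt_irrefl _ this

theorem norm_conePoint_eq_one_iff {I : Submodule (𝓞 k) k} {τ₁ τ₂ : I}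
    (hint : ∀ (ψ : k →+* ℂ_[p]) (x : I), ∃ z : ℤ_[p], intToComplex p z = ψ (x : k))
    (ψ : k →+* ℂ_[p]) (s : ParallelogramPoint τ₁ τ₂ × Fin p × Fin p) (n : ℕ × ℕ) :
    ‖ψ (conePoint (s, n) : k)‖ = 1 ↔ ‖ψ (basePoint s : k)‖ = 1 := by
  choose z hz using hint ψ
  obtain ⟨n, m⟩ := n
  rw [map_conePoint, map_mul, map_mul, map_natCast, ← hz, ← hz, ← hz, ← map_natCast (intToComplex p),
    ← map_mul, ← map_mul, ← linForm_map, norm_intToComplex, norm_intToComplex, norm_linForm_eq_one_iff]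

end

end ConeZeta

theorem theorem3
    -- a real quadratic field, a nonzero fractional ideal `I`, a character `ξ` of `I` with values
    -- in the roots of unity, whose annihilator `𝔣` is a proper ideal, and `𝔣 ∩ ℤ = f ℤ`
    {k : Type*} [Field k] [NumberField k] [NumberField.IsTotallyReal k]
    (hk : Module.finrank ℚ k = 2)
    (I : FractionalIdeal (𝓞 k)⁰ k) (hI : I ≠ 0)
    (ξ : AddChar (I : Submodule (𝓞 k) k) ConeZeta.QBar) (hξ : ∀ x, IsOfFinOrder (ξ x))
    (𝔣 : Ideal (𝓞 k)) (h𝔣 : ConeZeta.annihilator ξ = 𝔣) (h𝔣_proper : 𝔣 ≠ ⊤)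
    (f : ℕ) (hf_pos : 0 < f) (hf : 𝔣.comap (algebraMap ℤ (𝓞 k)) = Ideal.span {(f : ℤ)})
    -- two independent totally positive elements of `I` outside the kernel of `ξ`
    (τ₁ τ₂ : (I : Submodule (𝓞 k) k))
    (hτ₁ : ConeZeta.TotallyPositive (τ₁ : k)) (hτ₂ : ConeZeta.TotallyPositive (τ₂ : k))
    (hτ : LinearIndependent ℚ ![(τ₁ : k), (τ₂ : k)])
    (hξτ₁ : ξ τ₁ ≠ 1) (hξτ₂ : ξ τ₂ ≠ 1)
    -- a prime number `p`, prime to `𝔣` and to `I`, that splits in `k`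
    (p : ℕ) [Fact p.Prime]
    (hp𝔣 : IsCoprime (Ideal.span {(p : 𝓞 k)}) 𝔣)
    (𝔭₁ 𝔭₂ : IsDedekindDomain.HeightOneSpectrum (𝓞 k)) (h𝔭 : 𝔭₁ ≠ 𝔭₂)
    (hsplit : Ideal.span {(p : 𝓞 k)} = 𝔭₁.asIdeal * 𝔭₂.asIdeal)
    (hI𝔭₁ : FractionalIdeal.count k 𝔭₁ I = 0) (hI𝔭₂ : FractionalIdeal.count k 𝔭₂ I = 0) :
    -- the complex function, with algebraic values at the points of `M(p)`
    ∃ (Z : ℂ → ℂ) (_ : ConeZeta.IsPartialZeta p ξ τ₁ τ₂ Z)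
      (hZ : ∀ m ∈ ConeZeta.interpolationSet p, Z m ∈ ConeZeta.QBar),
      ∀ j : ConeZeta.QBar →+* ℂ_[p],
        -- existence and uniqueness of the interpolation
        (∃! z : ConeZeta.interpolationDomain p → ℂ_[p], ConeZeta.IsInterpolation j Z hZ z) ∧
        -- integrality of the coefficients, and the value at `1`
        ∀ ι : Fin 2 → (k →+* ConeZeta.QBar), ι 0 ≠ ι 1 →
          (∀ i l : ℕ, ConeZeta.coneCoeff ξ τ₁ τ₂ ι j i l ∈ ConeZeta.cyclotomicInts p f) ∧
          ∀ z : ConeZeta.interpolationDomain p → ℂ_[p], ConeZeta.IsInterpolation j Z hZ z →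
            HasSum
              (fun n : ℕ × ℕ => 1 / (p : ℂ_[p]) ^ 2 *
                (ConeZeta.rootSum p (n.1 + 1) * ConeZeta.rootSum p (n.2 + 1) *
                  ConeZeta.coneCoeff ξ τ₁ τ₂ ι j n.1 n.2 /
                    (((n.1 : ℂ_[p]) + 1) * ((n.2 : ℂ_[p]) + 1))))
              (z ⟨1, ConeZeta.one_mem_interpolationDomain p⟩) ∧
            z ⟨1, ConeZeta.one_mem_interpolationDomain p⟩ ∈ ConeZeta.cyclotomicInts p f := by
  have hf0 : f ≠ 0 := hf_pos.ne'
  have hpP : p.Prime := Fact.out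
  have hpf := ConeZeta.not_dvd_of_isCoprime hpP hf_pos hf hp𝔣
  have hξf := ConeZeta.character_pow_eq_one h𝔣 hf
  have hξτ₁' := ConeZeta.pow_prime_ne_one hpP hpf (hξf τ₁) hξτ₁
  have hξτ₂' := ConeZeta.pow_prime_ne_one hpP hpf (hξf τ₂) hξτ₂
  have hint : ∀ (ψ : k →+* ℂ_[p]) (x : (I : Submodule (𝓞 k) k)),
      ∃ z : ℤ_[p], ConeZeta.intToComplex p z = ψ (x : k) := fun ψ x =>
    ConeZeta.exists_intToComplex_eq_of_mem hk h𝔭 hsplit hI𝔭₁ hI𝔭₂ ψ x.2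
  have := ConeZeta.finite_parallelogramPoint I τ₁ τ₂
  have : Fintype (ConeZeta.ParallelogramPoint τ₁ τ₂) := Fintype.ofFinite _
  have hindex : ∀ a : (I : Submodule (𝓞 k) k), (a : k) ∈ ConeZeta.cone (τ₁ : k) (τ₂ : k) →
      (¬ p ∣ ConeZeta.principalIndex a ↔ ∀ ψ : k →+* ℂ_[p], ‖ψ (a : k)‖ = 1) := fun a ha =>
    ConeZeta.not_dvd_principalIndex_iff hk h𝔭 hsplit hI hI𝔭₁ hI𝔭₂
      (ConeZeta.ne_zero_of_mem_cone hτ₁ hτ₂ ha)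
  have hdvd : ∀ (s : ConeZeta.ParallelogramPoint τ₁ τ₂ × Fin p × Fin p) (n : ℕ × ℕ),
      p ∣ ConeZeta.principalIndex (ConeZeta.conePoint (s, n)) ↔
        p ∣ ConeZeta.principalIndex (ConeZeta.basePoint s) := by
    intro s n
    rw [← not_iff_not, hindex _ (ConeZeta.conePoint_mem_cone _), hindex _ (ConeZeta.basePoint_mem_cone s)]
    exact forall_congr' fun ψ => ConeZeta.norm_conePoint_eq_one_iff hint ψ s n
  obtain ⟨Z, hZ, hZN⟩ := ConeZeta.exists_isPartialZeta hk ξ hf0 hξf hτ₁ hτ₂ hpP.pos hξτ₁' hξτ₂' hτ hdvd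
  have hZm : ∀ m ∈ ConeZeta.interpolationSet p,
      Z m = (ConeZeta.zetaValue (τ₁ := τ₁) (τ₂ := τ₂) p ξ (-m).toNat : ConeZeta.QBar) := by
    intro m hm
    rw [← hZN]
    congr 1
    have h1 : (((-m).toNat : ℤ) : ℂ) = ((-m : ℤ) : ℂ) := by
      rw [Int.toNat_of_nonneg (by linarith [hm.1])]
    push_cast at h1
    rw [h1, neg_neg]
  refine ⟨Z, hZ, fun m hm => by rw [hZm m hm]; exact Subtype.mem _, fun j => ?_⟩
  -- The coefficients depend on the ordering `ι`, but the pairings with power functions do not. So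
  -- one interpolation serves both orderings.
  have main : ∀ ι : Fin 2 → (k →+* ConeZeta.QBar), ι 0 ≠ ι 1 →
      (∀ n : ℕ × ℕ, ConeZeta.coneCoeff ξ τ₁ τ₂ ι j n.1 n.2 ∈ ConeZeta.cyclotomicInts p f) ∧
      ∀ N : ℕ, ConeZeta.pairing (fun n => ConeZeta.coneCoeff ξ τ₁ τ₂ ι j n.1 n.2) (ConeZeta.unitPow p N) =
        j (ConeZeta.zetaValue (τ₁ := τ₁) (τ₂ := τ₂) p ξ N) := by
    classical
    intro ι hι
    have hmem := ConeZeta.coeff_baseSeries_mem hf0 hpf hξf hξτ₁' hξτ₂' hint (ι := ι) j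
    have hsum := ConeZeta.coneCoeff_eq_sum hξτ₁ hξτ₂ hξτ₁' hξτ₂' ι j
    refine ⟨fun n => ?_, fun N => ?_⟩
    · rw [hsum]
      exact Subring.sum_mem _ fun s _ => hmem s n
    · rw [funext hsum, ConeZeta.pairing_sum _ fun s _ n =>
        ConeZeta.norm_le_one_of_mem_cyclotomicInts hf0 (hmem s n), ConeZeta.zetaValue, map_sum]
      refine Finset.sum_congr rfl fun s _ => ?_
      rw [ConeZeta.pairing_baseSeries hk hf0 hpf hξf hξτ₁' hξτ₂' hint hι j s
        (hindex _ (ConeZeta.basePoint_mem_cone s))]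
  have hnorm : ∀ ι : Fin 2 → (k →+* ConeZeta.QBar), ι 0 ≠ ι 1 → ∀ n : ℕ × ℕ,
      ‖ConeZeta.coneCoeff ξ τ₁ τ₂ ι j n.1 n.2‖ ≤ 1 := fun ι hι n =>
    ConeZeta.norm_le_one_of_mem_cyclotomicInts hf0 ((main ι hι).1 n)
  have hval : ∀ ι : Fin 2 → (k →+* ConeZeta.QBar), ι 0 ≠ ι 1 → ∀ (m : ConeZeta.interpolationSet p)
      (h : Z (m : ℤ) ∈ ConeZeta.QBar), j ⟨Z (m : ℤ), h⟩ =
        ConeZeta.pairingValue (fun n => ConeZeta.coneCoeff ξ τ₁ τ₂ ι j n.1 n.2) m := by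
    intro ι hι m h
    rw [ConeZeta.pairingValue, (main ι hι).2]
    exact congrArg j (Subtype.ext (hZm m m.2))
  refine ⟨?_, fun ι hι => ⟨fun i l => (main ι hι).1 (i, l), fun z hz => ?_⟩⟩
  -- Existence needs the coefficients of only one ordering, chosen arbitrarily.
  · obtain ⟨ι, hι⟩ := ConeZeta.exists_ne_embeddings hk ConeZeta.QBar
    obtain ⟨z, hzc, hz⟩ := ConeZeta.exists_continuous_interpolation (hnorm ι hι)
    refine ⟨z, ⟨hzc, fun m hm => ?_⟩, fun z' hz' => ?_⟩
    · exact (hz ⟨m, hm⟩).trans (hval ι hι ⟨m, hm⟩ _).symm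
    · refine ConeZeta.eq_of_interpolates hz'.continuous hzc fun m => ?_
      rw [hz, ← hval ι hι m]
      exact hz'.interpolates m m.2
  · have hone := ConeZeta.interpolation_one (hnorm ι hι) hz.continuous fun m =>
      (hz.interpolates m m.2).trans (hval ι hι m _)
    rw [hone]
    exact ⟨ConeZeta.hasSum_pairing_unitInv (hnorm ι hι),
      ConeZeta.pairing_mem_cyclotomicInts hf0 (main ι hι).1 _⟩
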